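/- Let $\langle\cdot,\cdot\rangle$ be the form $x_1y_1+x_2y_2-x_3y_3-x_4y_4$ on $\mathbb R^4$, let $\mathbb{A}\mathrm{dS}=\{[x]\in\mathbb{RP}^3: \langle x,x\rangle<0\}$ be anti-de Sitter space and $\partial\mathbb{A}\mathrm{dS}=\{[x]:\langle x,x\rangle=0\}$. The universal cover is $\mathbb H^2\times\mathbb R$ (with boundary $\partial\mathbb H^2\times\mathbb R$), with covering map $p([y_1:y_2:y_3],t)=[y_1:y_2:y_3\cos t:y_3\sin t]$ and the pulled-back Lorentzian metric, time-oriented by increasing $t$. For a point $x$ let $P_x=\mathrm P(x^\perp)$ be its dual plane; the spacelike planes are the sets $P_w\cap\mathbb{A}\mathrm{dS}$ with $w\in\mathbb{A}\mathrm{dS}$. A *proper achronal meridian* is an embedded circle $\Lambda\subset\partial\mathbb{A}\mathrm{dS}$ such that, for some $w\in\mathbb{A}\mathrm{dS}$, $\Lambda\cap P_w=\emptyset$ and no two points of $\Lambda$ are joined by a timelike path in the complement of $P_w$. Its *invisible domain* $\Omega(\Lambda)$ is the image under $p$ of the set of points of the universal cover that are joined by no causal path to a lift $\widetilde\Lambda$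 of $\Lambda$. A subset of $\mathbb{RP}^3$ is *convex* if it is contained in an affine chart and convex there, and *properly convex* if it is moreover compactly contained in an affine chart. $C(\Lambda)$ is the convex hull of $\Lambda$ in an affine chart containing $\Lambda$. **Theorem.** Let $\Lambda$ be a proper achronal meridian. 1. $\Omega(\Lambda)$ is convex. If $\Lambda$ is not the boundary of a spacelike plane, then $\Omega(\Lambda)$ is properly convex. 2. $\Omega(\Lambda)=\{x\in\mathbb{A}\mathrm{dS}: P_x\cap\Lambda=\emptyset\}$. 3. There is an affine chart containing $\Lambda$. For $C(\Lambda)$ taken in any such chart and every $x\in\mathbb{A}\mathrm{dS}$: $x\in\Omega(\Lambda)$ if and only if $P_x\cap C(\Lambda)=\emptyset$; and $x\in C(\Lambda)$ if and only if $P_x\cap\Omega(\Lambda)=\emptyset$. 4. Suppose that $\Lambda$ is not the boundary of a spacelike plane, and let $x\in\mathbb{A}\mathrm{dS}$. Then $x\in\partial_\pm\Omega(\Lambda)$ if and only if $P_x$ is a support plane for $\partial_\mp C(\Lambda)$, and $x\in\partial_\pm C(\Lambda)$ if and only if $P_x$ is a support plane for $\partial_\mp\Omega(\Lambda)$. In 4,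 $\partial_\pm\Omega(\Lambda)=S_\pm(\Lambda)$ is the set of points of $\mathbb{A}\mathrm{dS}$ in the image under $p$ of the graph of $f_\pm$, where $\widetilde\Lambda$ is the graph of $f$, $f_+(y)=\inf_\xi\,(f(\xi)+d(\xi,y))$, $f_-(y)=\sup_\xi\,(f(\xi)-d(\xi,y))$ and $d$ is the hemispherical distance on $\mathbb H^2\cup\partial\mathbb H^2$. The set $\partial_-C(\Lambda)$ (resp. $\partial_+C(\Lambda)$) consists of the points $y\notin\Lambda$ of the frontier of $C(\Lambda)$ such that, for each support plane of $C(\Lambda)$ at $y$, the lift of $C(\Lambda)$ lies in $I^+(\widetilde P)\cup\widetilde P$ (resp. $I^-(\widetilde P)\cup\widetilde P$), $\widetilde P$ being the lift of that plane through the lift of $y$. For $K=C(\Lambda)$ or $K=\overline{\Omega(\Lambda)}$, the plane $P_x$ is a support plane for the past (resp. future) boundary of $K$ if it is a support plane of $K$ and some lift $\widetilde P$ of $P_x$ touches a lift $\widetilde K$ of $K$ with $\widetilde K\subset I^+(\widetilde P)\cup\widetilde P$ (resp. $\widetilde K\subset I^-(\widetilde P)\cup\widetilde P$). -/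

import Mathlib

open Set Topology

noncomputable section

namespace AdS

/-! ### The projective model -/

/-- The vector space underlying `ℝ^{2,2}`. -/
abbrev V : Type := Fin 4 → ℝ

/-- The symmetric bilinear form of signature `(2,2)`. -/
def form (x y : V) : ℝ := x 0 * y 0 + x 1 * y 1 - x 2 * y 2 - x 3 * y 3

/-- Real projective 3-space. -/
abbrev RP3 : Type := Projectivization ℝ V

/-- The quotient topology of `V ∖ {0}`. -/
instance instTopologicalSpaceRP3 : TopologicalSpace RP3 :=
  TopologicalSpace.coinduced (Projectivization.mk' ℝ : { v : V // v ≠ 0 } → RP3) inferInstance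

/-- Anti-de Sitter space: the projectivization of the set of timelike vectors. -/
def space : Set RP3 := {x | form x.rep x.rep < 0}

/-- Its boundary: the projectivization of the set of lightlike vectors. -/
def boundary : Set RP3 := {x | form x.rep x.rep = 0}

/-- The plane `P_x = P(x^⊥)` dual to the point `x`, as a full projective plane of `RP3`. -/
def dualPlane (x : RP3) : Set RP3 := {y | form x.rep y.rep = 0}

/-- `Λ` is the boundary at infinity of a spacelike plane. The spacelike planes are the
sets `dualPlane w ∩ space` with `w ∈ space` (a 3-dimensional subspace has signature `(2,1)` iff
it is orthogonal to a timelike vector). -/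
def BoundsSpacelikePlane (Λ : Set RP3) : Prop :=
  ∃ w ∈ space, Λ = dualPlane w ∩ boundary

/-! ### Convexity in projective space -/

/-- The affine chart of `RP3` given by a linear form `f`: the complement of the projective plane
`f = 0`. (It is empty for `f = 0`, so a nonempty set that it contains forces `f ≠ 0`.) -/
def affineChart (f : V →ₗ[ℝ] ℝ) : Set RP3 := {x | f x.rep ≠ 0}

/-- The part of `X` in the affine chart of `f`, seen in the affine hyperplane `f = 1` of `V`
with which that chart is identified. -/
def slice (f : V →ₗ[ℝ] ℝ) (X : Set RP3) : Set V :=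
  {v | f v = 1 ∧ ∃ hv : v ≠ 0, Projectivization.mk ℝ v hv ∈ X}

/-- `X` is contained in an affine chart and convex there. -/
def IsConvex (X : Set RP3) : Prop :=
  ∃ f : V →ₗ[ℝ] ℝ, f ≠ 0 ∧ X ⊆ affineChart f ∧ Convex ℝ (slice f X)

/-- `X` is convex and moreover compactly contained in an affine chart. -/
def IsProperConvex (X : Set RP3) : Prop :=
  IsConvex X ∧ ∃ f : V →ₗ[ℝ] ℝ, f ≠ 0 ∧ IsCompact (closure X) ∧ closure X ⊆ affineChart f

/-- The convex hull of `X`, taken in the affine chart of `f`. -/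
def hullIn (f : V →ₗ[ℝ] ℝ) (X : Set RP3) : Set RP3 :=
  {x | ∃ v ∈ convexHull ℝ (slice f X), ∃ hv : v ≠ 0, Projectivization.mk ℝ v hv = x}

/-! ### The universal cover with its boundary -/

/-- Ambient space of the universal cover: a point `(κ, t)` consists of a point `κ` of the plane
carrying the Klein (projective) model of the hyperbolic plane, and a real number `t`. -/
abbrev Cyl : Type := EuclideanSpace ℝ (Fin 2) × ℝ

/-- The universal cover `ℍ² × ℝ` of anti-de Sitter space. -/
def cover : Set Cyl := {z | ‖z.1‖ < 1}

/-- The universal cover together with its boundary. -/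
def closedCover : Set Cyl := {z | ‖z.1‖ ≤ 1}

/-- The vector `(κ₁, κ₂, cos t, sin t)`. -/
def vec (z : Cyl) : V := ![z.1 0, z.1 1, Real.cos z.2, Real.sin z.2]

theorem vec_ne_zero (z : Cyl) : vec z ≠ 0 := by
  intro h
  have h2 : Real.cos z.2 = 0 := by simpa [vec] using congrFun h 2
  have h3 : Real.sin z.2 = 0 := by simpa [vec] using congrFun h 3
  have := Real.sin_sq_add_cos_sq z.2
  rw [h2, h3] at this
  norm_num at this

/-- The covering map `(κ, t) ↦ [κ₁ : κ₂ : cos t : sin t]`. -/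
def proj (z : Cyl) : RP3 := Projectivization.mk ℝ (vec z) (vec_ne_zero z)

/-- The anti-de Sitter metric `g_{ℍ²} - y₃² dt²` on the universal cover at the point `z = (κ, t)`,
evaluated on the tangent vector `u = (k, s)`; here `y₃² = 1 / (1 - ‖κ‖²)` and `g_{ℍ²}` is the
hyperbolic metric of the Klein model. -/
def metric (z u : Cyl) : ℝ :=
  ‖u.1‖ ^ 2 / (1 - ‖z.1‖ ^ 2) + (inner ℝ z.1 u.1) ^ 2 / (1 - ‖z.1‖ ^ 2) ^ 2
    - u.2 ^ 2 / (1 - ‖z.1‖ ^ 2)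

/-- `c`, restricted to `[0,1]`, is a path in the universal cover whose endpoints may lie
on the boundary. -/
def IsPath (c : ℝ → Cyl) : Prop :=
  ContinuousOn c (Icc 0 1) ∧ ContDiffOn ℝ 1 c (Ioo 0 1) ∧ ∀ τ ∈ Ioo (0 : ℝ) 1, c τ ∈ cover

/-- A timelike path. -/
def IsTimelike (c : ℝ → Cyl) : Prop :=
  IsPath c ∧ ∀ τ ∈ Ioo (0 : ℝ) 1, metric (c τ) (deriv c τ) < 0

/-- A causal path: its velocity is nonzero and timelike or lightlike. -/
def IsCausal (c : ℝ → Cyl) : Prop :=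
  IsPath c ∧ ∀ τ ∈ Ioo (0 : ℝ) 1, deriv c τ ≠ 0 ∧ metric (c τ) (deriv c τ) ≤ 0

/-- The chronological future `I⁺(A)`. (The coordinate `t` is strictly monotone along a
timelike path.) -/
def chronFuture (A : Set Cyl) : Set Cyl :=
  {y | ∃ c, IsTimelike c ∧ c 0 ∈ A ∧ c 1 = y ∧ (c 0).2 < (c 1).2}

/-- The chronological past `I⁻(A)`. -/
def chronPast (A : Set Cyl) : Set Cyl :=
  {y | ∃ c, IsTimelike c ∧ c 0 ∈ A ∧ c 1 = y ∧ (c 1).2 < (c 0).2}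

/-- The invisible domain of a subset `X` of the universal cover with its boundary: the points
of the universal cover connected to `X` by no causal path. -/
def coverInvisible (X : Set Cyl) : Set Cyl :=
  {z | z ∈ cover ∧ z ∉ X ∧ ∀ c, IsCausal c → c 0 = z → c 1 ∉ X}

/-- `K'` is a lift of `K` to the universal cover with its boundary: the image of a continuous
section over `K` of the covering map. -/
def IsLift (K' : Set Cyl) (K : Set RP3) : Prop :=
  ∃ s : RP3 → Cyl, ContinuousOn s K ∧ (∀ x ∈ K, s x ∈ closedCover ∧ proj (s x) = x) ∧ K' = s '' K

/-! ### Proper achronal meridians and their invisible domains -/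

/-- There is a spacelike plane `P`, here `dualPlane w`, disjoint from `X` together with its
closure and such that no two points of `X` are joined by a timelike path in the complement
of `P`. -/
def IsProperAchronal (X : Set RP3) : Prop :=
  X ⊆ space ∪ boundary ∧ ∃ w ∈ space, Disjoint X (dualPlane w) ∧
    ∀ c, IsTimelike c → (∀ τ ∈ Icc (0 : ℝ) 1, proj (c τ) ∉ dualPlane w) →
      ¬ (proj (c 0) ∈ X ∧ proj (c 1) ∈ X)

/-- A proper achronal embedded circle in the boundary of anti-de Sitter space. -/
def IsProperAchronalMeridian (Λ : Set RP3) : Prop :=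
  Λ ⊆ boundary ∧ IsProperAchronal Λ ∧ ∃ γ : Circle → RP3, IsEmbedding γ ∧ range γ = Λ

/-- The invisible domain `Ω(Λ)`: the image under the covering map of the invisible domain of
a lift of `Λ` (two lifts of a meridian differ by a deck transformation, so that the choice of
the lift is immaterial). -/
def invisibleDomain (Λ : Set RP3) : Set RP3 :=
  {x | ∃ L, IsLift L Λ ∧ x ∈ proj '' coverInvisible L}

/-! ### Boundary components and support planes -/

/-- The hemispherical distance, in terms of the Klein coordinate `κ` of the point
`(κ, √(1 - ‖κ‖²))` of the closed hemisphere. -/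
def hemiDist (p q : EuclideanSpace ℝ (Fin 2)) : ℝ :=
  Real.arccos (inner ℝ p q + √(1 - ‖p‖ ^ 2) * √(1 - ‖q‖ ^ 2))

/-- `S₊(X)` in the universal cover: the graph of `y ↦ inf (f(x) + d(x, y))`, where `X` is the
graph of `f`. -/
def coverSPlus (X : Set Cyl) : Set Cyl :=
  {z | z ∈ closedCover ∧ IsGLB ((fun y : Cyl => y.2 + hemiDist y.1 z.1) '' X) z.2}

/-- `S₋(X)` in the universal cover: the graph of `y ↦ sup (f(x) - d(x, y))`, where `X` is the
graph of `f`. -/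
def coverSMinus (X : Set Cyl) : Set Cyl :=
  {z | z ∈ closedCover ∧ IsLUB ((fun y : Cyl => y.2 - hemiDist y.1 z.1) '' X) z.2}

/-- The future boundary component `∂₊Ω(Λ) = S₊(Λ)` of the invisible domain, in anti-de Sitter
space. -/
def SPlus (Λ : Set RP3) : Set RP3 := {x | x ∈ space ∧ ∃ L, IsLift L Λ ∧ x ∈ proj '' coverSPlus L}

/-- The past boundary component `∂₋Ω(Λ) = S₋(Λ)` of the invisible domain, in anti-de Sitter
space. -/
def SMinus (Λ : Set RP3) : Set RP3 := {x | x ∈ space ∧ ∃ L, IsLift L Λ ∧ x ∈ proj '' coverSMinus L}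

/-- The plane `P_n` is a support plane of `K`: it meets `K`, and in an affine chart containing
`K` it has `K` on one side. -/
def IsSupportPlane (n : RP3) (K : Set RP3) : Prop :=
  (dualPlane n ∩ K).Nonempty ∧ ∃ f : V →ₗ[ℝ] ℝ, K ⊆ affineChart f ∧
    ((∀ v ∈ slice f K, form n.rep v ≤ 0) ∨ (∀ v ∈ slice f K, 0 ≤ form n.rep v))

/-- For `z` in the universal cover this is the spacelike plane `P_z⁺` (with its boundary) of the
points at timelike distance `π/2` in the future of `z`; for `z` on the boundary it is the lightlike
plane with past vertex `z` and future vertex the next point with the same image as `z`.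
When `z` runs over the points with image `n`, these sets are all the lifts of the spacelike or
lightlike plane `P_n`. -/
def planeLift (z : Cyl) : Set Cyl :=
  {y | y ∈ closedCover ∧ form (vec z) (vec y) = 0 ∧ z.2 ≤ y.2 ∧ y.2 ≤ z.2 + Real.pi}

/-- `P_n` is a support plane of `K` on its past side: a lift of `P_n` touches the lift `K'` of
`K`, and `K'` lies in the future of that lift of `P_n`. -/
def IsPastSupportPlane (n : RP3) (K : Set RP3) : Prop :=
  IsSupportPlane n K ∧ ∃ K', IsLift K' K ∧ ∃ z ∈ closedCover, proj z = n ∧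
    (planeLift z ∩ K').Nonempty ∧ K' ⊆ chronFuture (planeLift z) ∪ planeLift z

/-- `P_n` is a support plane of `K` on its future side. -/
def IsFutureSupportPlane (n : RP3) (K : Set RP3) : Prop :=
  IsSupportPlane n K ∧ ∃ K', IsLift K' K ∧ ∃ z ∈ closedCover, proj z = n ∧
    (planeLift z ∩ K').Nonempty ∧ K' ⊆ chronPast (planeLift z) ∪ planeLift z

/-- The past boundary component `∂₋K` of a convex set `K` containing `Λ`: the points `x` of the
frontier of `K`, not in `Λ`, such that for each support plane touching `K` at `x`, the lift of `K`
lies in the future of the lift of the plane that touches it at the lift of `x`. -/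
def pastBoundary (K Λ : Set RP3) : Set RP3 :=
  {x | x ∈ K ∧ x ∈ frontier K ∧ x ∉ Λ ∧ ∀ K', IsLift K' K → ∀ y ∈ K', proj y = x →
    ∀ z ∈ closedCover, IsSupportPlane (proj z) K → y ∈ planeLift z →
      K' ⊆ chronFuture (planeLift z) ∪ planeLift z}

/-- The future boundary component `∂₊K` of a convex set `K` containing `Λ`. -/
def futureBoundary (K Λ : Set RP3) : Set RP3 :=
  {x | x ∈ K ∧ x ∈ frontier K ∧ x ∉ Λ ∧ ∀ K', IsLift K' K → ∀ y ∈ K', proj y = x →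
    ∀ z ∈ closedCover, IsSupportPlane (proj z) K → y ∈ planeLift z →
      K' ⊆ chronPast (planeLift z) ∪ planeLift z}

end AdS

end

open Set Topology

namespace AdS

/-! The metric of the universal cover is conformal to hemisphere × ℝ, so causality compares time
differences with spherical distances, and `form (vec z) (vec y) = ⟨z.1, y.1⟩ - cos (z.2 - y.2)`
turns such comparisons into signs of the bilinear form. Along a causal path the elapsed time is at
least the hemispherical distance (`IsCausal.exists_sign_hemiDist_le`), and great-circle paths to
boundary points show that this bound is sharp. Hence `z` is invisible from a lift `L` of `Λ` exactly
when `|z.2 - y.2| < arccos ⟨z.1, y.1⟩` for all `y ∈ L` (`mem_coverInvisible_iff`), which makes the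
form negative on `L`. Conversely, if the dual plane of a point of anti-de Sitter space misses `Λ`,
the form has constant sign on the connected set `L`, and connectedness also removes the ambiguity of
time modulo 2π. This is the description of the invisible domain by dual planes.

The rest is duality of convex cones. A lift of a proper achronal meridian is the graph of a
1-Lipschitz function on the whole circle (`IsProperAchronalMeridian.isMeridianLift`). The vectors
pairing strictly negatively with `vec '' L` project onto the invisible domain, which is therefore
convex, with closure the projectivization of `dualCone L`. By Hahn–Banach the bidual `hullCone L`
projects onto the convex hull in every chart containing `Λ`, and the Lipschitz property gives
`hullCone L ⊆ dualCone L`. If `Λ` does not bound a spacelike plane, then `vec '' L` spans, and some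
`w` in the dual cone is negative on all its nonzero vectors
(`IsMeridianLift.exists_form_neg_dualCone`): one affine chart contains both projectivized cones,
compactly.

For the boundary components, a support plane of one cone is dual to a boundary vector of the other.
It remains to tell past from future. On the face cut out of a cone by the plane dual to a point of
the cover, the signed time difference to that point cannot reach 0 or π, so its sign is constant
(`IsMeridianLift.eq_arccos_of_mem_face`). A sign `e = ±1` treats both time directions at once; the
two dualities are `isSignedHorizon_iff` and `isSignedBoundary_iff`. -/

/-! ### Angles and the hemisphere -/

/-- The point of the closed hemisphere with Klein coordinate `p`, in a three-dimensional subspace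
of `ℝ⁴`. -/
noncomputable def hemi (p : EuclideanSpace ℝ (Fin 2)) : EuclideanSpace ℝ (Fin 4) :=
  !₂[p 0, p 1, √(1 - ‖p‖ ^ 2), 0]

/-- The point with Klein coordinate `p` in another hemisphere of `S³` with the same boundary. -/
noncomputable def coHemi (p : EuclideanSpace ℝ (Fin 2)) : EuclideanSpace ℝ (Fin 4) :=
  !₂[p 0, p 1, 0, √(1 - ‖p‖ ^ 2)]

theorem inner_eq_sum (p q : EuclideanSpace ℝ (Fin 2)) :
    inner ℝ p q = p 0 * q 0 + p 1 * q 1 := by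
  simp [PiLp.inner_apply, Fin.sum_univ_two, mul_comm]

theorem norm_sq_eq_sum (p : EuclideanSpace ℝ (Fin 2)) : ‖p‖ ^ 2 = p 0 ^ 2 + p 1 ^ 2 := by
  simp [EuclideanSpace.norm_sq_eq, Fin.sum_univ_two]

theorem inner_hemi_hemi (p q : EuclideanSpace ℝ (Fin 2)) :
    inner ℝ (hemi p) (hemi q) = inner ℝ p q + √(1 - ‖p‖ ^ 2) * √(1 - ‖q‖ ^ 2) := by
  simp [hemi, PiLp.inner_apply, Fin.sum_univ_four, mul_comm]

theorem inner_coHemi_hemi (p q : EuclideanSpace ℝ (Fin 2)) :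
    inner ℝ (coHemi p) (hemi q) = inner ℝ p q := by
  simp [hemi, coHemi, PiLp.inner_apply, Fin.sum_univ_four, mul_comm]

theorem norm_hemi {p : EuclideanSpace ℝ (Fin 2)} (hp : ‖p‖ ≤ 1) : ‖hemi p‖ = 1 := by
  have h : 0 ≤ 1 - ‖p‖ ^ 2 := by nlinarith [norm_nonneg p]
  have : ‖hemi p‖ ^ 2 = 1 := by
    rw [EuclideanSpace.norm_sq_eq]
    simp [hemi, Fin.sum_univ_four, Real.sq_sqrt h]
    rw [norm_sq_eq_sum]; ring
  nlinarith [norm_nonneg (hemi p)]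

theorem norm_coHemi {p : EuclideanSpace ℝ (Fin 2)} (hp : ‖p‖ ≤ 1) : ‖coHemi p‖ = 1 := by
  have h : 0 ≤ 1 - ‖p‖ ^ 2 := by nlinarith [norm_nonneg p]
  have : ‖coHemi p‖ ^ 2 = 1 := by
    rw [EuclideanSpace.norm_sq_eq]
    simp [coHemi, Fin.sum_univ_four, Real.sq_sqrt h]
    rw [norm_sq_eq_sum]; ring
  nlinarith [norm_nonneg (coHemi p)]

theorem hemiDist_eq_angle {p q : EuclideanSpace ℝ (Fin 2)} (hp : ‖p‖ ≤ 1) (hq : ‖q‖ ≤ 1) :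
    hemiDist p q = InnerProductGeometry.angle (hemi p) (hemi q) := by
  rw [hemiDist, InnerProductGeometry.angle, norm_hemi hp, norm_hemi hq, inner_hemi_hemi]
  simp

theorem arccos_inner_eq_angle {p q : EuclideanSpace ℝ (Fin 2)} (hp : ‖p‖ ≤ 1) (hq : ‖q‖ ≤ 1) :
    Real.arccos (inner ℝ p q) = InnerProductGeometry.angle (coHemi p) (hemi q) := by
  rw [InnerProductGeometry.angle, norm_hemi hq, norm_coHemi hp, inner_coHemi_hemi]
  simp

theorem hemiDist_comm (p q : EuclideanSpace ℝ (Fin 2)) : hemiDist p q = hemiDist q p := by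
  rw [hemiDist, hemiDist, real_inner_comm, mul_comm]

/-- Triangle inequality in S³, with `k` on the second hemisphere so that the heights do not
contribute to its inner products. It says that the graph of `arccos ⟨k, ·⟩`, a lift of a dual plane,
is 1-Lipschitz and hence achronal. -/
theorem arccos_inner_le_add_hemiDist {k p q : EuclideanSpace ℝ (Fin 2)} (hk : ‖k‖ ≤ 1)
    (hp : ‖p‖ ≤ 1) (hq : ‖q‖ ≤ 1) :
    Real.arccos (inner ℝ k q) ≤ Real.arccos (inner ℝ k p) + hemiDist p q := by
  rw [arccos_inner_eq_angle hk hq, arccos_inner_eq_angle hk hp, hemiDist_eq_angle hp hq]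
  exact InnerProductGeometry.angle_le_angle_add_angle _ _ _

theorem hemiDist_eq_arccos {p q : EuclideanSpace ℝ (Fin 2)} (hp : ‖p‖ = 1) :
    hemiDist p q = Real.arccos (inner ℝ p q) := by
  simp [hemiDist, hp]

theorem angle_eq_two_mul_arcsin {E : Type*} [NormedAddCommGroup E] [InnerProductSpace ℝ E]
    {u v : E} (hu : ‖u‖ = 1) (hv : ‖v‖ = 1) :
    InnerProductGeometry.angle u v = 2 * Real.arcsin (‖u - v‖ / 2) := by
  have h1 := InnerProductGeometry.angle_nonneg u v
  have h2 := InnerProductGeometry.angle_le_pi u v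
  have hc : Real.cos (InnerProductGeometry.angle u v) = 1 - ‖u - v‖ ^ 2 / 2 := by
    rw [InnerProductGeometry.cos_angle, hu, hv, norm_sub_sq_real, hu, hv]; ring
  have hs : Real.sin (InnerProductGeometry.angle u v / 2) = ‖u - v‖ / 2 := by
    have h3 : 0 ≤ Real.sin (InnerProductGeometry.angle u v / 2) :=
      Real.sin_nonneg_of_nonneg_of_le_pi (by linarith) (by linarith)
    have h4 : Real.cos (InnerProductGeometry.angle u v)
        = 1 - 2 * Real.sin (InnerProductGeometry.angle u v / 2) ^ 2 := by
      have := Real.cos_two_mul (InnerProductGeometry.angle u v / 2)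
      rw [mul_div_cancel₀ _ (two_ne_zero)] at this
      nlinarith [Real.sin_sq_add_cos_sq (InnerProductGeometry.angle u v / 2)]
    have h5 := norm_nonneg (u - v)
    nlinarith
  rw [← hs, Real.arcsin_sin (by linarith) (by linarith)]; ring

/-- Since `arcsin` has derivative 1 at 0, angle and chord agree to first order, uniformly over the
sphere. -/
theorem exists_angle_le_mul_norm_sub {ε : ℝ} (hε : 0 < ε) : ∃ δ > 0,
    ∀ u v : EuclideanSpace ℝ (Fin 4), ‖u‖ = 1 → ‖v‖ = 1 → ‖u - v‖ < δ →
      InnerProductGeometry.angle u v ≤ (1 + ε) * ‖u - v‖ := by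
  have h : HasDerivAt Real.arcsin 1 0 := by
    simpa using Real.hasDerivAt_arcsin (x := 0) (by norm_num) (by norm_num)
  have h2 := (hasDerivAt_iff_isLittleO.1 h).def hε
  obtain ⟨δ, hδ, H⟩ := Metric.eventually_nhds_iff.1 h2
  refine ⟨δ, hδ, fun u v hu hv huv => ?_⟩
  have h3 := norm_nonneg (u - v)
  have h4 : dist (‖u - v‖ / 2) 0 < δ := by
    rw [Real.dist_eq, sub_zero, abs_of_nonneg (by positivity)]; linarith
  have h5 := H h4
  simp only [Real.arcsin_zero, sub_zero, smul_eq_mul, mul_one, Real.norm_eq_abs] at h5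
  rw [abs_of_nonneg (by positivity : 0 ≤ ‖u - v‖ / 2)] at h5
  rw [angle_eq_two_mul_arcsin hu hv]
  linarith [le_abs_self (Real.arcsin (‖u - v‖ / 2) - ‖u - v‖ / 2)]

/-- On the unit sphere, the angle between the endpoints of a curve is at most its length. -/
theorem angle_le_of_norm_deriv_le {u : ℝ → EuclideanSpace ℝ (Fin 4)}
    {u' : ℝ → EuclideanSpace ℝ (Fin 4)} {t t' : ℝ → ℝ} {a b : ℝ} (hab : a ≤ b)
    (hu : ∀ x ∈ Icc a b, HasDerivAt u (u' x) x) (hn : ∀ x ∈ Icc a b, ‖u x‖ = 1)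
    (ht : ∀ x ∈ Icc a b, HasDerivAt t (t' x) x) (h : ∀ x ∈ Icc a b, ‖u' x‖ ≤ t' x) :
    InnerProductGeometry.angle (u a) (u b) ≤ t b - t a := by
  have huc : ContinuousOn u (Icc a b) := fun x hx => (hu x hx).continuousAt.continuousWithinAt
  have hne : ∀ x ∈ Icc a b, u x ≠ 0 := fun x hx h0 => by
    have := hn x hx; rw [h0] at this; simp at this
  -- This form of the mean value inequality only asks for bounds on right slopes, so the angle need
  -- not be differentiable.
  refine image_le_of_liminf_slope_right_le_deriv_boundary
    (f := fun x => InnerProductGeometry.angle (u a) (u x)) (B := fun x => t x - t a) (B' := t')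
    (a := a) (b := b) ?_ ?_ ?_ ?_ ?_ (right_mem_Icc.2 hab)
  · intro x hx
    have h1 : ContinuousAt (fun y : EuclideanSpace ℝ (Fin 4) × EuclideanSpace ℝ (Fin 4) =>
      InnerProductGeometry.angle y.1 y.2) (u a, u x) :=
      InnerProductGeometry.continuousAt_angle (hne a (left_mem_Icc.2 hab)) (hne x hx)
    exact ContinuousAt.comp_continuousWithinAt (f := fun z => (u a, u z)) h1
      (continuousWithinAt_const.prodMk (huc x hx))
  · simp [InnerProductGeometry.angle_self (hne a (left_mem_Icc.2 hab))]
  · exact fun x hx => ((ht x hx).continuousAt.sub continuousAt_const).continuousWithinAt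
  · exact fun x hx => ((ht x (Ico_subset_Icc_self hx)).sub_const _).hasDerivWithinAt
  · intro x hx r hr
    have hx' := Ico_subset_Icc_self hx
    have h0 : ‖u' x‖ < r := (h x hx').trans_lt hr
    obtain ⟨r', h1, h2⟩ := exists_between h0
    have hr'0 : 0 < r' := (norm_nonneg _).trans_lt h1
    -- With this ε, `(1 + ε) * r'` is the midpoint of `r'` and `r`, still below `r`.
    obtain ⟨δ, hδ, H⟩ := exists_angle_le_mul_norm_sub (ε := (r - r') / (2 * r'))
      (div_pos (by linarith) (by linarith))
    have e1 : ∀ᶠ z in 𝓝[>] x, ‖z - x‖⁻¹ * ‖u z - u x‖ < r' :=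
      (hu x hx').hasDerivWithinAt.limsup_norm_slope_le h1
    have e2 : ∀ᶠ z in 𝓝[>] x, ‖u x - u z‖ < δ := by
      have : ContinuousAt (fun z => ‖u x - u z‖) x :=
        (continuousAt_const.sub (hu x hx').continuousAt).norm
      have := (this.eventually_lt_const (u := δ) (by simpa using hδ))
      exact nhdsWithin_le_nhds this
    have e3 : ∀ᶠ z in 𝓝[>] x, z ∈ Ioc x b := Ioc_mem_nhdsGT hx.2
    refine (Filter.Eventually.frequently ?_)
    filter_upwards [e1, e2, e3] with z z1 z2 z3
    have hz : z ∈ Icc a b := ⟨hx.1.trans z3.1.le, z3.2⟩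
    have hzx : 0 < z - x := sub_pos.2 z3.1
    rw [Real.norm_of_nonneg hzx.le, inv_mul_lt_iff₀ hzx, norm_sub_rev] at z1
    have k1 := H (u x) (u z) (hn x hx') (hn z hz) z2
    have k2 := InnerProductGeometry.angle_le_angle_add_angle (u a) (u x) (u z)
    rw [slope_def_field, div_lt_iff₀ hzx]
    have k3 : (1 + (r - r') / (2 * r')) * ‖u x - u z‖ ≤ (1 + (r - r') / (2 * r')) * ((z - x) * r') := by
      gcongr
    have k4 : (1 + (r - r') / (2 * r')) * ((z - x) * r') = (r + r') / 2 * (z - x) := by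
      field_simp; ring
    have k5 : (r + r') / 2 * (z - x) < r * (z - x) := by
      apply mul_lt_mul_of_pos_right _ hzx; linarith
    linarith

end AdS
namespace AdS

/-! ### Functions that avoid a value on a connected set. -/

theorem forall_lt_of_isPreconnected {X : Type*} [TopologicalSpace X] {S : Set X}
    (hS : IsPreconnected S) {f : X → ℝ} (hf : ContinuousOn f S) {c : ℝ}
    (hc : ∀ x ∈ S, f x ≠ c) {x₀ : X} (hx₀ : x₀ ∈ S) (h : f x₀ < c) : ∀ x ∈ S, f x < c := by
  intro x hx
  by_contra hlt
  obtain ⟨y, hy, hyc⟩ := hS.intermediate_value hx₀ hx hf ⟨h.le, not_lt.1 hlt⟩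
  exact hc y hy hyc

theorem forall_gt_of_isPreconnected {X : Type*} [TopologicalSpace X] {S : Set X}
    (hS : IsPreconnected S) {f : X → ℝ} (hf : ContinuousOn f S) {c : ℝ}
    (hc : ∀ x ∈ S, f x ≠ c) {x₀ : X} (hx₀ : x₀ ∈ S) (h : c < f x₀) : ∀ x ∈ S, c < f x := by
  intro x hx
  by_contra hlt
  obtain ⟨y, hy, hyc⟩ := hS.intermediate_value hx hx₀ hf ⟨not_lt.1 hlt, h.le⟩
  exact hc y hy hyc

/-! ### Causal paths are no faster than light -/

theorem hasDerivAt_hemi {q : ℝ → EuclideanSpace ℝ (Fin 2)} {k : EuclideanSpace ℝ (Fin 2)} {x : ℝ}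
    (hq : HasDerivAt q k x) (hx : ‖q x‖ < 1) :
    HasDerivAt (fun τ => hemi (q τ))
      !₂[k 0, k 1, -inner ℝ (q x) k / √(1 - ‖q x‖ ^ 2), 0] x := by
  have hpos : 0 < 1 - ‖q x‖ ^ 2 := by nlinarith [norm_nonneg (q x)]
  have hi : ∀ i, HasDerivAt (fun τ => q τ i) (k i) x := fun i =>
    (EuclideanSpace.proj (𝕜 := ℝ) i).hasFDerivAt.comp_hasDerivAt x hq
  have h3 : HasDerivAt (fun τ => √(1 - ‖q τ‖ ^ 2)) (-inner ℝ (q x) k / √(1 - ‖q x‖ ^ 2)) x := by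
    have := (hq.norm_sq.const_sub 1).sqrt hpos.ne'
    convert this using 1
    field_simp
  have : HasDerivAt (fun τ => (![q τ 0, q τ 1, √(1 - ‖q τ‖ ^ 2), 0] : Fin 4 → ℝ))
      ![k 0, k 1, -inner ℝ (q x) k / √(1 - ‖q x‖ ^ 2), 0] x := by
    rw [hasDerivAt_pi]
    intro i
    fin_cases i
    · exact hi 0
    · exact hi 1
    · exact h3
    · exact hasDerivAt_const x 0
  exact (EuclideanSpace.equiv (Fin 4) ℝ).symm.toContinuousLinearMap.hasFDerivAt.comp_hasDerivAt x this

theorem norm_deriv_hemi_sq {p k : EuclideanSpace ℝ (Fin 2)} (hp : ‖p‖ < 1) :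
    ‖(!₂[k 0, k 1, -inner ℝ p k / √(1 - ‖p‖ ^ 2), 0] : EuclideanSpace ℝ (Fin 4))‖ ^ 2
      = ‖k‖ ^ 2 + inner ℝ p k ^ 2 / (1 - ‖p‖ ^ 2) := by
  have hpos : 0 < 1 - ‖p‖ ^ 2 := by nlinarith [norm_nonneg p]
  rw [EuclideanSpace.norm_sq_eq, norm_sq_eq_sum k]
  simp [Fin.sum_univ_four, div_pow, Real.sq_sqrt hpos.le]

/-- This is the conformal change: by `norm_deriv_hemi_sq` the first two terms on the right are the
squared speed on the round hemisphere. -/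
theorem metric_mul {z u : Cyl} (hz : z ∈ cover) :
    metric z u * (1 - ‖z.1‖ ^ 2)
      = ‖u.1‖ ^ 2 + inner ℝ z.1 u.1 ^ 2 / (1 - ‖z.1‖ ^ 2) - u.2 ^ 2 := by
  have hz' : ‖z.1‖ < 1 := hz
  have hpos : 0 < 1 - ‖z.1‖ ^ 2 := by nlinarith [norm_nonneg z.1]
  unfold metric
  field_simp

theorem IsTimelike.isCausal {c : ℝ → Cyl} (hc : IsTimelike c) : IsCausal c := by
  refine ⟨hc.1, fun τ hτ => ⟨fun h0 => ?_, (hc.2 τ hτ).le⟩⟩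
  have := hc.2 τ hτ
  simp [h0, metric] at this

/-- Causality bounds the speed of the spherical projection by the speed of time, and an angle is at
most a length. The sign `e` covers both time orientations. -/
theorem IsCausal.hemiDist_le_aux {c : ℝ → Cyl} {e : ℝ} (he : e ^ 2 = 1) (hc : IsPath c)
    (h : ∀ τ ∈ Ioo (0 : ℝ) 1, 0 < e * (deriv c τ).2 ∧ metric (c τ) (deriv c τ) ≤ 0)
    {a b : ℝ} (ha : 0 ≤ a) (hab : a ≤ b) (hb : b ≤ 1) :
    hemiDist (c a).1 (c b).1 ≤ e * ((c b).2 - (c a).2) := by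
  obtain ⟨hcont, hdiff, hcov⟩ := hc
  have hder : ∀ τ ∈ Ioo (0 : ℝ) 1, HasDerivAt c (deriv c τ) τ := fun τ hτ =>
    ((hdiff.differentiableOn (by norm_num)).differentiableAt (isOpen_Ioo.mem_nhds hτ)).hasDerivAt
  have key : ∀ a b : ℝ, 0 < a → a ≤ b → b < 1 →
      hemiDist (c a).1 (c b).1 ≤ e * ((c b).2 - (c a).2) := by
    intro a b ha hab hb
    have hmem : ∀ x ∈ Icc a b, x ∈ Ioo (0 : ℝ) 1 := fun x hx => ⟨ha.trans_le hx.1, hx.2.trans_lt hb⟩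
    have hn : ∀ x ∈ Icc a b, ‖(c x).1‖ < 1 := fun x hx => hcov x (hmem x hx)
    rw [hemiDist_eq_angle (hn a (left_mem_Icc.2 hab)).le (hn b (right_mem_Icc.2 hab)).le, mul_sub]
    have hfst : ∀ x ∈ Icc a b, HasDerivAt (fun τ => (c τ).1) (deriv c x).1 x := fun x hx =>
      (ContinuousLinearMap.fst ℝ (EuclideanSpace ℝ (Fin 2)) ℝ).hasFDerivAt.comp_hasDerivAt x (hder x (hmem x hx))
    have hsnd : ∀ x ∈ Icc a b, HasDerivAt (fun τ => (c τ).2) (deriv c x).2 x := fun x hx =>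
      (ContinuousLinearMap.snd ℝ (EuclideanSpace ℝ (Fin 2)) ℝ).hasFDerivAt.comp_hasDerivAt x
        (hder x (hmem x hx))
    refine angle_le_of_norm_deriv_le (u := fun τ => hemi (c τ).1) (t := fun τ => e * (c τ).2) hab
      (fun x hx => hasDerivAt_hemi (hfst x hx) (hn x hx)) (fun x hx => norm_hemi (hn x hx).le)
      (fun x hx => (hsnd x hx).const_mul e) fun x hx => ?_
    have h1 := h x (hmem x hx)
    have hpos : 0 < 1 - ‖(c x).1‖ ^ 2 := by nlinarith [norm_nonneg (c x).1, hn x hx]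
    refine le_of_sq_le_sq ?_ h1.1.le
    rw [norm_deriv_hemi_sq (hn x hx)]
    have h2 := metric_mul (u := deriv c x) (hcov x (hmem x hx))
    have h3 : metric (c x) (deriv c x) * (1 - ‖(c x).1‖ ^ 2) ≤ 0 :=
      mul_nonpos_of_nonpos_of_nonneg h1.2 hpos.le
    have h4 : (e * (deriv c x).2) ^ 2 = (deriv c x).2 ^ 2 := by rw [mul_pow, he, one_mul]
    linarith
  -- The path is differentiable only on the open interval. Contracting parameters towards 1/2 brings
  -- the endpoints inside, and the inequality passes to the limit.
  have hpath : ∀ x ∈ Icc (0 : ℝ) 1,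
      Filter.Tendsto (fun s : ℝ => c ((1 - s) * x + s / 2)) (𝓝[>] 0) (𝓝 (c x)) := by
    intro x hx
    refine (hcont x hx).tendsto.comp (tendsto_nhdsWithin_iff.2 ⟨?_, ?_⟩)
    · have : ContinuousAt (fun s : ℝ => (1 - s) * x + s / 2) 0 := by fun_prop
      have := this.tendsto
      simp only [sub_zero, one_mul, zero_div, add_zero] at this
      exact this.mono_left nhdsWithin_le_nhds
    · filter_upwards [Ioc_mem_nhdsGT (zero_lt_one (α := ℝ))] with s hs
      constructor
      · nlinarith [mul_nonneg (sub_nonneg.2 hs.2) hx.1, hs.1]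
      · nlinarith [mul_nonneg (sub_nonneg.2 hs.2) (sub_nonneg.2 hx.2), hs.1]
  have ta := hpath a ⟨ha, hab.trans hb⟩
  have tb := hpath b ⟨ha.trans hab, hb⟩
  have hcd : Continuous fun p : Cyl × Cyl => hemiDist p.1.1 p.2.1 := by
    unfold hemiDist
    refine Real.continuous_arccos.comp ?_
    fun_prop
  have t1 := (hcd.tendsto (c a, c b)).comp (ta.prodMk_nhds tb)
  have hcs : Continuous fun p : Cyl × Cyl => e * (p.2.2 - p.1.2) := by fun_prop
  have t2 := (hcs.tendsto (c a, c b)).comp (ta.prodMk_nhds tb)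
  refine le_of_tendsto_of_tendsto t1 t2 ?_
  filter_upwards [Ioo_mem_nhdsGT (zero_lt_one (α := ℝ))] with s hs
  apply key
  · nlinarith [mul_nonneg (sub_pos.2 hs.2).le ha, hs.1]
  · nlinarith [mul_nonneg (sub_pos.2 hs.2).le (sub_nonneg.2 hab)]
  · nlinarith [mul_nonneg (sub_pos.2 hs.2).le (sub_nonneg.2 hb), hs.1]

/-- Along a causal path, the coordinate `t` is monotone and grows at least as fast as the
hemispherical distance. -/
theorem IsCausal.exists_sign_hemiDist_le {c : ℝ → Cyl} (hc : IsCausal c) :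
    ∃ e : ℝ, e ^ 2 = 1 ∧ ∀ a b : ℝ, 0 ≤ a → a ≤ b → b ≤ 1 →
      hemiDist (c a).1 (c b).1 ≤ e * ((c b).2 - (c a).2) := by
  obtain ⟨hp, h⟩ := hc
  -- Without a time component, a causal velocity would have zero spherical speed and so vanish.
  have hne : ∀ τ ∈ Ioo (0 : ℝ) 1, (deriv c τ).2 ≠ 0 := by
    intro τ hτ h0
    have hz : ‖(c τ).1‖ < 1 := hp.2.2 τ hτ
    have hpos : 0 < 1 - ‖(c τ).1‖ ^ 2 := by nlinarith [norm_nonneg (c τ).1]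
    have h2 := metric_mul (u := deriv c τ) (hp.2.2 τ hτ)
    have h3 := mul_nonpos_of_nonpos_of_nonneg (h τ hτ).2 hpos.le
    have h4 : 0 ≤ inner ℝ (c τ).1 (deriv c τ).1 ^ 2 / (1 - ‖(c τ).1‖ ^ 2) := by positivity
    rw [h2, h0] at h3
    have h5 : ‖(deriv c τ).1‖ = 0 := by nlinarith [norm_nonneg (deriv c τ).1]
    exact (h τ hτ).1 (Prod.ext (norm_eq_zero.1 h5) h0)
  have hcont : ContinuousOn (fun τ => (deriv c τ).2) (Ioo 0 1) :=
    continuous_snd.comp_continuousOn (hp.2.1.continuousOn_deriv_of_isOpen isOpen_Ioo le_rfl)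
  have hmid : (1 / 2 : ℝ) ∈ Ioo (0 : ℝ) 1 := by norm_num
  rcases lt_or_gt_of_ne (hne _ hmid) with hlt | hgt
  · refine ⟨-1, by norm_num, fun a b => IsCausal.hemiDist_le_aux (by norm_num) hp fun τ hτ =>
      ⟨?_, (h τ hτ).2⟩⟩
    have := forall_lt_of_isPreconnected isPreconnected_Ioo hcont hne hmid hlt τ hτ
    linarith
  · refine ⟨1, by norm_num, fun a b => IsCausal.hemiDist_le_aux (by norm_num) hp fun τ hτ =>
      ⟨?_, (h τ hτ).2⟩⟩
    have := forall_gt_of_isPreconnected isPreconnected_Ioo hcont hne hmid hgt τ hτ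
    linarith

end AdS
namespace AdS

/-! ### Construction of causal and timelike paths -/

theorem hasDerivAt_toLp_prodMk {x y x' y' : ℝ → ℝ} (hx : ∀ τ, HasDerivAt x (x' τ) τ)
    (hy : ∀ τ, HasDerivAt y (y' τ) τ) (t d τ : ℝ) :
    HasDerivAt (fun τ => ((!₂[x τ, y τ], t + τ * d) : Cyl)) (!₂[x' τ, y' τ], d) τ := by
  have h1 : HasDerivAt (fun τ => (![x τ, y τ] : Fin 2 → ℝ)) ![x' τ, y' τ] τ := by
    rw [hasDerivAt_pi]
    intro i
    fin_cases i
    · exact hx τ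
    · exact hy τ
  have h2 : HasDerivAt (fun τ => (!₂[x τ, y τ] : EuclideanSpace ℝ (Fin 2))) !₂[x' τ, y' τ] τ :=
    (EuclideanSpace.equiv (Fin 2) ℝ).symm.toContinuousLinearMap.hasFDerivAt.comp_hasDerivAt τ h1
  have h3 : HasDerivAt (fun τ : ℝ => t + τ * d) d τ := by
    simpa using ((hasDerivAt_id τ).mul_const d).const_add t
  exact h2.prodMk h3

theorem isPath_toLp_prodMk {x y : ℝ → ℝ} (hx : ContDiff ℝ 1 x) (hy : ContDiff ℝ 1 y) (t d : ℝ)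
    (h : ∀ τ ∈ Ioo (0 : ℝ) 1, x τ ^ 2 + y τ ^ 2 < 1) :
    IsPath (fun τ => ((!₂[x τ, y τ], t + τ * d) : Cyl)) := by
  have hc : ContDiff ℝ 1 (fun τ => ((!₂[x τ, y τ], t + τ * d) : Cyl)) := by
    refine ContDiff.prodMk (contDiff_euclidean.2 fun i => ?_) (by fun_prop)
    fin_cases i
    · exact hx
    · exact hy
  refine ⟨hc.continuous.continuousOn, hc.contDiffOn, fun τ hτ => ?_⟩
  have h2 : ‖(!₂[x τ, y τ] : EuclideanSpace ℝ (Fin 2))‖ ^ 2 < 1 := by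
    rw [norm_sq_eq_sum]; exact h τ hτ
  show ‖(!₂[x τ, y τ] : EuclideanSpace ℝ (Fin 2))‖ < 1
  nlinarith [norm_nonneg (!₂[x τ, y τ] : EuclideanSpace ℝ (Fin 2))]

/-- Here `m` is the squared height on the hemisphere and `s` the squared spherical speed of the
projected velocity. -/
theorem metric_toLp_prodMk {x y k l t d m s : ℝ} (hm : 0 < m) (h : 1 - (x ^ 2 + y ^ 2) = m)
    (hs : (k ^ 2 + l ^ 2) * m + (x * k + y * l) ^ 2 = s * m) :
    metric (!₂[x, y], t) (!₂[k, l], d) = (s - d ^ 2) / m := by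
  have h1 : ‖(!₂[x, y] : EuclideanSpace ℝ (Fin 2))‖ ^ 2 = x ^ 2 + y ^ 2 := norm_sq_eq_sum _
  have h2 : ‖(!₂[k, l] : EuclideanSpace ℝ (Fin 2))‖ ^ 2 = k ^ 2 + l ^ 2 := norm_sq_eq_sum _
  have h3 : inner ℝ (!₂[x, y] : EuclideanSpace ℝ (Fin 2)) !₂[k, l] = x * k + y * l :=
    inner_eq_sum _ _
  simp only [metric, h1, h2, h3, h]
  field_simp
  linarith

theorem exists_cos_sin_eq {x y : ℝ} (h : x ^ 2 + y ^ 2 = 1) :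
    ∃ θ, |θ| = Real.arccos x ∧ Real.cos θ = x ∧ Real.sin θ = y := by
  have hx1 : -1 ≤ x := by nlinarith
  have hx2 : x ≤ 1 := by nlinarith
  have hs : Real.sin (Real.arccos x) = |y| := by
    rw [Real.sin_arccos, ← Real.sqrt_sq_eq_abs]; congr 1; linarith
  rcases le_total 0 y with hy | hy
  · exact ⟨Real.arccos x, abs_of_nonneg (Real.arccos_nonneg x), Real.cos_arccos hx1 hx2, by
      rw [hs, abs_of_nonneg hy]⟩
  · exact ⟨-Real.arccos x, by rw [abs_neg, abs_of_nonneg (Real.arccos_nonneg x)], by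
      rw [Real.cos_neg, Real.cos_arccos hx1 hx2], by
      rw [Real.sin_neg, hs, abs_of_nonpos hy, neg_neg]⟩

/-- Two boundary points whose time difference exceeds their distance are joined by a timelike
path. -/
theorem exists_isTimelike_of_norm_eq_one {y y' : Cyl} (hy : ‖y.1‖ = 1) (hy' : ‖y'.1‖ = 1)
    (h : Real.arccos (inner ℝ y.1 y'.1) < |y'.2 - y.2|) :
    ∃ c, IsTimelike c ∧ c 0 = y ∧ c 1 = y' := by
  have e1 : y.1 0 ^ 2 + y.1 1 ^ 2 = 1 := by rw [← norm_sq_eq_sum, hy]; norm_num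
  have e2 : y'.1 0 ^ 2 + y'.1 1 ^ 2 = 1 := by rw [← norm_sq_eq_sum, hy']; norm_num
  obtain ⟨α, -, hα1, hα2⟩ := exists_cos_sin_eq e1
  have e3 : inner ℝ y.1 y'.1 ^ 2 + (y.1 0 * y'.1 1 - y.1 1 * y'.1 0) ^ 2 = 1 := by
    rw [inner_eq_sum]
    linear_combination (y'.1 0 ^ 2 + y'.1 1 ^ 2) * e1 + e2
  obtain ⟨δ, hδ, hδ1, hδ2⟩ := exists_cos_sin_eq e3
  rw [inner_eq_sum] at hδ1
  set Δ := y'.2 - y.2 with hΔ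
  have hlt : 0 < Δ ^ 2 - δ ^ 2 := by
    have : δ ^ 2 < Δ ^ 2 := by rw [← hδ] at h; exact sq_lt_sq.2 h
    linarith
  obtain ⟨ε, hε0, hε1, hε2⟩ : ∃ ε : ℝ, 0 < ε ∧ ε ≤ 1 ∧ ε ^ 2 < Δ ^ 2 - δ ^ 2 := by
    -- Since ε ≤ 1, one has ε² ≤ ε, and ε is at most half the available gap.
    refine ⟨min 1 ((Δ ^ 2 - δ ^ 2) / 2), by positivity, min_le_left _ _, ?_⟩
    have h1 := min_le_left 1 ((Δ ^ 2 - δ ^ 2) / 2)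
    have h2 := min_le_right 1 ((Δ ^ 2 - δ ^ 2) / 2)
    have h3 : 0 < min 1 ((Δ ^ 2 - δ ^ 2) / 2) := by positivity
    nlinarith
  -- The boundary arc from angle α to α + δ is raised into the hemisphere by the elevation φ, which
  -- vanishes at the ends. The squared speed φ'² + cos² φ · δ² is at most ε² + δ² < Δ².
  set φ : ℝ → ℝ := fun τ => ε * (τ * (1 - τ)) with hφ
  have hφpos : ∀ τ ∈ Ioo (0 : ℝ) 1, 0 < Real.sin (φ τ) := by
    intro τ hτ
    have h1 : 0 < τ * (1 - τ) := mul_pos hτ.1 (by linarith [hτ.2])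
    have h2 : τ * (1 - τ) ≤ 1 := by nlinarith [hτ.1, hτ.2]
    refine Real.sin_pos_of_pos_of_lt_pi (mul_pos hε0 h1) ?_
    have : φ τ ≤ 1 := by simp only [hφ]; nlinarith
    linarith [Real.pi_gt_three]
  have dφ : ∀ τ, HasDerivAt φ (ε * (1 - 2 * τ)) τ := by
    intro τ
    exact (((hasDerivAt_id' τ).fun_mul ((hasDerivAt_id' τ).const_sub 1)).const_mul ε).congr_deriv
      (by ring)
  have dθ : ∀ τ, HasDerivAt (fun τ => α + τ * δ) δ τ := fun τ => by
    simpa using ((hasDerivAt_id τ).mul_const δ).const_add α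
  let x : ℝ → ℝ := fun τ => Real.cos (φ τ) * Real.cos (α + τ * δ)
  let z : ℝ → ℝ := fun τ => Real.cos (φ τ) * Real.sin (α + τ * δ)
  have dx : ∀ τ, HasDerivAt x _ τ := fun τ => (dφ τ).cos.mul (dθ τ).cos
  have dz : ∀ τ, HasDerivAt z _ τ := fun τ => (dφ τ).cos.mul (dθ τ).sin
  have hr : ∀ τ, 1 - (x τ ^ 2 + z τ ^ 2) = Real.sin (φ τ) ^ 2 := by
    intro τ
    simp only [x, z]
    linear_combination (-Real.cos (φ τ) ^ 2) * Real.sin_sq_add_cos_sq (α + τ * δ)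
      - Real.sin_sq_add_cos_sq (φ τ)
  refine ⟨fun τ => (!₂[x τ, z τ], y.2 + τ * Δ), ⟨isPath_toLp_prodMk ?_ ?_ _ _ fun τ hτ => ?_,
    fun τ hτ => ?_⟩, ?_, ?_⟩
  · simp only [x, φ]; fun_prop
  · simp only [z, φ]; fun_prop
  · have := hr τ
    have := pow_pos (hφpos τ hτ) 2
    linarith
  · rw [(hasDerivAt_toLp_prodMk dx dz y.2 Δ τ).deriv]
    have hs := pow_pos (hφpos τ hτ) 2
    rw [metric_toLp_prodMk (s := (ε * (1 - 2 * τ)) ^ 2 + Real.cos (φ τ) ^ 2 * δ ^ 2) hs (hr τ)]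
    · apply div_neg_of_neg_of_pos _ hs
      have h1 : (1 - 2 * τ) ^ 2 ≤ 1 := by nlinarith [mul_pos hτ.1 (sub_pos.2 hτ.2)]
      have h2 : Real.cos (φ τ) ^ 2 ≤ 1 := Real.cos_sq_le_one _
      have h3 : (ε * (1 - 2 * τ)) ^ 2 ≤ ε ^ 2 := by
        rw [mul_pow]; exact mul_le_of_le_one_right (sq_nonneg ε) h1
      have h4 : Real.cos (φ τ) ^ 2 * δ ^ 2 ≤ δ ^ 2 := mul_le_of_le_one_left (sq_nonneg δ) h2
      linarith
    · have c1 : Real.cos (α + τ * δ) ^ 2 = 1 - Real.sin (α + τ * δ) ^ 2 := Real.cos_sq' _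
      have c2 : Real.cos (φ τ) ^ 2 = 1 - Real.sin (φ τ) ^ 2 := Real.cos_sq' _
      simp only [x, z]
      generalize Real.cos (α + τ * δ) = a at *
      generalize Real.sin (α + τ * δ) = b at *
      generalize Real.cos (φ τ) = p at *
      generalize Real.sin (φ τ) = r at *
      have hab : a ^ 2 + b ^ 2 = 1 := by linarith
      have hk : (-r * (ε * (1 - 2 * τ)) * a + p * (-b * δ)) ^ 2 +
          (-r * (ε * (1 - 2 * τ)) * b + p * (a * δ)) ^ 2
          = r ^ 2 * (ε * (1 - 2 * τ)) ^ 2 + p ^ 2 * δ ^ 2 := by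
        linear_combination (r ^ 2 * (ε * (1 - 2 * τ)) ^ 2 + p ^ 2 * δ ^ 2) * hab
      have hl : p * a * (-r * (ε * (1 - 2 * τ)) * a + p * (-b * δ)) +
          p * b * (-r * (ε * (1 - 2 * τ)) * b + p * (a * δ)) = -p * r * (ε * (1 - 2 * τ)) := by
        linear_combination (-p * r * (ε * (1 - 2 * τ))) * hab
      rw [hk, hl]
      linear_combination r ^ 2 * (ε * (1 - 2 * τ)) ^ 2 * c2
  · refine Prod.ext ?_ (by simp)
    ext i
    fin_cases i
    · simp [x, φ, hα1]
    · simp [z, φ, hα2]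
  · refine Prod.ext ?_ (by simp [hΔ])
    ext i
    fin_cases i
    · simp only [x, φ, one_mul, sub_self, mul_zero, Real.cos_zero, Real.cos_add, hα1, hα2, hδ1, hδ2]
      simp only [Fin.zero_eta, Matrix.cons_val_zero]
      linear_combination y'.1 0 * e1
    · simp only [z, φ, one_mul, sub_self, mul_zero, Real.cos_zero, Real.sin_add, hα1, hα2, hδ1, hδ2]
      simp only [Fin.mk_one, Matrix.cons_val_one, Matrix.cons_val_fin_one]
      linear_combination y'.1 1 * e1

/-- Vertical displacements are realized by timelike paths. -/
theorem exists_isTimelike_vertical {q : EuclideanSpace ℝ (Fin 2)} (hq : ‖q‖ ≤ 1) {t t' : ℝ}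
    (ht : t ≠ t') : ∃ c, IsTimelike c ∧ c 0 = (q, t) ∧ c 1 = (q, t') := by
  rcases hq.lt_or_eq with hq | hq
  · have hpos : 0 < 1 - ‖q‖ ^ 2 := by nlinarith [norm_nonneg q]
    have hq2 : (!₂[q 0, q 1] : EuclideanSpace ℝ (Fin 2)) = q := by
      ext i; fin_cases i <;> simp
    refine ⟨fun τ => (!₂[q 0, q 1], t + τ * (t' - t)), ⟨isPath_toLp_prodMk contDiff_const
      contDiff_const _ _ fun τ hτ => ?_, fun τ hτ => ?_⟩, by simp [hq2], by simp [hq2]⟩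
    · rw [← norm_sq_eq_sum]; linarith
    · rw [(hasDerivAt_toLp_prodMk (fun τ => hasDerivAt_const τ (q 0))
        (fun τ => hasDerivAt_const τ (q 1)) t (t' - t) τ).deriv]
      rw [metric_toLp_prodMk (s := 0) hpos (by rw [norm_sq_eq_sum]) (by ring)]
      have : 0 < (t' - t) ^ 2 := by
        have := sub_ne_zero.2 ht.symm
        positivity
      exact div_neg_of_neg_of_pos (by linarith) hpos
  -- Over a boundary point the vertical segment is not in the open cover, so the raised path
  -- replaces it.
  · refine exists_isTimelike_of_norm_eq_one (y := (q, t)) (y' := (q, t')) hq hq ?_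
    simp only [real_inner_self_eq_norm_sq, hq]
    simpa [sub_eq_zero] using ht.symm

theorem abs_inner_lt_one {p q : EuclideanSpace ℝ (Fin 2)} (hp : ‖p‖ < 1) (hq : ‖q‖ ≤ 1) :
    |inner ℝ p q| < 1 :=
  (abs_real_inner_le_norm p q).trans_lt (by nlinarith [norm_nonneg p, norm_nonneg q])

/-- A point of the cover and a boundary point whose time difference is at least their distance are
joined by a causal path. -/
theorem exists_isCausal_of_le {z y : Cyl} (hz : z ∈ cover) (hy : ‖y.1‖ = 1)
    (h : Real.arccos (inner ℝ z.1 y.1) ≤ |z.2 - y.2|) :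
    ∃ c, IsCausal c ∧ c 0 = z ∧ c 1 = y := by
  have hz' : ‖z.1‖ < 1 := hz
  obtain ⟨hi1, hi2⟩ := abs_lt.1 (abs_inner_lt_one hz' hy.le)
  have e1 : y.1 0 ^ 2 + y.1 1 ^ 2 = 1 := by rw [← norm_sq_eq_sum, hy]; norm_num
  have e2 : z.1 0 ^ 2 + z.1 1 ^ 2 < 1 := by
    rw [← norm_sq_eq_sum]; nlinarith [norm_nonneg z.1]
  set d := Real.arccos (inner ℝ z.1 y.1) with hd
  have hd0 : 0 < d := Real.arccos_pos.2 hi2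
  have hdπ : d < Real.pi := Real.arccos_lt_pi.2 hi1
  have hcd : Real.cos d = z.1 0 * y.1 0 + z.1 1 * y.1 1 := by
    rw [← inner_eq_sum, hd, Real.cos_arccos hi1.le hi2.le]
  have hsd : 0 < Real.sin d := Real.sin_pos_of_pos_of_lt_pi hd0 hdπ
  have hsd2 : Real.sin d ^ 2 = 1 - Real.cos d ^ 2 := Real.sin_sq d
  -- `(E0, E1)` is the horizontal part of the unit tangent at `y.1` of the great circle through the
  -- hemisphere point over `z.1`. The path runs along this circle at constant speed `d`.
  set E0 := (z.1 0 - Real.cos d * y.1 0) / Real.sin d with hE0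
  set E1 := (z.1 1 - Real.cos d * y.1 1) / Real.sin d with hE1
  have hE0' : Real.sin d * E0 = z.1 0 - Real.cos d * y.1 0 := by rw [hE0]; field_simp
  have hE1' : Real.sin d * E1 = z.1 1 - Real.cos d * y.1 1 := by rw [hE1]; field_simp
  have horth : y.1 0 * E0 + y.1 1 * E1 = 0 := by
    have : Real.sin d * (y.1 0 * E0 + y.1 1 * E1) = 0 := by
      linear_combination y.1 0 * hE0' + y.1 1 * hE1' - Real.cos d * e1 - hcd
    exact (mul_eq_zero.1 this).resolve_left hsd.ne'
  have hE : 0 < 1 - (E0 ^ 2 + E1 ^ 2) := by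
    have : 0 < Real.sin d ^ 2 * (1 - (E0 ^ 2 + E1 ^ 2)) := by
      have : Real.sin d ^ 2 * (1 - (E0 ^ 2 + E1 ^ 2)) = 1 - (z.1 0 ^ 2 + z.1 1 ^ 2) := by
        linear_combination hsd2 - (Real.sin d * E0 + (z.1 0 - Real.cos d * y.1 0)) * hE0'
          - (Real.sin d * E1 + (z.1 1 - Real.cos d * y.1 1)) * hE1' - Real.cos d ^ 2 * e1
          - 2 * Real.cos d * hcd
      linarith
    exact pos_of_mul_pos_right this (sq_nonneg _)
  set ψ : ℝ → ℝ := fun τ => d * (1 - τ) with hψ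
  have hψpos : ∀ τ ∈ Ioo (0 : ℝ) 1, 0 < Real.sin (ψ τ) := by
    intro τ hτ
    refine Real.sin_pos_of_pos_of_lt_pi (mul_pos hd0 (by linarith [hτ.2])) ?_
    have : ψ τ ≤ d := by simp only [hψ]; nlinarith [hτ.1]
    linarith
  have dψ : ∀ τ, HasDerivAt ψ (-d) τ := by
    intro τ
    simpa using ((hasDerivAt_id τ).const_sub 1).const_mul d
  let x : ℝ → ℝ := fun τ => Real.cos (ψ τ) * y.1 0 + Real.sin (ψ τ) * E0
  let w : ℝ → ℝ := fun τ => Real.cos (ψ τ) * y.1 1 + Real.sin (ψ τ) * E1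
  have dx : ∀ τ, HasDerivAt x _ τ := fun τ =>
    ((dψ τ).cos.mul_const (y.1 0)).add ((dψ τ).sin.mul_const E0)
  have dw : ∀ τ, HasDerivAt w _ τ := fun τ =>
    ((dψ τ).cos.mul_const (y.1 1)).add ((dψ τ).sin.mul_const E1)
  have hr : ∀ τ, 1 - (x τ ^ 2 + w τ ^ 2) = Real.sin (ψ τ) ^ 2 * (1 - (E0 ^ 2 + E1 ^ 2)) := by
    intro τ
    simp only [x, w]
    linear_combination (-Real.cos (ψ τ) ^ 2) * e1
      - 2 * Real.cos (ψ τ) * Real.sin (ψ τ) * horth - Real.sin_sq_add_cos_sq (ψ τ)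
  have hm : ∀ τ ∈ Ioo (0 : ℝ) 1, 0 < Real.sin (ψ τ) ^ 2 * (1 - (E0 ^ 2 + E1 ^ 2)) :=
    fun τ hτ => mul_pos (pow_pos (hψpos τ hτ) 2) hE
  have hΔ : z.2 - y.2 ≠ 0 := fun h0 => by rw [h0, abs_zero] at h; linarith
  refine ⟨fun τ => (!₂[x τ, w τ], z.2 + τ * (y.2 - z.2)), ⟨isPath_toLp_prodMk ?_ ?_ _ _
    fun τ hτ => ?_, fun τ hτ => ?_⟩, ?_, ?_⟩
  · simp only [x, ψ]; fun_prop
  · simp only [w, ψ]; fun_prop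
  · linarith [hr τ, hm τ hτ]
  · rw [(hasDerivAt_toLp_prodMk dx dw z.2 (y.2 - z.2) τ).deriv]
    refine ⟨fun h0 => hΔ ?_, ?_⟩
    · have := congrArg Prod.snd h0
      simp only [Prod.snd_zero] at this
      linarith
    · rw [metric_toLp_prodMk (s := d ^ 2) (hm τ hτ) (hr τ)]
      · apply div_nonpos_of_nonpos_of_nonneg _ (hm τ hτ).le
        have := sq_le_sq.2 ((abs_of_pos hd0).le.trans h)
        nlinarith
      · have c1 : Real.cos (ψ τ) ^ 2 = 1 - Real.sin (ψ τ) ^ 2 := Real.cos_sq' _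
        simp only [x, w]
        generalize Real.cos (ψ τ) = p at *
        generalize Real.sin (ψ τ) = r at *
        generalize E0 = a at *
        generalize E1 = b at *
        generalize y.1 0 = u at *
        generalize y.1 1 = v at *
        have hk : (-r * -d * u + p * -d * a) ^ 2 + (-r * -d * v + p * -d * b) ^ 2
            = d ^ 2 * (r ^ 2 + p ^ 2 * (a ^ 2 + b ^ 2)) := by
          linear_combination d ^ 2 * r ^ 2 * e1 - 2 * d ^ 2 * r * p * horth
        have hl : (p * u + r * a) * (-r * -d * u + p * -d * a)
            + (p * v + r * b) * (-r * -d * v + p * -d * b)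
            = d * r * p * (1 - (a ^ 2 + b ^ 2)) := by
          linear_combination d * r * p * e1 + d * (r ^ 2 - p ^ 2) * horth
        rw [hk, hl]
        linear_combination d ^ 2 * r ^ 2 * (1 - (a ^ 2 + b ^ 2)) * c1
  · refine Prod.ext ?_ (by simp)
    ext i
    fin_cases i
    · simp [x, ψ, hE0']
    · simp [w, ψ, hE1']
  · refine Prod.ext ?_ (by simp)
    ext i
    fin_cases i
    · simp [x, ψ]
    · simp [w, ψ]

end AdS
namespace AdS

/-! ### The bilinear form -/

theorem form_comm (x y : V) : form x y = form y x := by simp only [form]; ring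

theorem form_add_right (x y z : V) : form x (y + z) = form x y + form x z := by
  simp only [form, Pi.add_apply]; ring

theorem form_add_left (x y z : V) : form (x + y) z = form x z + form y z := by
  simp only [form, Pi.add_apply]; ring

theorem form_smul_right (c : ℝ) (x y : V) : form x (c • y) = c * form x y := by
  simp only [form, Pi.smul_apply, smul_eq_mul]; ring

theorem form_smul_left (c : ℝ) (x y : V) : form (c • x) y = c * form x y := by
  simp only [form, Pi.smul_apply, smul_eq_mul]; ring

theorem form_neg_right (x y : V) : form x (-y) = -form x y := by
  simp only [form, Pi.neg_apply]; ring

theorem form_neg_left (x y : V) : form (-x) y = -form x y := by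
  simp only [form, Pi.neg_apply]; ring

theorem continuous_form : Continuous fun p : V × V => form p.1 p.2 := by
  unfold form; fun_prop

@[fun_prop]
theorem Continuous.form {X : Type*} [TopologicalSpace X] {f g : X → V} (hf : Continuous f)
    (hg : Continuous g) : Continuous fun x => form (f x) (g x) :=
  continuous_form.comp (hf.prodMk hg)

/-- The linear form `form n`. -/
def formLin (n : V) : V →ₗ[ℝ] ℝ where
  toFun := form n
  map_add' := form_add_right n
  map_smul' c x := form_smul_right c n x

@[simp] theorem formLin_apply (n v : V) : formLin n v = form n v := rfl

theorem exists_form_eq (f : V →ₗ[ℝ] ℝ) : ∃ n : V, ∀ v, form n v = f v := by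
  have e : ∀ i : Fin 4, ∃ c : ℝ, f (fun j => if i = j then 1 else 0) = c := fun i => ⟨_, rfl⟩
  choose c hc using e
  refine ⟨![c 0, c 1, -c 2, -c 3], fun v => ?_⟩
  rw [LinearMap.pi_apply_eq_sum_univ f v]
  simp only [hc, Fin.sum_univ_four, form, smul_eq_mul]
  simp
  ring

theorem exists_form_pos {v : V} (hv : v ≠ 0) : ∃ m, 0 < form m v := by
  refine ⟨![v 0, v 1, -v 2, -v 3], ?_⟩
  obtain ⟨i, hi⟩ := Function.ne_iff.1 hv
  have hi' : 0 < v i ^ 2 := by have : v i ≠ 0 := hi; positivity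
  have : form ![v 0, v 1, -v 2, -v 3] v = v 0 ^ 2 + v 1 ^ 2 + v 2 ^ 2 + v 3 ^ 2 := by
    simp [form]; ring
  rw [this]
  fin_cases i <;> simp at hi' <;> nlinarith [sq_nonneg (v 0), sq_nonneg (v 1), sq_nonneg (v 2), sq_nonneg (v 3)]

/-- The dictionary between linear algebra and causality: when `|z.2 - y.2| ≤ π`, the sign of the
form compares this difference with `arccos ⟨z.1, y.1⟩`. -/
theorem form_vec_vec (z y : Cyl) : form (vec z) (vec y) = inner ℝ z.1 y.1 - Real.cos (z.2 - y.2) := by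
  rw [inner_eq_sum, Real.cos_sub]; simp [form, vec]; ring

theorem continuous_vec : Continuous vec := by
  unfold vec
  refine continuous_pi fun i => ?_
  fin_cases i <;> simp <;> fun_prop

theorem form_vec_self (z : Cyl) : form (vec z) (vec z) = ‖z.1‖ ^ 2 - 1 := by
  rw [form_vec_vec]; simp

/-! ### Points of projective space and their representatives -/

theorem exists_rep_eq (v : V) (hv : v ≠ 0) :
    ∃ c : ℝ, c ≠ 0 ∧ (Projectivization.mk ℝ v hv).rep = c • v := by
  obtain ⟨a, ha⟩ := Projectivization.exists_smul_eq_mk_rep ℝ v hv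
  exact ⟨a, a.ne_zero, ha.symm⟩

theorem mk_eq_mk_iff {v w : V} (hv : v ≠ 0) (hw : w ≠ 0) :
    Projectivization.mk ℝ v hv = Projectivization.mk ℝ w hw ↔ ∃ c : ℝ, c ≠ 0 ∧ v = c • w := by
  rw [Projectivization.mk_eq_mk_iff]
  constructor
  · rintro ⟨a, ha⟩; exact ⟨a, a.ne_zero, ha.symm⟩
  · rintro ⟨c, hc, h⟩; exact ⟨Units.mk0 c hc, h.symm⟩

theorem mk_mem_space {v : V} (hv : v ≠ 0) : Projectivization.mk ℝ v hv ∈ space ↔ form v v < 0 := by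
  obtain ⟨c, hc, h⟩ := exists_rep_eq v hv
  have : 0 < c * c := mul_self_pos.2 hc
  show form _ _ < 0 ↔ _
  rw [h, form_smul_left, form_smul_right, ← mul_assoc]
  exact ⟨fun h => by by_contra h'; nlinarith, fun h => mul_neg_of_pos_of_neg this h⟩

theorem mk_mem_boundary {v : V} (hv : v ≠ 0) :
    Projectivization.mk ℝ v hv ∈ boundary ↔ form v v = 0 := by
  obtain ⟨c, hc, h⟩ := exists_rep_eq v hv
  simp [boundary, h, form_smul_left, form_smul_right, hc]

theorem mk_mem_dualPlane {n v : V} (hn : n ≠ 0) (hv : v ≠ 0) :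
    Projectivization.mk ℝ v hv ∈ dualPlane (Projectivization.mk ℝ n hn) ↔ form n v = 0 := by
  obtain ⟨c, hc, h⟩ := exists_rep_eq v hv
  obtain ⟨d, hd, h'⟩ := exists_rep_eq n hn
  simp [dualPlane, h, h', form_smul_left, form_smul_right, hc, hd]

theorem mk_mem_affineChart {v : V} (hv : v ≠ 0) (f : V →ₗ[ℝ] ℝ) :
    Projectivization.mk ℝ v hv ∈ affineChart f ↔ f v ≠ 0 := by
  obtain ⟨c, hc, h⟩ := exists_rep_eq v hv
  simp [affineChart, h, hc]

theorem proj_mem_space {z : Cyl} : proj z ∈ space ↔ z ∈ cover := by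
  rw [proj, mk_mem_space, form_vec_self]
  show _ ↔ ‖z.1‖ < 1
  constructor <;> intro h <;> nlinarith [norm_nonneg z.1]

theorem proj_mem_boundary {z : Cyl} : proj z ∈ boundary ↔ ‖z.1‖ = 1 := by
  rw [proj, mk_mem_boundary, form_vec_self]
  constructor <;> intro h
  · nlinarith [norm_nonneg z.1]
  · rw [h]; norm_num

theorem cover_subset_closedCover : cover ⊆ closedCover := fun z h => le_of_lt (show ‖z.1‖ < 1 from h)

/-- The deck transformation group of the covering of anti-de Sitter space. -/
noncomputable def deck (k : ℤ) (z : Cyl) : Cyl := ((-1 : ℝ) ^ k • z.1, z.2 + k * Real.pi)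

theorem vec_deck (k : ℤ) (z : Cyl) : vec (deck k z) = (-1 : ℝ) ^ k • vec z := by
  ext i
  fin_cases i <;> simp [vec, deck, Real.cos_add_int_mul_pi, Real.sin_add_int_mul_pi]

theorem proj_deck (k : ℤ) (z : Cyl) : proj (deck k z) = proj z :=
  (mk_eq_mk_iff _ _).2 ⟨(-1) ^ k, zpow_ne_zero _ (by norm_num), vec_deck k z⟩

theorem neg_one_zpow_sq (k : ℤ) : ((-1 : ℝ) ^ k) ^ 2 = 1 := by
  rcases Int.even_or_odd k with h | h
  · rw [h.neg_one_zpow]; norm_num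
  · rw [h.neg_one_zpow]; norm_num

theorem norm_deck (k : ℤ) (z : Cyl) : ‖(deck k z).1‖ = ‖z.1‖ := by
  simp [deck, norm_smul]

theorem inner_deck (k : ℤ) (z y : Cyl) : inner ℝ (deck k z).1 (deck k y).1 = inner ℝ z.1 y.1 := by
  simp only [deck, real_inner_smul_left, real_inner_smul_right]
  have := neg_one_zpow_sq k
  linear_combination inner ℝ z.1 y.1 * this

theorem eq_deck_of_proj_eq {z y : Cyl} (h : proj y = proj z) : ∃ k : ℤ, y = deck k z := by
  obtain ⟨c, hc, h⟩ := (mk_eq_mk_iff _ _).1 h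
  have h2 : Real.cos y.2 = c * Real.cos z.2 := by simpa [vec] using congrFun h 2
  have h3 : Real.sin y.2 = c * Real.sin z.2 := by simpa [vec] using congrFun h 3
  have hs : Real.sin (y.2 - z.2) = 0 := by rw [Real.sin_sub, h2, h3]; ring
  obtain ⟨k, hk⟩ := Real.sin_eq_zero_iff.1 hs
  have hy2 : y.2 = z.2 + k * Real.pi := by linarith
  have hck : c = (-1) ^ k := by
    rw [hy2, Real.cos_add_int_mul_pi] at h2
    rw [hy2, Real.sin_add_int_mul_pi] at h3
    have := Real.sin_sq_add_cos_sq z.2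
    linear_combination (-Real.cos z.2) * h2 - Real.sin z.2 * h3 + ((-1 : ℝ) ^ k - c) * this
  refine ⟨k, Prod.ext ?_ hy2⟩
  ext i
  have h0 : y.1 0 = c * z.1 0 := by simpa [vec] using congrFun h 0
  have h1 : y.1 1 = c * z.1 1 := by simpa [vec] using congrFun h 1
  fin_cases i
  · simp [deck, h0, hck]
  · simp [deck, h1, hck]

theorem eq_of_proj_eq_of_abs_lt {z y : Cyl} (h : proj y = proj z) (hlt : |y.2 - z.2| < Real.pi) :
    y = z := by
  obtain ⟨k, rfl⟩ := eq_deck_of_proj_eq h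
  have h1 : |(k : ℝ)| * Real.pi < 1 * Real.pi := by
    have : (deck k z).2 - z.2 = k * Real.pi := by simp [deck]
    rwa [this, abs_mul, abs_of_pos Real.pi_pos, ← one_mul Real.pi, ← mul_assoc, mul_one] at hlt
  have h2 : |(k : ℝ)| < 1 := lt_of_mul_lt_mul_right h1 Real.pi_pos.le
  have h3 : k = 0 := by
    have : |k| < 1 := by exact_mod_cast h2
    exact Int.abs_lt_one_iff.1 this
  subst h3
  simp [deck]

theorem exists_pos_smul_vec {v : V} (hv : v ≠ 0) (h : form v v ≤ 0) :
    ∃ z ∈ closedCover, ∃ c : ℝ, 0 < c ∧ v = c • vec z := by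
  set r := √(v 2 ^ 2 + v 3 ^ 2) with hr
  have hf : v 0 ^ 2 + v 1 ^ 2 ≤ v 2 ^ 2 + v 3 ^ 2 := by simp only [form] at h; linarith
  have hr0 : 0 < v 2 ^ 2 + v 3 ^ 2 := by
    by_contra hle
    apply hv
    have h2 : v 2 = 0 := by nlinarith [sq_nonneg (v 2), sq_nonneg (v 3)]
    have h3 : v 3 = 0 := by nlinarith [sq_nonneg (v 2), sq_nonneg (v 3)]
    have h0 : v 0 = 0 := by nlinarith [sq_nonneg (v 0), sq_nonneg (v 1)]
    have h1 : v 1 = 0 := by nlinarith [sq_nonneg (v 0), sq_nonneg (v 1)]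
    ext i; fin_cases i <;> assumption
  have hrp : 0 < r := Real.sqrt_pos.2 hr0
  have hrs : r ^ 2 = v 2 ^ 2 + v 3 ^ 2 := Real.sq_sqrt hr0.le
  obtain ⟨θ, -, h1, h2⟩ := exists_cos_sin_eq (x := v 2 / r) (y := v 3 / r) (by
    field_simp; linarith)
  refine ⟨(!₂[v 0 / r, v 1 / r], θ), ?_, r, hrp, ?_⟩
  · have : ‖(!₂[v 0 / r, v 1 / r] : EuclideanSpace ℝ (Fin 2))‖ ^ 2 ≤ 1 := by
      rw [norm_sq_eq_sum]
      simp only [Matrix.cons_val_zero, Matrix.cons_val_one, Matrix.cons_val_fin_one, div_pow]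
      rw [← add_div, div_le_one (by positivity), hrs]
      exact hf
    show ‖(!₂[v 0 / r, v 1 / r] : EuclideanSpace ℝ (Fin 2))‖ ≤ 1
    nlinarith [norm_nonneg (!₂[v 0 / r, v 1 / r] : EuclideanSpace ℝ (Fin 2))]
  · ext i
    fin_cases i <;> simp [vec, h1, h2] <;> field_simp

theorem exists_proj_eq {x : RP3} (h : x ∈ space ∪ boundary) : ∃ z ∈ closedCover, proj z = x := by
  induction x using Projectivization.ind with | h v hv =>
  have : form v v ≤ 0 := by
    rcases h with h | h
    · exact ((mk_mem_space hv).1 h).le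
    · exact ((mk_mem_boundary hv).1 h).le
  obtain ⟨z, hz, c, hc, h⟩ := exists_pos_smul_vec hv this
  refine ⟨z, hz, ((mk_eq_mk_iff _ _).2 ⟨c⁻¹, inv_ne_zero hc.ne', ?_⟩)⟩
  rw [h, smul_smul, inv_mul_cancel₀ hc.ne', one_smul]

/-! ### Topology of projective space -/

/-- The projection from nonzero vectors. -/
noncomputable def toRP3 (v : { v : V // v ≠ 0 }) : RP3 := Projectivization.mk ℝ v.1 v.2

theorem continuous_toRP3 : Continuous toRP3 := continuous_coinduced_rng

theorem isOpen_iff_preimage {U : Set RP3} : IsOpen U ↔ IsOpen (toRP3 ⁻¹' U) := isOpen_coinduced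

theorem isClosed_iff_preimage {U : Set RP3} : IsClosed U ↔ IsClosed (toRP3 ⁻¹' U) := by
  rw [← isOpen_compl_iff, isOpen_iff_preimage, preimage_compl, isOpen_compl_iff]

theorem isOpenMap_toRP3 : IsOpenMap toRP3 := by
  intro U hU
  rw [isOpen_iff_preimage]
  have : toRP3 ⁻¹' (toRP3 '' U)
      = ⋃ c : {c : ℝ // c ≠ 0}, (fun v : { v : V // v ≠ 0 } =>
        (⟨c.1 • v.1, smul_ne_zero c.2 v.2⟩ : { v : V // v ≠ 0 })) ⁻¹' U := by
    ext v
    simp only [mem_preimage, mem_image, mem_iUnion]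
    constructor
    · rintro ⟨w, hw, h⟩
      obtain ⟨c, hc, h⟩ := (mk_eq_mk_iff _ _).1 h
      refine ⟨⟨c, hc⟩, ?_⟩
      convert hw
      exact h.symm
    · rintro ⟨c, hc⟩
      exact ⟨_, hc, (mk_eq_mk_iff _ _).2 ⟨c.1, c.2, rfl⟩⟩
  rw [this]
  refine isOpen_iUnion fun c => hU.preimage ?_
  exact (continuous_subtype_val.const_smul c.1).subtype_mk _

theorem compactSpace_RP3 : CompactSpace RP3 := by
  have h : IsCompact (Metric.sphere (0 : V) 1) := isCompact_sphere _ _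
  rw [isCompact_iff_compactSpace] at h
  have hne : ∀ v : Metric.sphere (0 : V) 1, v.1 ≠ 0 := fun v h0 => by
    have := v.2; rw [h0] at this; simp at this
  have hc : Continuous fun v : Metric.sphere (0 : V) 1 => toRP3 ⟨v.1, hne v⟩ :=
    continuous_toRP3.comp (continuous_subtype_val.subtype_mk hne)
  have hs : Function.Surjective fun v : Metric.sphere (0 : V) 1 => toRP3 ⟨v.1, hne v⟩ := by
    intro x
    induction x using Projectivization.ind with | h v hv =>
    have hv' : ‖v‖ ≠ 0 := norm_ne_zero_iff.2 hv
    refine ⟨⟨‖v‖⁻¹ • v, ?_⟩, (mk_eq_mk_iff _ _).2 ⟨‖v‖⁻¹, inv_ne_zero hv', rfl⟩⟩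
    simp [norm_smul, hv']
  exact hs.compactSpace hc

end AdS
namespace AdS

/-! ### Time differences and the sign of the form -/

theorem abs_lt_arccos {c t : ℝ} (hc : |c| ≤ 1) (ht : |t| ≤ Real.pi) (h : c < Real.cos t) :
    |t| < Real.arccos c := by
  rw [← Real.cos_abs] at h
  have := Real.strictAntiOn_arccos (abs_le.1 hc) ⟨Real.neg_one_le_cos _, Real.cos_le_one _⟩ h
  rwa [Real.arccos_cos (abs_nonneg t) ht] at this

theorem abs_le_arccos {c t : ℝ} (ht : |t| ≤ Real.pi) (h : c ≤ Real.cos t) :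
    |t| ≤ Real.arccos c := by
  rw [← Real.cos_abs] at h
  have := Real.arccos_le_arccos h
  rwa [Real.arccos_cos (abs_nonneg t) ht] at this

theorem lt_cos_of_abs_lt_arccos {c t : ℝ} (h : |t| < Real.arccos c) : c < Real.cos t := by
  by_contra hle
  have h1 := Real.arccos_le_arccos (not_lt.1 hle)
  rw [← Real.cos_abs, Real.arccos_cos (abs_nonneg t) (h.le.trans (Real.arccos_le_pi c))] at h1
  linarith

theorem le_cos_of_abs_le_arccos {c t : ℝ} (hc : |c| ≤ 1) (h : |t| ≤ Real.arccos c) :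
    c ≤ Real.cos t := by
  have h1 := Real.cos_le_cos_of_nonneg_of_le_pi (abs_nonneg t) (Real.arccos_le_pi c) h
  rwa [Real.cos_arccos (abs_le.1 hc).1 (abs_le.1 hc).2, Real.cos_abs] at h1

theorem abs_inner_le_one {p q : EuclideanSpace ℝ (Fin 2)} (hp : ‖p‖ ≤ 1) (hq : ‖q‖ ≤ 1) :
    |inner ℝ p q| ≤ 1 :=
  (abs_real_inner_le_norm p q).trans (by nlinarith [norm_nonneg p, norm_nonneg q])

/-- The form sees times only through a cosine. If the cosine avoids -1, a time difference that
starts in (-π, π) stays there, which settles the ambiguity modulo 2π. -/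
theorem abs_lt_pi_of_isPreconnected {X : Type*} [TopologicalSpace X] {S : Set X}
    (hS : IsPreconnected S) {f : X → ℝ} (hf : ContinuousOn f S)
    (hc : ∀ x ∈ S, -1 < Real.cos (f x)) {x₀ : X} (hx₀ : x₀ ∈ S) (h : |f x₀| < Real.pi) :
    ∀ x ∈ S, |f x| < Real.pi := by
  have h1 : ∀ x ∈ S, f x ≠ Real.pi := fun x hx h0 => by
    have := hc x hx; rw [h0, Real.cos_pi] at this; exact lt_irrefl _ this
  have h2 : ∀ x ∈ S, f x ≠ -Real.pi := fun x hx h0 => by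
    have := hc x hx; rw [h0, Real.cos_neg, Real.cos_pi] at this; exact lt_irrefl _ this
  intro x hx
  rw [abs_lt] at h ⊢
  exact ⟨forall_gt_of_isPreconnected hS hf h2 hx₀ h.1 x hx,
    forall_lt_of_isPreconnected hS hf h1 hx₀ h.2 x hx⟩

theorem forall_neg_or_forall_pos {X : Type*} [TopologicalSpace X] {S : Set X}
    (hS : IsPreconnected S) {f : X → ℝ} (hf : ContinuousOn f S) (h : ∀ x ∈ S, f x ≠ 0) :
    (∀ x ∈ S, f x < 0) ∨ (∀ x ∈ S, 0 < f x) := by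
  rcases S.eq_empty_or_nonempty with rfl | ⟨x, hx⟩
  · simp
  · rcases lt_or_gt_of_ne (h x hx) with h1 | h1
    · exact Or.inl (forall_lt_of_isPreconnected hS hf h hx h1)
    · exact Or.inr (forall_gt_of_isPreconnected hS hf h hx h1)

/-- A point of anti-de Sitter space whose dual plane misses a connected set has a lift that is
spacelike related to every point of a given lift of the set. -/
theorem exists_lift_abs_lt_arccos {L : Set Cyl} (hL : IsPreconnected L) (hLc : L ⊆ closedCover)
    {y₀ : Cyl} (hy₀ : y₀ ∈ L) {z : Cyl} (hz : z ∈ cover)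
    (h : ∀ y ∈ L, form (vec z) (vec y) ≠ 0) :
    ∃ z', proj z' = proj z ∧ z' ∈ cover ∧
      ∀ y ∈ L, |z'.2 - y.2| < Real.arccos (inner ℝ z'.1 y.1) := by
  have hcv : Continuous fun y => form (vec z) (vec y) := by
    have := continuous_vec
    fun_prop
  obtain ⟨z₁, hp, hz₁, hneg⟩ : ∃ z₁, proj z₁ = proj z ∧ z₁ ∈ cover ∧
      ∀ y ∈ L, form (vec z₁) (vec y) < 0 := by
    rcases forall_neg_or_forall_pos hL hcv.continuousOn h with h1 | h1
    · exact ⟨z, rfl, hz, h1⟩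
    -- An odd deck transformation changes the sign of `vec`.
    · refine ⟨deck 1 z, proj_deck 1 z, by show ‖_‖ < 1; rw [norm_deck]; exact hz, fun y hy => ?_⟩
      rw [vec_deck, form_smul_left]
      simpa using h1 y hy
  -- An even deck transformation fixes `vec`; this one brings the time within π of that of `y₀`.
  set k : ℤ := round ((y₀.2 - z₁.2) / (2 * Real.pi)) with hk
  set z₂ := deck (2 * k) z₁ with hz₂
  have hv : vec z₂ = vec z₁ := by
    rw [hz₂, vec_deck, Even.neg_one_zpow ⟨k, by ring⟩, one_smul]
  have hz₂c : ‖z₂.1‖ < 1 := by rw [hz₂, norm_deck]; exact hz₁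
  have hcos : ∀ y ∈ L, inner ℝ z₂.1 y.1 < Real.cos (z₂.2 - y.2) := fun y hy => by
    have := hneg y hy
    rw [← hv, form_vec_vec] at this
    linarith
  have hcos' : ∀ y ∈ L, -1 < Real.cos (z₂.2 - y.2) := fun y hy =>
    (abs_lt.1 (abs_inner_lt_one hz₂c (hLc hy))).1.trans (hcos y hy)
  have hle : |z₂.2 - y₀.2| ≤ Real.pi := by
    have h1 := abs_sub_round ((y₀.2 - z₁.2) / (2 * Real.pi))
    rw [← hk] at h1
    have h2 : z₂.2 - y₀.2 = -(2 * Real.pi) * ((y₀.2 - z₁.2) / (2 * Real.pi) - k) := by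
      simp only [hz₂, deck]; push_cast; field_simp; ring
    rw [h2, abs_mul, abs_neg, abs_of_pos Real.two_pi_pos]
    nlinarith [Real.pi_pos]
  have hlt : |z₂.2 - y₀.2| < Real.pi := by
    refine lt_of_le_of_ne hle fun h0 => ?_
    have := hcos' y₀ hy₀
    rw [← Real.cos_abs, h0, Real.cos_pi] at this
    exact lt_irrefl _ this
  have hall := abs_lt_pi_of_isPreconnected hL (f := fun y => z₂.2 - y.2) (by fun_prop) hcos' hy₀ hlt
  exact ⟨z₂, (proj_deck _ _).trans hp, hz₂c, fun y hy =>
    abs_lt_arccos (abs_inner_le_one hz₂c.le (hLc hy)) (hall y hy).le (hcos y hy)⟩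

/-! ### A section of the covering over the complement of a spacelike plane -/

/-- Away from the dual plane, each line has a generator pairing negatively with `vec z₀`, unique up
to positive scale. Normalizing it gives the Klein coordinate, and its argument relative to `z₀.2`
gives the time. -/
theorem exists_section {z₀ : Cyl} (hz₀ : z₀ ∈ cover) {K : Set RP3} (hK : K ⊆ space ∪ boundary)
    (hd : ∀ x ∈ K, x ∉ dualPlane (proj z₀)) :
    ∃ s : RP3 → Cyl, ContinuousOn s K ∧ ∀ x ∈ K, s x ∈ closedCover ∧ proj (s x) = x ∧
      |(s x).2 - z₀.2| < Real.arccos (inner ℝ z₀.1 (s x).1) := by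
  have hz₀' : ‖z₀.1‖ < 1 := hz₀
  -- Quadratic in `v`, hence insensitive to its sign: this is the generator negative on `vec z₀`.
  let n : V → V := fun v => (-form (vec z₀) v) • v
  let r : V → ℝ := fun v => √(n v 2 ^ 2 + n v 3 ^ 2)
  -- The last two coordinates as a complex number, rotated so that the time `z₀.2` has argument 0.
  let B : V → ℂ := fun v => ⟨n v 2 * Real.cos z₀.2 + n v 3 * Real.sin z₀.2,
    n v 3 * Real.cos z₀.2 - n v 2 * Real.sin z₀.2⟩
  let S : V → Cyl := fun v => (!₂[n v 0 / r v, n v 1 / r v], z₀.2 + (B v).arg)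
  have hn : Continuous n := by simp only [n]; fun_prop
  have hni : ∀ i, Continuous fun v => n v i := fun i => (continuous_apply i).comp hn
  have hr : Continuous r := by
    have := hni 2; have := hni 3
    simp only [r]; fun_prop
  have hB : Continuous B := by
    have h2 := hni 2; have h3 := hni 3
    have : B = fun v => ((n v 2 * Real.cos z₀.2 + n v 3 * Real.sin z₀.2 : ℝ) : ℂ) +
        ((n v 3 * Real.cos z₀.2 - n v 2 * Real.sin z₀.2 : ℝ) : ℂ) * Complex.I := by
      funext v
      exact Complex.mk_eq_add_mul_I _ _
    rw [this]; fun_prop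
  have hBr : ∀ v, ‖B v‖ = r v := fun v => by
    rw [Complex.norm_eq_sqrt_sq_add_sq]
    simp only [r, B]
    congr 1
    linear_combination (n v 2 ^ 2 + n v 3 ^ 2) * Real.sin_sq_add_cos_sq z₀.2
  have hrpos : ∀ v, v ≠ 0 → form v v ≤ 0 → form (vec z₀) v ≠ 0 → 0 < r v := by
    intro v hv hvv hv0
    have hnv : n v ≠ 0 := smul_ne_zero (neg_ne_zero.2 hv0) hv
    have hnn : form (n v) (n v) ≤ 0 := by
      simp only [n, form_smul_left, form_smul_right]
      nlinarith [mul_self_nonneg (form (vec z₀) v)]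
    obtain ⟨z, -, c, hc, h⟩ := exists_pos_smul_vec hnv hnn
    refine Real.sqrt_pos.2 ?_
    rw [h]
    have : (c • vec z) 2 ^ 2 + (c • vec z) 3 ^ 2 = c ^ 2 := by
      simp only [Pi.smul_apply, smul_eq_mul, vec]
      simp
      linear_combination c ^ 2 * Real.sin_sq_add_cos_sq z.2
    rw [this]; positivity
  have hvec : ∀ v, 0 < r v → vec (S v) = (r v)⁻¹ • n v := by
    intro v hrv
    have hB0 : B v ≠ 0 := by
      intro h0; rw [← hBr, h0, norm_zero] at hrv; exact lt_irrefl _ hrv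
    have h1 : Real.cos (B v).arg = (B v).re / r v := by rw [Complex.cos_arg hB0, hBr]
    have h2 : Real.sin (B v).arg = (B v).im / r v := by rw [Complex.sin_arg, hBr]
    have h3 := Real.sin_sq_add_cos_sq z₀.2
    ext i
    fin_cases i
    · simp [vec, S]; ring
    · simp [vec, S]; ring
    · simp only [vec, S, Real.cos_add, h1, h2, B]
      simp
      field_simp
      linear_combination n v 2 * h3
    · simp only [vec, S, Real.sin_add, h1, h2, B]
      simp
      field_simp
      linear_combination n v 3 * h3
  have hprop : ∀ v (hv : v ≠ 0), form v v ≤ 0 → form (vec z₀) v ≠ 0 →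
      S v ∈ closedCover ∧ proj (S v) = Projectivization.mk ℝ v hv ∧
        |(S v).2 - z₀.2| < Real.arccos (inner ℝ z₀.1 (S v).1) := by
    intro v hv hvv hv0
    have hrv := hrpos v hv hvv hv0
    have hvS := hvec v hrv
    have hcl : S v ∈ closedCover := by
      have h1 := form_vec_self (S v)
      rw [hvS] at h1
      simp only [n, form_smul_left, form_smul_right] at h1
      have h2 : (r v)⁻¹ * ((r v)⁻¹ * (-form (vec z₀) v * (-form (vec z₀) v * form v v))) ≤ 0 := by
        have : (r v)⁻¹ * ((r v)⁻¹ * (-form (vec z₀) v * (-form (vec z₀) v * form v v)))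
          = ((r v)⁻¹ * form (vec z₀) v) ^ 2 * form v v := by ring
        rw [this]
        exact mul_nonpos_of_nonneg_of_nonpos (sq_nonneg _) hvv
      show ‖(S v).1‖ ≤ 1
      nlinarith [norm_nonneg (S v).1]
    refine ⟨hcl, ?_, ?_⟩
    · refine (mk_eq_mk_iff _ _).2 ⟨(r v)⁻¹ * -form (vec z₀) v, ?_, ?_⟩
      · exact mul_ne_zero (inv_ne_zero hrv.ne') (neg_ne_zero.2 hv0)
      · rw [hvS, ← smul_smul]
    · have h1 : (S v).2 - z₀.2 = (B v).arg := by simp [S]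
      refine abs_lt_arccos (abs_inner_le_one hz₀'.le hcl) (h1 ▸ Complex.abs_arg_le_pi _) ?_
      have h2 := form_vec_vec z₀ (S v)
      rw [hvS] at h2
      simp only [n, form_smul_right] at h2
      have h3 : 0 < (r v)⁻¹ * (form (vec z₀) v * form (vec z₀) v) :=
        mul_pos (inv_pos.2 hrv) (mul_self_pos.2 hv0)
      rw [← neg_sub z₀.2 (S v).2, Real.cos_neg]
      linarith
  have hhom : ∀ (c : ℝ) (v : V), c ≠ 0 → S (c • v) = S v := by
    intro c v hc
    have hcc : 0 < c ^ 2 := by positivity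
    have hnc : n (c • v) = c ^ 2 • n v := by
      simp only [n, form_smul_right, smul_smul]; congr 1; ring
    have hrc : r (c • v) = c ^ 2 * r v := by
      simp only [r, hnc, Pi.smul_apply, smul_eq_mul]
      rw [← Real.sqrt_sq hcc.le, ← Real.sqrt_mul (sq_nonneg _), Real.sqrt_sq hcc.le]
      congr 1; ring
    have hBc : B (c • v) = ((c ^ 2 : ℝ) : ℂ) * B v := by
      apply Complex.ext
      · simp only [B, hnc, Complex.re_ofReal_mul, Pi.smul_apply, smul_eq_mul]; ring
      · simp only [B, hnc, Complex.im_ofReal_mul, Pi.smul_apply, smul_eq_mul]; ring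
    simp only [S, hrc, hBc, Complex.arg_real_mul _ hcc, hnc, Pi.smul_apply, smul_eq_mul,
      mul_div_mul_left _ _ hcc.ne']
  have hcont : ∀ v, v ≠ 0 → form v v ≤ 0 → form (vec z₀) v ≠ 0 → ContinuousAt S v := by
    intro v hv hvv hv0
    have hrv := hrpos v hv hvv hv0
    -- The time bound, already established pointwise, keeps `B v` off the branch cut of the
    -- argument.
    have harg : |(B v).arg| < Real.pi := by
      have h1 : (S v).2 - z₀.2 = (B v).arg := by simp [S]
      rw [← h1]
      exact (hprop v hv hvv hv0).2.2.trans_le (Real.arccos_le_pi _)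
    have hslit : B v ∈ Complex.slitPlane := by
      rw [Complex.mem_slitPlane_iff_arg]
      refine ⟨(abs_lt.1 harg).2.ne, fun h0 => ?_⟩
      rw [← hBr, h0, norm_zero] at hrv
      exact lt_irrefl _ hrv
    have h2 : ContinuousAt (fun v => (B v).arg) v :=
      (Complex.continuousAt_arg hslit).comp hB.continuousAt
    have h3 : ∀ i, ContinuousAt (fun v => n v i / r v) v := fun i =>
      (hni i).continuousAt.div hr.continuousAt hrv.ne'
    have h4 : ContinuousAt (fun v => (!₂[n v 0 / r v, n v 1 / r v] : EuclideanSpace ℝ (Fin 2))) v := by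
      refine (PiLp.continuous_toLp 2 _).continuousAt.comp (continuousAt_pi.2 fun i => ?_)
      fin_cases i
      · exact h3 0
      · exact h3 1
    exact h4.prodMk (continuousAt_const.add h2)
  have hmk : ∀ v (hv : v ≠ 0), S (Projectivization.mk ℝ v hv).rep = S v := by
    intro v hv
    obtain ⟨c, hc, h⟩ := exists_rep_eq v hv
    rw [h, hhom c v hc]
  have hgood : ∀ v (hv : v ≠ 0), Projectivization.mk ℝ v hv ∈ K →
      form v v ≤ 0 ∧ form (vec z₀) v ≠ 0 := by
    intro v hv hx
    refine ⟨?_, fun h0 => hd _ hx ((mk_mem_dualPlane _ hv).2 h0)⟩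
    rcases hK hx with h | h
    · exact ((mk_mem_space hv).1 h).le
    · exact ((mk_mem_boundary hv).1 h).le
  refine ⟨fun x => S x.rep, fun x hx => ContinuousAt.continuousWithinAt ?_, fun x hx => ?_⟩
  · induction x using Projectivization.ind with | h v hv =>
    obtain ⟨h1, h2⟩ := hgood v hv hx
    have h3 : ContinuousAt (fun w : { v : V // v ≠ 0 } => S w.1) ⟨v, hv⟩ :=
      ContinuousAt.comp (g := S) (f := Subtype.val) (hcont v hv h1 h2)
        continuous_subtype_val.continuousAt
    have h4 : (fun x : RP3 => S x.rep) ∘ toRP3 = fun w : { v : V // v ≠ 0 } => S w.1 := by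
      funext w; exact hmk w.1 w.2
    show Filter.Tendsto (fun x : RP3 => S x.rep) (𝓝 (toRP3 ⟨v, hv⟩)) (𝓝 (S (toRP3 ⟨v, hv⟩).rep))
    -- The quotient map is open, so continuity can be checked on nonzero vectors.
    refine Filter.Tendsto.mono_left ?_ (isOpenMap_toRP3.nhds_le _)
    rw [Filter.tendsto_map'_iff, h4]
    show Filter.Tendsto _ _ (𝓝 (S (Projectivization.mk ℝ v hv).rep))
    rw [hmk]
    exact h3
  · induction x using Projectivization.ind with | h v hv =>
    obtain ⟨h1, h2⟩ := hgood v hv hx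
    simp only [hmk]
    exact hprop v hv h1 h2

/-! ### Causal structure in terms of time differences -/

/-- Points of `L` have height 0 on the hemisphere, so the spherical distance to them is `arccos` of
the planar inner product. Great-circle paths realize it, and no causal path does better. -/
theorem mem_coverInvisible_iff {L : Set Cyl} (hL : ∀ y ∈ L, ‖y.1‖ = 1) {z : Cyl} :
    z ∈ coverInvisible L ↔
      z ∈ cover ∧ ∀ y ∈ L, |z.2 - y.2| < Real.arccos (inner ℝ z.1 y.1) := by
  constructor
  · rintro ⟨hz, -, h⟩
    refine ⟨hz, fun y hy => ?_⟩
    by_contra hle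
    obtain ⟨c, hc, h0, h1⟩ := exists_isCausal_of_le hz (hL y hy) (not_lt.1 hle)
    exact h c hc h0 (h1 ▸ hy)
  · rintro ⟨hz, h⟩
    have hz' : ‖z.1‖ < 1 := hz
    refine ⟨hz, fun hzL => ?_, fun c hc h0 h1 => ?_⟩
    · have := hL z hzL; linarith
    · obtain ⟨e, he, h2⟩ := hc.exists_sign_hemiDist_le
      have h3 := h2 0 1 le_rfl zero_le_one le_rfl
      have h4 := h _ h1
      rw [hemiDist_comm, hemiDist_eq_arccos (hL _ h1), real_inner_comm, h0] at h3
      have h5 : |e| = 1 := (pow_eq_one_iff_of_nonneg (abs_nonneg e) two_ne_zero).1 (by rwa [sq_abs])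
      have h6 := le_abs_self (e * ((c 1).2 - z.2))
      rw [abs_mul, h5, one_mul, abs_sub_comm] at h6
      linarith

/-- On the window `[z.2, z.2 + π]` the cosine is injective, so the lifted plane is a graph over the
closed disc. -/
theorem mem_planeLift_iff {z y : Cyl} (hz : z ∈ closedCover) :
    y ∈ planeLift z ↔ y ∈ closedCover ∧ y.2 - z.2 = Real.arccos (inner ℝ z.1 y.1) := by
  constructor
  · rintro ⟨hy, h0, h1, h2⟩
    refine ⟨hy, ?_⟩
    rw [form_vec_vec] at h0
    have : inner ℝ z.1 y.1 = Real.cos (y.2 - z.2) := by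
      rw [← Real.cos_neg, neg_sub]; linarith
    rw [this, Real.arccos_cos] <;> linarith
  · rintro ⟨hy, h⟩
    have hi := abs_le.1 (abs_inner_le_one hz hy)
    refine ⟨hy, ?_, ?_, ?_⟩
    · rw [form_vec_vec, ← Real.cos_neg, neg_sub, h, Real.cos_arccos hi.1 hi.2, sub_self]
    · linarith [Real.arccos_nonneg (inner ℝ z.1 y.1)]
    · linarith [Real.arccos_le_pi (inner ℝ z.1 y.1)]

theorem hemiDist_nonneg (p q : EuclideanSpace ℝ (Fin 2)) : 0 ≤ hemiDist p q :=
  Real.arccos_nonneg _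

/-- The graph is 1-Lipschitz, so a timelike path going back from it stays below; conversely each
point below it is reached by a vertical path. -/
theorem mem_chronPast_union_iff {z y : Cyl} (hz : z ∈ closedCover) (hy : y ∈ closedCover) :
    y ∈ chronPast (planeLift z) ∪ planeLift z ↔ y.2 - z.2 ≤ Real.arccos (inner ℝ z.1 y.1) := by
  constructor
  · rintro (⟨c, hc, h0, rfl, hlt⟩ | h)
    · obtain ⟨h1, h2⟩ := (mem_planeLift_iff hz).1 h0
      obtain ⟨e, he, h3⟩ := hc.isCausal.exists_sign_hemiDist_le
      have h4 := h3 0 1 le_rfl zero_le_one le_rfl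
      have h5 := hemiDist_nonneg (c 0).1 (c 1).1
      have h6 := arccos_inner_le_add_hemiDist hz hy h1
      rw [hemiDist_comm] at h6
      have : e = -1 := by
        rcases sq_eq_one_iff.1 he with h | h
        · rw [h] at h4; linarith
        · exact h
      rw [this] at h4
      linarith
    · exact ((mem_planeLift_iff hz).1 h).2.le
  · intro h
    rcases h.eq_or_lt with h | h
    · exact Or.inr ((mem_planeLift_iff hz).2 ⟨hy, h⟩)
    · left
      have hlt : y.2 < z.2 + Real.arccos (inner ℝ z.1 y.1) := by linarith
      obtain ⟨c, hc, h0, h1⟩ := exists_isTimelike_vertical hy hlt.ne'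
      refine ⟨c, hc, ?_, h1, ?_⟩
      · rw [h0]; exact (mem_planeLift_iff hz).2 ⟨hy, by simp⟩
      · rw [h0, h1]; exact hlt

theorem mem_chronFuture_union_iff {z y : Cyl} (hz : z ∈ closedCover) (hy : y ∈ closedCover) :
    y ∈ chronFuture (planeLift z) ∪ planeLift z ↔ Real.arccos (inner ℝ z.1 y.1) ≤ y.2 - z.2 := by
  constructor
  · rintro (⟨c, hc, h0, rfl, hlt⟩ | h)
    · obtain ⟨h1, h2⟩ := (mem_planeLift_iff hz).1 h0
      obtain ⟨e, he, h3⟩ := hc.isCausal.exists_sign_hemiDist_le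
      have h4 := h3 0 1 le_rfl zero_le_one le_rfl
      have h5 := hemiDist_nonneg (c 0).1 (c 1).1
      have h6 := arccos_inner_le_add_hemiDist hz h1 hy
      have : e = 1 := by
        rcases sq_eq_one_iff.1 he with h | h
        · exact h
        · rw [h] at h4; linarith
      rw [this] at h4
      linarith
    · exact ((mem_planeLift_iff hz).1 h).2.ge
  · intro h
    rcases h.eq_or_lt with h | h
    · exact Or.inr ((mem_planeLift_iff hz).2 ⟨hy, h.symm⟩)
    · left
      have hlt : z.2 + Real.arccos (inner ℝ z.1 y.1) < y.2 := by linarith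
      obtain ⟨c, hc, h0, h1⟩ := exists_isTimelike_vertical hy hlt.ne
      refine ⟨c, hc, ?_, h1, ?_⟩
      · rw [h0]; exact (mem_planeLift_iff hz).2 ⟨hy, by simp⟩
      · rw [h0, h1]; exact hlt

end AdS
namespace AdS

/-! ### Lifts of proper achronal meridians -/

/-- An injective continuous map from the circle to itself is surjective. -/
theorem exists_eq_of_injective_circle {g : Circle → EuclideanSpace ℝ (Fin 2)} (hg : Continuous g)
    (hinj : Function.Injective g) (hn : ∀ x, ‖g x‖ = 1) {u : EuclideanSpace ℝ (Fin 2)}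
    (hu : ‖u‖ = 1) : ∃ x, g x = u := by
  by_contra! hne
  have hu2 : u 0 ^ 2 + u 1 ^ 2 = 1 := by rw [← norm_sq_eq_sum, hu]; norm_num
  have hg2 : ∀ x, g x 0 ^ 2 + g x 1 ^ 2 = 1 := fun x => by rw [← norm_sq_eq_sum, hn]; norm_num
  -- The rotation that takes the omitted point `u` to -1: the image then lies in the slit plane,
  -- where the argument is continuous.
  let B : Circle → ℂ := fun x => ⟨-(g x 0 * u 0 + g x 1 * u 1), -(g x 1 * u 0 - g x 0 * u 1)⟩
  have hB : Continuous B := by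
    have : B = fun x => ((-(g x 0 * u 0 + g x 1 * u 1) : ℝ) : ℂ) +
        ((-(g x 1 * u 0 - g x 0 * u 1) : ℝ) : ℂ) * Complex.I := by
      funext v
      exact Complex.mk_eq_add_mul_I _ _
    rw [this]; fun_prop
  have hB1 : ∀ x, ‖B x‖ = 1 := fun x => by
    rw [Complex.norm_eq_sqrt_sq_add_sq, Real.sqrt_eq_one]
    simp only [B]
    linear_combination (u 0 ^ 2 + u 1 ^ 2) * hg2 x + hu2
  have hslit : ∀ x, B x ∈ Complex.slitPlane := by
    intro x
    by_contra h
    rw [Complex.mem_slitPlane_iff, not_or, not_lt, not_not] at h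
    obtain ⟨h1, h2⟩ := h
    simp only [B] at h1 h2
    have h4 : (g x 0 * u 0 + g x 1 * u 1) ^ 2 = 1 := by
      linear_combination (u 0 ^ 2 + u 1 ^ 2) * hg2 x + hu2 + (g x 1 * u 0 - g x 0 * u 1) * h2
    have h3 : g x 0 * u 0 + g x 1 * u 1 = 1 := by nlinarith
    apply hne x
    ext i
    fin_cases i
    · show g x 0 = u 0
      linear_combination u 0 * h3 - g x 0 * hu2 + u 1 * h2
    · show g x 1 = u 1
      linear_combination u 1 * h3 - g x 1 * hu2 - u 0 * h2
  have hBinj : Function.Injective B := by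
    intro x y h
    apply hinj
    have h1 : g x 0 * u 0 + g x 1 * u 1 = g y 0 * u 0 + g y 1 * u 1 :=
      neg_injective (congrArg Complex.re h)
    have h2 : g x 1 * u 0 - g x 0 * u 1 = g y 1 * u 0 - g y 0 * u 1 :=
      neg_injective (congrArg Complex.im h)
    ext i
    fin_cases i
    · show g x 0 = g y 0
      linear_combination u 0 * h1 - u 1 * h2 - (g x 0 - g y 0) * hu2
    · show g x 1 = g y 1
      linear_combination u 1 * h1 + u 0 * h2 - (g x 1 - g y 1) * hu2
  have hh : Continuous fun x => (B x).arg :=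
    continuous_iff_continuousAt.2 fun x =>
      (Complex.continuousAt_arg (hslit x)).comp hB.continuousAt
  have hhinj : Function.Injective fun x => (B x).arg := fun x y h =>
    hBinj (Complex.ext_norm_arg (by rw [hB1, hB1]) h)
  have hπ : ∀ x : Circle, x * Circle.exp Real.pi ≠ x := fun x h =>
    Circle.exp_pi_ne_one (mul_eq_left.1 h)
  -- Borsuk–Ulam in dimension one: this difference changes sign under the antipodal map, so it
  -- vanishes somewhere, against injectivity.
  have hk : Continuous fun x : Circle => (B x).arg - (B (x * Circle.exp Real.pi)).arg :=
    hh.sub (hh.comp (continuous_mul_const _))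
  have hk0 : ∀ x : Circle, (B x).arg - (B (x * Circle.exp Real.pi)).arg ≠ 0 := fun x h =>
    hπ x (hhinj (sub_eq_zero.1 h)).symm
  have h2π : (1 : Circle) * Circle.exp Real.pi * Circle.exp Real.pi = 1 := by
    rw [one_mul, ← Circle.exp_add, ← two_mul, Circle.exp_two_pi]
  rcases forall_neg_or_forall_pos isPreconnected_univ hk.continuousOn (fun x _ => hk0 x) with h | h
  all_goals
    have h1 := h 1 (mem_univ _)
    have h2 := h (1 * Circle.exp Real.pi) (mem_univ _)
    rw [h2π] at h2
    linarith

/-- The properties of the lifts of a proper achronal meridian: they are graphs of functions on the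
circle that are `1`-Lipschitz for the angular distance, and some point of the universal cover is
spacelike related to all their points. -/
structure IsMeridianLift (L : Set Cyl) (Λ : Set RP3) : Prop where
  norm_eq : ∀ y ∈ L, ‖y.1‖ = 1
  exists_mem : ∀ u : EuclideanSpace ℝ (Fin 2), ‖u‖ = 1 → ∃ y ∈ L, y.1 = u
  abs_le : ∀ y ∈ L, ∀ y' ∈ L, |y.2 - y'.2| ≤ Real.arccos (inner ℝ y.1 y'.1)
  image_eq : proj '' L = Λ
  isCompact : IsCompact L
  isConnected : IsConnected L
  exists_base : ∃ z ∈ cover, ∀ y ∈ L, |z.2 - y.2| < Real.arccos (inner ℝ z.1 y.1)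

theorem form_neg_of_abs_lt {z y : Cyl} (h : |z.2 - y.2| < Real.arccos (inner ℝ z.1 y.1)) :
    form (vec z) (vec y) < 0 := by
  have := lt_cos_of_abs_lt_arccos h
  rw [form_vec_vec]; linarith

theorem form_nonpos_of_abs_le {z y : Cyl} (hz : z ∈ closedCover) (hy : y ∈ closedCover)
    (h : |z.2 - y.2| ≤ Real.arccos (inner ℝ z.1 y.1)) : form (vec z) (vec y) ≤ 0 := by
  have := le_cos_of_abs_le_arccos (abs_inner_le_one hz hy) h
  rw [form_vec_vec]; linarith

/-- A timelike path between two points that are spacelike related to a point `z₀` of the cover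
stays spacelike related to `z₀`. -/
theorem IsCausal.abs_lt_arccos {c : ℝ → Cyl} (hc : IsCausal c) {z₀ : Cyl} (hz₀ : z₀ ∈ closedCover)
    (h0 : c 0 ∈ closedCover) (h1 : c 1 ∈ closedCover)
    (h0' : |z₀.2 - (c 0).2| < Real.arccos (inner ℝ z₀.1 (c 0).1))
    (h1' : |z₀.2 - (c 1).2| < Real.arccos (inner ℝ z₀.1 (c 1).1)) {τ : ℝ} (hτ : τ ∈ Icc (0 : ℝ) 1) :
    |z₀.2 - (c τ).2| < Real.arccos (inner ℝ z₀.1 (c τ).1) := by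
  have hcl : c τ ∈ closedCover := by
    rcases eq_or_lt_of_le hτ.1 with h | h
    · rwa [← h]
    rcases eq_or_lt_of_le hτ.2 with h' | h'
    · rwa [h']
    · exact cover_subset_closedCover (hc.1.2.2 τ ⟨h, h'⟩)
  obtain ⟨e, he, H⟩ := hc.exists_sign_hemiDist_le
  have k1 := H 0 τ le_rfl hτ.1 hτ.2
  have k2 := H τ 1 hτ.1 hτ.2 le_rfl
  have t1 := arccos_inner_le_add_hemiDist hz₀ hcl h0
  have t2 := arccos_inner_le_add_hemiDist hz₀ hcl h1
  rw [hemiDist_comm] at t1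
  rw [abs_lt] at h0' h1' ⊢
  rcases sq_eq_one_iff.1 he with rfl | rfl <;> constructor <;> linarith

/-- A lift `z₀` of `w` is spacelike related to all of `L`. Two points violating the Lipschitz bound
would be joined by a timelike path, which stays spacelike related to `z₀` and so avoids the dual
plane of `w`, against achronality. -/
theorem IsProperAchronalMeridian.isMeridianLift {Λ : Set RP3} (hΛ : IsProperAchronalMeridian Λ)
    {L : Set Cyl} (hL : IsLift L Λ) : IsMeridianLift L Λ := by
  obtain ⟨hb, ⟨-, w, hw, hdis, hach⟩, γ, hγ, hrange⟩ := hΛ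
  obtain ⟨s, hs, hsec, rfl⟩ := hL
  have hnorm : ∀ y ∈ s '' Λ, ‖y.1‖ = 1 := by
    rintro _ ⟨x, hx, rfl⟩
    rw [← proj_mem_boundary, (hsec x hx).2]
    exact hb hx
  have hcl : s '' Λ ⊆ closedCover := fun y hy => (hnorm y hy).le
  have hΛc : IsCompact Λ := hrange ▸ isCompact_range hγ.continuous
  have hΛconn : IsConnected Λ := hrange ▸ isConnected_range hγ.continuous
  have hconn : IsConnected (s '' Λ) := hΛconn.image s hs
  have himg : proj '' (s '' Λ) = Λ := by
    rw [image_image]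
    exact (image_congr fun x hx => (hsec x hx).2).trans (image_id' Λ)
  obtain ⟨zw, -, rfl⟩ := exists_proj_eq (Or.inl hw)
  rw [proj_mem_space] at hw
  obtain ⟨y₀, hy₀⟩ := hconn.nonempty
  obtain ⟨z₀, hz₀p, hz₀, hz₀L⟩ := exists_lift_abs_lt_arccos hconn.isPreconnected hcl hy₀ hw
    fun y hy h0 => by
      have h1 : proj y ∈ Λ := himg ▸ mem_image_of_mem _ hy
      exact disjoint_left.1 hdis h1 ((mk_mem_dualPlane _ _).2 h0)
  have habs : ∀ y ∈ s '' Λ, ∀ y' ∈ s '' Λ, |y.2 - y'.2| ≤ Real.arccos (inner ℝ y.1 y'.1) := by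
    intro y hy y' hy'
    by_contra hlt
    rw [not_le, abs_sub_comm] at hlt
    obtain ⟨c, hc, rfl, rfl⟩ := exists_isTimelike_of_norm_eq_one (hnorm y hy) (hnorm y' hy') hlt
    refine hach c hc (fun τ hτ hmem => ?_) ⟨himg ▸ mem_image_of_mem _ hy,
      himg ▸ mem_image_of_mem _ hy'⟩
    have h1 := hc.isCausal.abs_lt_arccos (cover_subset_closedCover hz₀) (hcl hy) (hcl hy')
      (hz₀L _ hy) (hz₀L _ hy') hτ
    have h2 := form_neg_of_abs_lt h1
    rw [← hz₀p] at hmem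
    exact h2.ne ((mk_mem_dualPlane _ _).1 hmem)
  refine ⟨hnorm, fun u hu => ?_, habs, himg, hΛc.image_of_continuousOn hs, hconn, z₀, hz₀, hz₀L⟩
  have hmem : ∀ x, γ x ∈ Λ := fun x => hrange ▸ mem_range_self x
  have hsγ : Continuous fun x => s (γ x) := hs.comp_continuous hγ.continuous hmem
  -- By the Lipschitz bound a point of the lift is determined by its boundary coordinate, so that
  -- coordinate is injective along the meridian.
  obtain ⟨x, hx⟩ := exists_eq_of_injective_circle (g := fun x => (s (γ x)).1)
    (continuous_fst.comp hsγ) (fun x x' hxx' => by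
      have h1 := habs _ (mem_image_of_mem s (hmem x)) _ (mem_image_of_mem s (hmem x'))
      have hxx'' : (s (γ x)).1 = (s (γ x')).1 := hxx'
      rw [hxx'', real_inner_self_eq_norm_sq, hnorm _ (mem_image_of_mem s (hmem x'))] at h1
      have h2 : (s (γ x)).2 = (s (γ x')).2 := by
        simp only [one_pow, Real.arccos_one] at h1
        exact sub_eq_zero.1 (abs_nonpos_iff.1 h1)
      have h3 : s (γ x) = s (γ x') := Prod.ext hxx'' h2
      have h4 := congrArg proj h3
      rw [(hsec _ (hmem x)).2, (hsec _ (hmem x')).2] at h4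
      exact hγ.injective h4) (fun x => hnorm _ (mem_image_of_mem s (hmem x))) hu
  exact ⟨_, mem_image_of_mem s (hmem x), hx⟩

theorem IsProperAchronalMeridian.exists_isLift {Λ : Set RP3} (hΛ : IsProperAchronalMeridian Λ) :
    ∃ L, IsLift L Λ := by
  obtain ⟨hb, ⟨-, w, hw, hdis, -⟩, -⟩ := hΛ
  obtain ⟨zw, -, rfl⟩ := exists_proj_eq (Or.inl hw)
  obtain ⟨s, hs, h⟩ := exists_section (proj_mem_space.1 hw) (hb.trans subset_union_right)
    fun x hx => disjoint_left.1 hdis hx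
  exact ⟨_, s, hs, fun x hx => ⟨(h x hx).1, (h x hx).2.1⟩, rfl⟩

end AdS
namespace AdS

/-! ### The dual cone and the hull cone of a lift -/

/-- The closed cone dual to the set `vec '' L`. -/
def dualCone (L : Set Cyl) : Set V := {m | ∀ y ∈ L, form m (vec y) ≤ 0}

/-- The bidual of the set `vec '' L`, which is the closed convex cone that it generates. -/
def hullCone (L : Set Cyl) : Set V := {v | ∀ m ∈ dualCone L, form m v ≤ 0}

/-- The image in projective space of the nonzero vectors of a set. -/
def coneImage (T : Set V) : Set RP3 := {x | ∃ v ∈ T, ∃ hv : v ≠ 0, Projectivization.mk ℝ v hv = x}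

theorem smul_mem_dualCone {L : Set Cyl} {m : V} (hm : m ∈ dualCone L) {c : ℝ} (hc : 0 ≤ c) :
    c • m ∈ dualCone L := fun y hy => by
  rw [form_smul_left]; exact mul_nonpos_of_nonneg_of_nonpos hc (hm y hy)

theorem smul_mem_hullCone {L : Set Cyl} {v : V} (hv : v ∈ hullCone L) {c : ℝ} (hc : 0 ≤ c) :
    c • v ∈ hullCone L := fun m hm => by
  rw [form_smul_right]; exact mul_nonpos_of_nonneg_of_nonpos hc (hv m hm)

theorem add_mem_dualCone {L : Set Cyl} {m n : V} (hm : m ∈ dualCone L) (hn : n ∈ dualCone L) :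
    m + n ∈ dualCone L := fun y hy => by
  rw [form_add_left]; exact add_nonpos (hm y hy) (hn y hy)

theorem add_mem_hullCone {L : Set Cyl} {u v : V} (hu : u ∈ hullCone L) (hv : v ∈ hullCone L) :
    u + v ∈ hullCone L := fun m hm => by
  rw [form_add_right]; exact add_nonpos (hu m hm) (hv m hm)

theorem isClosed_dualCone (L : Set Cyl) : IsClosed (dualCone L) := by
  have : dualCone L = ⋂ y ∈ L, {m | form m (vec y) ≤ 0} := by
    ext m; simp [dualCone]
  rw [this]
  exact isClosed_biInter fun y _ => isClosed_le (by fun_prop) continuous_const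

theorem vec_mem_hullCone {L : Set Cyl} {y : Cyl} (hy : y ∈ L) : vec y ∈ hullCone L :=
  fun _ hm => hm y hy

theorem mk_mem_coneImage {T : Set V} (hT : ∀ v ∈ T, ∀ c : ℝ, 0 ≤ c → c • v ∈ T) {v : V}
    (hv : v ≠ 0) : Projectivization.mk ℝ v hv ∈ coneImage T ↔ v ∈ T ∨ -v ∈ T := by
  constructor
  · rintro ⟨u, hu, hu0, h⟩
    obtain ⟨c, hc, rfl⟩ := (mk_eq_mk_iff _ _).1 h.symm
    rcases lt_or_gt_of_ne hc with h | h
    · right; rw [← neg_smul]; exact hT u hu _ (by linarith)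
    · left; exact hT u hu _ h.le
  · rintro (h | h)
    · exact ⟨v, h, hv, rfl⟩
    · exact ⟨-v, h, neg_ne_zero.2 hv, (mk_eq_mk_iff _ _).2 ⟨-1, by norm_num, by simp⟩⟩

theorem isClosed_coneImage {T : Set V} (hT : ∀ v ∈ T, ∀ c : ℝ, 0 ≤ c → c • v ∈ T)
    (hc : IsClosed T) : IsClosed (coneImage T) := by
  rw [isClosed_iff_preimage]
  have : toRP3 ⁻¹' coneImage T = Subtype.val ⁻¹' T ∪ (fun v : { v : V // v ≠ 0 } => -v.1) ⁻¹' T := by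
    ext v
    exact mk_mem_coneImage hT v.2
  rw [this]
  exact (hc.preimage continuous_subtype_val).union (hc.preimage continuous_subtype_val.neg)

namespace IsMeridianLift

variable {L : Set Cyl} {Λ : Set RP3}

theorem subset_closedCover (h : IsMeridianLift L Λ) : L ⊆ closedCover :=
  fun y hy => (h.norm_eq y hy).le

theorem vec_mem_dualCone (h : IsMeridianLift L Λ) {y : Cyl} (hy : y ∈ L) : vec y ∈ dualCone L :=
  fun y' hy' => form_nonpos_of_abs_le (h.subset_closedCover hy) (h.subset_closedCover hy')
    (h.abs_le y hy y' hy')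

/-- Achronality puts each `vec y` with `y ∈ L` in the dual cone, so a vector of the bidual pairs
nonpositively with it. -/
theorem hullCone_subset_dualCone (h : IsMeridianLift L Λ) : hullCone L ⊆ dualCone L :=
  fun v hv y hy => by rw [form_comm]; exact hv _ (h.vec_mem_dualCone hy)

theorem exists_form_neg (h : IsMeridianLift L Λ) : ∃ z ∈ cover, ∀ y ∈ L, form (vec z) (vec y) < 0 := by
  obtain ⟨z, hz, hzL⟩ := h.exists_base
  exact ⟨z, hz, fun y hy => form_neg_of_abs_lt (hzL y hy)⟩

theorem vec_ne_neg_vec (h : IsMeridianLift L Λ) {y y' : Cyl} (hy : y ∈ L) (hy' : y' ∈ L) :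
    vec y' ≠ -vec y := fun h0 => by
  obtain ⟨z, -, hz⟩ := h.exists_form_neg
  have h1 := hz y hy
  have h2 := hz y' hy'
  rw [h0, form_neg_right] at h2
  linarith

/-- By compactness of `L`, strict negativity survives a small perturbation of `m`. Perturbing
towards `n` with `form n v > 0` still gives a nonpositive value at `v`, so the value of `m` itself
is negative. -/
theorem form_neg_of_mem_hullCone (h : IsMeridianLift L Λ) {m : V}
    (hm : ∀ y ∈ L, form m (vec y) < 0) {v : V} (hv : v ∈ hullCone L) (hv0 : v ≠ 0) :
    form m v < 0 := by
  obtain ⟨n, hn⟩ := exists_form_pos hv0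
  have hcont : Continuous fun p : ℝ × Cyl => form (m + p.1 • n) (vec p.2) := by
    have := continuous_vec
    fun_prop
  have hev : ∀ᶠ t in 𝓝 (0 : ℝ), ∀ y ∈ L, form (m + t • n) (vec y) < 0 := by
    refine h.isCompact.eventually_forall_of_forall_eventually fun y hy => ?_
    refine (hcont.tendsto (0, y)).eventually_lt_const ?_
    simpa using hm y hy
  obtain ⟨t, ht, hpos⟩ := ((hev.filter_mono nhdsWithin_le_nhds).and
    (self_mem_nhdsWithin : Ioi (0 : ℝ) ∈ 𝓝[>] 0)).exists
  have h1 := hv (m + t • n) fun y hy => (ht y hy).le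
  rw [form_add_left, form_smul_left] at h1
  have : 0 < t * form n v := mul_pos hpos hn
  linarith

/-- `L` has a point over the direction of the positive part of `m`, where Cauchy–Schwarz is an
equality. A vector whose positive part dominates cannot be negative there. -/
theorem exists_form_vec_eq (h : IsMeridianLift L Λ) {m : V} (hm : m 0 ^ 2 + m 1 ^ 2 ≠ 0) :
    ∃ y ∈ L, √(m 0 ^ 2 + m 1 ^ 2) * y.1 0 = m 0 ∧ √(m 0 ^ 2 + m 1 ^ 2) * y.1 1 = m 1 ∧
      form m (vec y) = √(m 0 ^ 2 + m 1 ^ 2) - (m 2 * Real.cos y.2 + m 3 * Real.sin y.2) := by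
  have hpos : 0 < m 0 ^ 2 + m 1 ^ 2 := lt_of_le_of_ne (by positivity) hm.symm
  have hr := Real.sq_sqrt hpos.le
  have hr0 := Real.sqrt_pos.2 hpos
  set r := √(m 0 ^ 2 + m 1 ^ 2)
  obtain ⟨y, hy, hyu⟩ := h.exists_mem !₂[m 0 / r, m 1 / r] (by
    have : ‖(!₂[m 0 / r, m 1 / r] : EuclideanSpace ℝ (Fin 2))‖ ^ 2 = 1 := by
      rw [norm_sq_eq_sum]
      simp only [Matrix.cons_val_zero, Matrix.cons_val_one, Matrix.cons_val_fin_one, div_pow]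
      rw [← add_div, hr, div_self hm]
    exact (pow_eq_one_iff_of_nonneg (norm_nonneg _) two_ne_zero).1 this)
  have h0 : y.1 0 = m 0 / r := by rw [hyu]; rfl
  have h1 : y.1 1 = m 1 / r := by rw [hyu]; rfl
  refine ⟨y, hy, by rw [h0]; field_simp, by rw [h1]; field_simp, ?_⟩
  have : m 0 * (m 0 / r) + m 1 * (m 1 / r) = r := by
    field_simp; linarith
  simp only [form, vec]
  simp [h0, h1]
  linarith

theorem cos_add_sin_sq_le (a b t : ℝ) :
    (a * Real.cos t + b * Real.sin t) ^ 2 ≤ a ^ 2 + b ^ 2 := by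
  have : a ^ 2 + b ^ 2 - (a * Real.cos t + b * Real.sin t) ^ 2
      = (a * Real.sin t - b * Real.cos t) ^ 2 := by
    linear_combination (-a ^ 2 - b ^ 2) * Real.sin_sq_add_cos_sq t
  nlinarith [sq_nonneg (a * Real.sin t - b * Real.cos t)]

theorem eq_zero_of_sq_add_sq_nonpos {a b : ℝ} (h : a ^ 2 + b ^ 2 ≤ 0) : a = 0 ∧ b = 0 :=
  ⟨pow_eq_zero_iff two_ne_zero |>.1 (by linarith [sq_nonneg a, sq_nonneg b]),
    pow_eq_zero_iff two_ne_zero |>.1 (by linarith [sq_nonneg a, sq_nonneg b])⟩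

theorem sum_sq_pos_of_form_nonneg {m : V} (hm : m ≠ 0) (h : 0 ≤ form m m) :
    0 < m 0 ^ 2 + m 1 ^ 2 := by
  by_contra! hle
  have h1 : m 2 ^ 2 + m 3 ^ 2 ≤ m 0 ^ 2 + m 1 ^ 2 := by simp only [form] at h; linarith
  obtain ⟨e0, e1⟩ := eq_zero_of_sq_add_sq_nonpos hle
  obtain ⟨e2, e3⟩ := eq_zero_of_sq_add_sq_nonpos (h1.trans hle)
  apply hm
  ext i; fin_cases i <;> assumption

theorem form_self_nonpos (h : IsMeridianLift L Λ) {m : V} (hm : m ∈ dualCone L) :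
    form m m ≤ 0 := by
  by_contra! hpos
  have h1 : m 2 ^ 2 + m 3 ^ 2 < m 0 ^ 2 + m 1 ^ 2 := by simp only [form] at hpos; linarith
  have h0 : 0 < m 0 ^ 2 + m 1 ^ 2 := lt_of_le_of_lt (by positivity) h1
  obtain ⟨y, hy, -, -, hf⟩ := h.exists_form_vec_eq h0.ne'
  have h2 := hm y hy
  have h3 := cos_add_sin_sq_le (m 2) (m 3) y.2
  have h4 := Real.sq_sqrt h0.le
  have h5 := Real.sqrt_pos.2 h0
  nlinarith

theorem form_self_neg (h : IsMeridianLift L Λ) {m : V} (hm : ∀ y ∈ L, form m (vec y) < 0) :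
    form m m < 0 := by
  by_contra! hpos
  have h1 : m 2 ^ 2 + m 3 ^ 2 ≤ m 0 ^ 2 + m 1 ^ 2 := by simp only [form] at hpos; linarith
  have hm0 : m ≠ 0 := by
    rintro rfl
    obtain ⟨y, hy⟩ := h.isConnected.nonempty
    have := hm y hy
    simp [form] at this
  have h0 := sum_sq_pos_of_form_nonneg hm0 hpos
  obtain ⟨y, hy, -, -, hf⟩ := h.exists_form_vec_eq h0.ne'
  have h2 := hm y hy
  have h3 := cos_add_sin_sq_le (m 2) (m 3) y.2
  have h4 := Real.sq_sqrt h0.le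
  have h5 := Real.sqrt_pos.2 h0
  nlinarith

/-! ### Degenerate position -/

/-- A line meets the unit circle in at most two points. -/
theorem eq_of_dot_eq {b0 b1 p0 p1 q0 q1 r0 r1 : ℝ} (hb : 0 < b0 ^ 2 + b1 ^ 2)
    (hp : p0 ^ 2 + p1 ^ 2 = 1) (hq : q0 ^ 2 + q1 ^ 2 = 1) (hr : r0 ^ 2 + r1 ^ 2 = 1)
    (hpq : b0 * p0 + b1 * p1 = b0 * q0 + b1 * q1) (hpr : b0 * p0 + b1 * p1 = b0 * r0 + b1 * r1) :
    (p0 = q0 ∧ p1 = q1) ∨ (p0 = r0 ∧ p1 = r1) ∨ (q0 = r0 ∧ q1 = r1) := by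
  have key : ∀ p0 p1 q0 q1 : ℝ, b0 * p0 + b1 * p1 = b0 * q0 + b1 * q1 →
      b0 * p1 - b1 * p0 = b0 * q1 - b1 * q0 → p0 = q0 ∧ p1 = q1 := by
    intro p0 p1 q0 q1 h1 h2
    constructor
    · apply mul_left_cancel₀ hb.ne'
      linear_combination b0 * h1 - b1 * h2
    · apply mul_left_cancel₀ hb.ne'
      linear_combination b1 * h1 + b0 * h2
  have sq1 : (b0 * p1 - b1 * p0) ^ 2 = (b0 * q1 - b1 * q0) ^ 2 := by
    linear_combination (b0 ^ 2 + b1 ^ 2) * hp - (b0 ^ 2 + b1 ^ 2) * hq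
      - (b0 * p0 + b1 * p1 + b0 * q0 + b1 * q1) * hpq
  have sq2 : (b0 * p1 - b1 * p0) ^ 2 = (b0 * r1 - b1 * r0) ^ 2 := by
    linear_combination (b0 ^ 2 + b1 ^ 2) * hp - (b0 ^ 2 + b1 ^ 2) * hr
      - (b0 * p0 + b1 * p1 + b0 * r0 + b1 * r1) * hpr
  rcases sq_eq_sq_iff_eq_or_eq_neg.1 sq1 with e1 | e1
  · exact Or.inl (key _ _ _ _ hpq e1)
  rcases sq_eq_sq_iff_eq_or_eq_neg.1 sq2 with e2 | e2
  · exact Or.inr (Or.inl (key _ _ _ _ hpr e2))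
  · exact Or.inr (Or.inr (key _ _ _ _ (hpq.symm.trans hpr) (by linarith)))

theorem vec_eq_of {z y : Cyl} {c : ℝ} (h0 : z.1 0 = c * y.1 0) (h1 : z.1 1 = c * y.1 1)
    (h2 : Real.cos z.2 = c * Real.cos y.2) (h3 : Real.sin z.2 = c * Real.sin y.2) :
    vec z = c • vec y := by
  ext i
  fin_cases i <;> simp [vec, h0, h1, h2, h3]

/-- A meridian contained in a projective plane bounds a spacelike plane. -/
theorem boundsSpacelikePlane (h : IsMeridianLift L Λ) {n : V} (hn : n ≠ 0)
    (hnL : ∀ y ∈ L, form n (vec y) = 0) : BoundsSpacelikePlane Λ := by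
  -- Otherwise the points of `L` over the directions of `n` and `-n` are forced to have opposite
  -- vectors, although both pair negatively with a common base point.
  have hneg : form n n < 0 := by
    by_contra! hpos
    have h1 : n 2 ^ 2 + n 3 ^ 2 ≤ n 0 ^ 2 + n 1 ^ 2 := by simp only [form] at hpos; linarith
    have h0 := sum_sq_pos_of_form_nonneg hn hpos
    have hr := Real.sq_sqrt h0.le
    have hr0 := Real.sqrt_pos.2 h0
    obtain ⟨y, hy, a0, a1, hf⟩ := h.exists_form_vec_eq h0.ne'
    have h0' : (-n) 0 ^ 2 + (-n) 1 ^ 2 ≠ 0 := by simpa using h0.ne'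
    obtain ⟨y', hy', b0, b1, hf'⟩ := h.exists_form_vec_eq h0'
    rw [form_neg_left, hnL y' hy'] at hf'
    rw [hnL y hy] at hf
    simp only [Pi.neg_apply, neg_sq] at b0 b1 hf'
    set r := √(n 0 ^ 2 + n 1 ^ 2)
    have hs := Real.sin_sq_add_cos_sq y.2
    have hs' := Real.sin_sq_add_cos_sq y'.2
    have k1 : (r * Real.cos y.2 - n 2) ^ 2 + (r * Real.sin y.2 - n 3) ^ 2
        = n 2 ^ 2 + n 3 ^ 2 - r ^ 2 := by
      linear_combination r ^ 2 * hs - 2 * r * hf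
    have k2 : (r * Real.cos y'.2 + n 2) ^ 2 + (r * Real.sin y'.2 + n 3) ^ 2
        = n 2 ^ 2 + n 3 ^ 2 - r ^ 2 := by
      linear_combination r ^ 2 * hs' - 2 * r * hf'
    obtain ⟨c1, c2⟩ := eq_zero_of_sq_add_sq_nonpos (k1.trans_le (by linarith))
    obtain ⟨c3, c4⟩ := eq_zero_of_sq_add_sq_nonpos (k2.trans_le (by linarith))
    refine h.vec_ne_neg_vec hy hy' ?_
    rw [← neg_one_smul ℝ (vec y)]
    apply vec_eq_of <;> apply mul_left_cancel₀ hr0.ne' <;> linarith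
  refine ⟨Projectivization.mk ℝ n hn, (mk_mem_space hn).2 hneg, ?_⟩
  apply Subset.antisymm
  · rw [← h.image_eq]
    rintro _ ⟨y, hy, rfl⟩
    exact ⟨(mk_mem_dualPlane hn _).2 (hnL y hy), proj_mem_boundary.2 (h.norm_eq y hy)⟩
  · rintro x ⟨hx, hxb⟩
    obtain ⟨z, -, rfl⟩ := exists_proj_eq (Or.inr hxb)
    rw [proj_mem_boundary] at hxb
    have hz : form n (vec z) = 0 := (mk_mem_dualPlane hn _).1 hx
    obtain ⟨y, hy, hyz⟩ := h.exists_mem z.1 hxb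
    obtain ⟨y', hy', hyz'⟩ := h.exists_mem (-z.1) (by rwa [norm_neg])
    have e1 := hnL y hy
    have e2 := hnL y' hy'
    simp only [form, vec] at hz e1 e2
    simp only [hyz, hyz'] at e1 e2
    simp at hz e1 e2
    have hb : 0 < n 2 ^ 2 + n 3 ^ 2 := by
      simp only [form] at hneg
      nlinarith [sq_nonneg (n 0), sq_nonneg (n 1)]
    have hcs : ∀ t : ℝ, Real.cos t ^ 2 + Real.sin t ^ 2 = 1 := fun t => Real.cos_sq_add_sin_sq t
    -- With `y` over `z.1` and `y'` over `-z.1`, the time parts of `z`, `y` and minus that of `y'`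
    -- lie on one line. If the last two coincided, `vec y'` would be `-vec y`.
    have hor := eq_of_dot_eq hb (p0 := Real.cos z.2) (p1 := Real.sin z.2) (q0 := Real.cos y.2)
      (q1 := Real.sin y.2) (r0 := -Real.cos y'.2) (r1 := -Real.sin y'.2) (hcs _) (hcs _)
      (by rw [neg_sq, neg_sq]; exact hcs _) (by linarith) (by linarith)
    rw [← h.image_eq]
    rcases hor with ⟨g1, g2⟩ | ⟨g1, g2⟩ | ⟨g1, g2⟩
    · refine ⟨y, hy, (mk_eq_mk_iff _ _).2 ⟨1, one_ne_zero, vec_eq_of ?_ ?_ ?_ ?_⟩⟩ <;>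
        simp [hyz, g1, g2]
    · refine ⟨y', hy', (mk_eq_mk_iff _ _).2 ⟨-1, by norm_num, vec_eq_of ?_ ?_ ?_ ?_⟩⟩ <;>
        simp [hyz', g1, g2]
    · refine absurd ?_ (h.vec_ne_neg_vec hy hy')
      rw [← neg_one_smul ℝ (vec y)]
      apply vec_eq_of <;> simp [hyz, hyz', g1, g2]

/-- Off the degenerate case `vec '' L` spans. The sum of a basis taken from it pairs nonpositively
with the dual cone, and vanishes only on a vector orthogonal to the whole basis, which is zero. -/
theorem exists_form_neg_dualCone (h : IsMeridianLift L Λ) (hΛ : ¬ BoundsSpacelikePlane Λ) :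
    ∃ w ∈ dualCone L, ∀ m ∈ dualCone L, m ≠ 0 → form w m < 0 := by
  have hspan : Submodule.span ℝ (vec '' L) = ⊤ := by
    by_contra hne
    obtain ⟨f, hf0, hf⟩ := Submodule.exists_le_ker_of_lt_top _ (lt_top_iff_ne_top.2 hne)
    obtain ⟨n, hn⟩ := exists_form_eq f
    refine hΛ (h.boundsSpacelikePlane (n := n) ?_ fun y hy => ?_)
    · rintro rfl
      refine hf0 (LinearMap.ext fun v => ?_)
      rw [← hn]
      simp [form]
    · rw [hn]
      exact hf (Submodule.subset_span (mem_image_of_mem _ hy))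
  obtain ⟨f, hfmem, hfspan, -⟩ := Submodule.exists_fun_fin_finrank_span_eq ℝ (vec '' L)
  have hform : ∀ m, form (∑ i, f i) m = ∑ i, form (f i) m := fun m => by
    simp only [form_comm _ m, ← formLin_apply, map_sum]
  have hle : ∀ i, ∀ m ∈ dualCone L, form (f i) m ≤ 0 := by
    intro i m hm
    obtain ⟨y, hy, hyf⟩ := hfmem i
    rw [← hyf, form_comm]; exact hm y hy
  have hle' : ∀ m ∈ dualCone L, form (∑ i, f i) m ≤ 0 := fun m hm => by
    rw [hform]; exact Finset.sum_nonpos fun i _ => hle i m hm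
  refine ⟨∑ i, f i, fun y hy => hle' _ (h.vec_mem_dualCone hy), fun m hm hm0 => ?_⟩
  refine lt_of_le_of_ne (hle' m hm) fun h0 => ?_
  rw [hform, Finset.sum_eq_zero_iff_of_nonpos fun i _ => hle i m hm] at h0
  obtain ⟨v, hv⟩ := exists_form_pos hm0
  have hker : Submodule.span ℝ (range f) ≤ LinearMap.ker (formLin m) := by
    rw [Submodule.span_le]
    rintro _ ⟨i, rfl⟩
    have := h0 i (Finset.mem_univ i)
    rwa [form_comm] at this
  have : v ∈ LinearMap.ker (formLin m) := hker (by rw [hfspan, hspan]; trivial)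
  have : form m v = 0 := this
  rw [form_comm] at hv
  linarith

end IsMeridianLift

end AdS
namespace AdS

/-! ### The invisible domain and the convex hull as projectivized cones -/

/-- Carathéodory in dimension 4: five points suffice, so the hull is a continuous image of a simplex
times five copies of `s`. Unused slots get weight 0 and the default point `p`. -/
theorem isCompact_convexHull_of_isCompact {s : Set V} (hs : IsCompact s) :
    IsCompact (convexHull ℝ s) := by
  rcases s.eq_empty_or_nonempty with rfl | ⟨p, hp⟩
  · simp
  have : convexHull ℝ s = (fun q : (Fin 5 → ℝ) × (Fin 5 → V) => ∑ i, q.1 i • q.2 i) ''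
      (stdSimplex ℝ (Fin 5) ×ˢ Set.pi univ fun _ => s) := by
    apply Subset.antisymm
    · intro x hx
      obtain ⟨ι, _, z, w, hz, hind, hw0, hw1, rfl⟩ := eq_pos_convex_span_of_mem_convexHull hx
      have hcard : Fintype.card ι ≤ Fintype.card (Fin 5) := by
        refine hind.card_le_finrank_succ.trans (Nat.succ_le_succ ((Submodule.finrank_le _).trans ?_))
        simp
      obtain ⟨e⟩ := Function.Embedding.nonempty_of_card_le hcard
      have hout : ∀ j ∉ range e, Function.extend e w 0 j = 0 := fun j hj => by
        rw [Function.extend_apply' _ _ _ hj]; rfl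
      refine ⟨(Function.extend e w 0, Function.extend e z fun _ => p), ⟨⟨fun j => ?_, ?_⟩, ?_⟩, ?_⟩
      · by_cases hj : j ∈ range e
        · obtain ⟨i, rfl⟩ := hj
          simp only [e.injective.extend_apply]
          exact (hw0 i).le
        · exact (hout j hj).ge
      · rw [← hw1]
        exact (Fintype.sum_of_injective e e.injective _ _ hout fun i =>
          (e.injective.extend_apply _ _ _).symm).symm
      · intro j _
        by_cases hj : j ∈ range e
        · obtain ⟨i, rfl⟩ := hj
          simp only [e.injective.extend_apply]
          exact hz (mem_range_self i)
        · simp only [Function.extend_apply' _ _ _ hj]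
          exact hp
      · refine (Fintype.sum_of_injective e e.injective _ _ (fun j hj => ?_) fun i => ?_).symm
        · simp only [hout j hj, zero_smul]
        · simp only [e.injective.extend_apply]
    · rintro _ ⟨⟨w, z⟩, ⟨hw, hz⟩, rfl⟩
      exact (convex_convexHull ℝ s).sum_mem (fun i _ => hw.1 i) hw.2 fun i _ =>
        subset_convexHull ℝ s (hz i (mem_univ i))
  rw [this]
  exact ((isCompact_stdSimplex ℝ (Fin 5)).prod (isCompact_univ_pi fun _ => hs)).image (by fun_prop)

theorem isPreconnected_coneImage {T : Set V} (hT : Convex ℝ T) (h0 : (0 : V) ∉ T) :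
    IsPreconnected (coneImage T) := by
  have h1 : coneImage T = toRP3 '' (Subtype.val ⁻¹' T) := by
    ext x
    constructor
    · rintro ⟨v, hv, hv0, rfl⟩
      exact ⟨⟨v, hv0⟩, hv, rfl⟩
    · rintro ⟨⟨v, hv0⟩, hv, rfl⟩
      exact ⟨v, hv, hv0, rfl⟩
  rw [h1]
  refine IsPreconnected.image ?_ _ continuous_toRP3.continuousOn
  have h2 : Subtype.val '' (Subtype.val ⁻¹' T : Set { v : V // v ≠ 0 }) = T :=
    image_preimage_eq_of_subset fun v hv => ⟨⟨v, fun h => h0 (h ▸ hv)⟩, rfl⟩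
  rw [← Topology.IsEmbedding.subtypeVal.isInducing.isPreconnected_image, h2]
  exact hT.isPreconnected

theorem coneImage_mono {S T : Set V} (h : S ⊆ T) : coneImage S ⊆ coneImage T := by
  rintro _ ⟨v, hv, hv0, rfl⟩
  exact ⟨v, h hv, hv0, rfl⟩

/-! ### The invisible domain as a projectivized open dual cone. -/

namespace IsProperAchronalMeridian

variable {L : Set Cyl} {Λ : Set RP3}

theorem invisibleDomain_eq (hΛ : IsProperAchronalMeridian Λ) :
    invisibleDomain Λ = {x | x ∈ space ∧ Disjoint (dualPlane x) Λ} := by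
  ext x
  constructor
  · rintro ⟨L, hL, z, hz, rfl⟩
    have h := hΛ.isMeridianLift hL
    rw [mem_coverInvisible_iff h.norm_eq] at hz
    refine ⟨proj_mem_space.2 hz.1, disjoint_left.2 fun x hx hxΛ => ?_⟩
    rw [← h.image_eq] at hxΛ
    obtain ⟨y, hy, rfl⟩ := hxΛ
    exact (form_neg_of_abs_lt (hz.2 y hy)).ne ((mk_mem_dualPlane _ _).1 hx)
  · rintro ⟨hx, hd⟩
    obtain ⟨L, hL⟩ := hΛ.exists_isLift
    have h := hΛ.isMeridianLift hL
    obtain ⟨z, -, rfl⟩ := exists_proj_eq (Or.inl hx)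
    obtain ⟨y₀, hy₀⟩ := h.isConnected.nonempty
    obtain ⟨z', hp, hz', hzL⟩ := exists_lift_abs_lt_arccos h.isConnected.isPreconnected
      h.subset_closedCover hy₀ (proj_mem_space.1 hx) fun y hy h0 =>
        disjoint_left.1 hd ((mk_mem_dualPlane _ _).2 h0) (h.image_eq ▸ mem_image_of_mem _ hy)
    exact ⟨L, hL, z', (mem_coverInvisible_iff h.norm_eq).2 ⟨hz', hzL⟩, hp⟩

end IsProperAchronalMeridian

namespace IsMeridianLift

variable {L : Set Cyl} {Λ : Set RP3}

theorem continuous_form_vec (v : V) : Continuous fun y => form v (vec y) := by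
  have := continuous_vec
  fun_prop

/-- A dual plane missing the connected set `L` leaves it on one side. Conversely a strict sign on
`L` already makes `v` timelike, by `form_self_neg`. -/
theorem mk_mem_invisibleDomain (h : IsMeridianLift L Λ) (hΛ : IsProperAchronalMeridian Λ) {v : V}
    (hv : v ≠ 0) : Projectivization.mk ℝ v hv ∈ invisibleDomain Λ ↔
      (∀ y ∈ L, form v (vec y) < 0) ∨ (∀ y ∈ L, 0 < form v (vec y)) := by
  rw [hΛ.invisibleDomain_eq]
  constructor
  · rintro ⟨-, hd⟩
    refine forall_neg_or_forall_pos h.isConnected.isPreconnected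
      (continuous_form_vec v).continuousOn fun y hy h0 => ?_
    exact disjoint_left.1 hd ((mk_mem_dualPlane hv _).2 h0) (h.image_eq ▸ mem_image_of_mem _ hy)
  · intro hor
    refine ⟨(mk_mem_space hv).2 ?_, disjoint_left.2 fun x hx hxΛ => ?_⟩
    · rcases hor with h1 | h1
      · exact h.form_self_neg h1
      · have := h.form_self_neg (m := -v) fun y hy => by
          rw [form_neg_left]; linarith [h1 y hy]
        rwa [form_neg_left, form_neg_right, neg_neg] at this
    · rw [← h.image_eq] at hxΛ
      obtain ⟨y, hy, rfl⟩ := hxΛ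
      have h0 := (mk_mem_dualPlane hv _).1 hx
      rcases hor with h1 | h1
      · exact (h1 y hy).ne h0
      · exact (h1 y hy).ne' h0

theorem isConvex_invisibleDomain (h : IsMeridianLift L Λ) (hΛ : IsProperAchronalMeridian Λ) :
    IsConvex (invisibleDomain Λ) := by
  obtain ⟨y₀, hy₀⟩ := h.isConnected.nonempty
  have hne : ∀ v : V, formLin (-vec y₀) v = 1 → v ≠ 0 := by
    rintro v hv rfl; simp [form] at hv
  -- The chart omits the plane dual to a point of `Λ`; its normalization selects the generators that
  -- are negative on `L`, so the slice is an intersection of half-spaces.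
  have hslice : slice (formLin (-vec y₀)) (invisibleDomain Λ)
      = {v | formLin (-vec y₀) v = 1} ∩ ⋂ y ∈ L, {v | formLin (vec y) v < 0} := by
    ext v
    simp only [mem_inter_iff, mem_iInter]
    constructor
    · rintro ⟨hv, hv0, hmem⟩
      refine ⟨hv, fun y hy => ?_⟩
      rcases (h.mk_mem_invisibleDomain hΛ hv0).1 hmem with h1 | h1
      · have := h1 y hy
        rwa [form_comm] at this
      · have h2 := h1 y₀ hy₀
        rw [formLin_apply, form_neg_left, form_comm] at hv
        linarith
    · rintro ⟨hv, hv2⟩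
      refine ⟨hv, hne v hv, (h.mk_mem_invisibleDomain hΛ (hne v hv)).2 (Or.inl fun y hy => ?_)⟩
      rw [form_comm]; exact hv2 y hy
  refine ⟨formLin (-vec y₀), fun h0 => ?_, fun x hx => ?_, ?_⟩
  · have := hne (vec y₀)
    obtain ⟨m, hm⟩ := exists_form_pos (vec_ne_zero y₀)
    have := LinearMap.congr_fun h0 m
    rw [formLin_apply, form_neg_left, form_comm] at this
    simp at this
    linarith
  · induction x using Projectivization.ind with | h v hv =>
    rw [mk_mem_affineChart hv, formLin_apply, form_neg_left, neg_ne_zero, form_comm]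
    rcases (h.mk_mem_invisibleDomain hΛ hv).1 hx with h1 | h1
    · exact (h1 y₀ hy₀).ne
    · exact (h1 y₀ hy₀).ne'
  · rw [hslice]
    exact (convex_hyperplane (formLin (-vec y₀)).isLinear 1).inter
      (convex_iInter₂ fun y _ => convex_halfSpace_lt (formLin (vec y)).isLinear 0)

theorem closure_invisibleDomain (h : IsMeridianLift L Λ) (hΛ : IsProperAchronalMeridian Λ) :
    closure (invisibleDomain Λ) = coneImage (dualCone L) := by
  apply Subset.antisymm
  · refine closure_minimal (fun x hx => ?_)
      (isClosed_coneImage (fun v hv c hc => smul_mem_dualCone hv hc) (isClosed_dualCone L))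
    induction x using Projectivization.ind with | h v hv =>
    rw [mk_mem_coneImage fun v hv c hc => smul_mem_dualCone hv hc]
    rcases (h.mk_mem_invisibleDomain hΛ hv).1 hx with h1 | h1
    · exact Or.inl fun y hy => (h1 y hy).le
    · exact Or.inr fun y hy => by rw [form_neg_left]; linarith [h1 y hy]
  · rintro _ ⟨m, hm, hm0, rfl⟩
    obtain ⟨z, -, hz⟩ := h.exists_form_neg
    obtain ⟨y₀, hy₀⟩ := h.isConnected.nonempty
    -- Adding a strictly negative vector pushes `m` inside; the absolute value keeps the curve
    -- nonzero on both sides of 0.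
    have hneg : ∀ t : ℝ, t ≠ 0 → ∀ y ∈ L, form (m + |t| • vec z) (vec y) < 0 := by
      intro t ht y hy
      rw [form_add_left, form_smul_left]
      have := mul_neg_of_pos_of_neg (abs_pos.2 ht) (hz y hy)
      linarith [hm y hy]
    have hne : ∀ t : ℝ, m + |t| • vec z ≠ 0 := by
      intro t h0
      by_cases ht : t = 0
      · subst ht; simp at h0; exact hm0 h0
      · have := hneg t ht y₀ hy₀
        rw [h0] at this
        simp [form] at this
    have hcont : Continuous fun t : ℝ => toRP3 ⟨m + |t| • vec z, hne t⟩ :=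
      continuous_toRP3.comp (Continuous.subtype_mk (by fun_prop) _)
    have h0 : toRP3 ⟨m + |(0 : ℝ)| • vec z, hne 0⟩ = Projectivization.mk ℝ m hm0 :=
      (mk_eq_mk_iff _ _).2 ⟨1, one_ne_zero, by simp⟩
    rw [← h0]
    refine mem_closure_of_tendsto (hcont.continuousAt.tendsto.mono_left
      (nhdsWithin_le_nhds (s := Ioi 0))) ?_
    filter_upwards [self_mem_nhdsWithin] with t ht
    exact (h.mk_mem_invisibleDomain hΛ _).2 (Or.inl (hneg t (ne_of_gt ht)))

theorem isProperConvex_invisibleDomain (h : IsMeridianLift L Λ) (hΛ : IsProperAchronalMeridian Λ)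
    (hb : ¬ BoundsSpacelikePlane Λ) : IsProperConvex (invisibleDomain Λ) := by
  obtain ⟨w, hw, hwneg⟩ := h.exists_form_neg_dualCone hb
  have hw0 : w ≠ 0 := by
    rintro rfl
    obtain ⟨y₀, hy₀⟩ := h.isConnected.nonempty
    have := hwneg _ (h.vec_mem_dualCone hy₀) (vec_ne_zero _)
    simp [form] at this
  refine ⟨h.isConvex_invisibleDomain hΛ, formLin w, fun h0 => ?_, ?_, ?_⟩
  · have := LinearMap.congr_fun h0 w
    have h2 := hwneg w hw hw0
    simp at this
    linarith
  · have := compactSpace_RP3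
    exact isClosed_closure.isCompact
  · rw [h.closure_invisibleDomain hΛ]
    rintro _ ⟨m, hm, hm0, rfl⟩
    exact (mk_mem_affineChart hm0 _).2 (hwneg m hm hm0).ne

/-! ### The convex hull as a projectivized bidual cone. -/

theorem exists_affineChart (h : IsMeridianLift L Λ) : ∃ f : V →ₗ[ℝ] ℝ, Λ ⊆ affineChart f := by
  obtain ⟨z, -, hz⟩ := h.exists_form_neg
  refine ⟨formLin (vec z), ?_⟩
  rw [← h.image_eq]
  rintro _ ⟨y, hy, rfl⟩
  exact (mk_mem_affineChart _ _).2 (hz y hy).ne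

/-- The bipolar theorem in the chart: `f` has a constant sign `e` on `L`, and the hull of the
compact slice is closed, so Hahn–Banach applies. In particular the hull does not depend on the
chart. -/
theorem hullIn_eq (h : IsMeridianLift L Λ) {f : V →ₗ[ℝ] ℝ} (hf : Λ ⊆ affineChart f) :
    hullIn f Λ = coneImage (hullCone L) := by
  obtain ⟨n, hn⟩ := exists_form_eq f
  have hne : ∀ y ∈ L, form n (vec y) ≠ 0 := fun y hy => by
    rw [hn, ← mk_mem_affineChart (vec_ne_zero y)]
    exact hf (h.image_eq ▸ mem_image_of_mem _ hy)
  obtain ⟨e, he, hpos⟩ : ∃ e : ℝ, e ^ 2 = 1 ∧ ∀ y ∈ L, 0 < e * form n (vec y) := by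
    rcases forall_neg_or_forall_pos h.isConnected.isPreconnected
      (continuous_form_vec n).continuousOn hne with h1 | h1
    · exact ⟨-1, by norm_num, fun y hy => by linarith [h1 y hy]⟩
    · exact ⟨1, by norm_num, fun y hy => by linarith [h1 y hy]⟩
  have he0 : e ≠ 0 := by rintro rfl; norm_num at he
  have hslice : slice f Λ = (fun y => (form n (vec y))⁻¹ • vec y) '' L := by
    ext v
    constructor
    · rintro ⟨hfv, hv, hmem⟩
      rw [← h.image_eq] at hmem
      obtain ⟨y, hy, hyv⟩ := hmem
      obtain ⟨c, hc, rfl⟩ := (mk_eq_mk_iff _ _).1 hyv.symm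
      refine ⟨y, hy, ?_⟩
      rw [← hn, form_smul_right] at hfv
      rw [eq_inv_of_mul_eq_one_left hfv]
    · rintro ⟨y, hy, rfl⟩
      refine ⟨?_, smul_ne_zero (inv_ne_zero (hne y hy)) (vec_ne_zero y), ?_⟩
      · show f ((form n (vec y))⁻¹ • vec y) = 1
        rw [← hn, form_smul_right, inv_mul_cancel₀ (hne y hy)]
      · rw [← h.image_eq]
        exact ⟨y, hy, (mk_eq_mk_iff _ _).2 ⟨form n (vec y), hne y hy, by
          rw [smul_smul, mul_inv_cancel₀ (hne y hy), one_smul]⟩⟩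
  have hcomp : IsCompact (convexHull ℝ (slice f Λ)) := by
    rw [hslice]
    refine isCompact_convexHull_of_isCompact (h.isCompact.image_of_continuousOn ?_)
    exact ((continuous_form_vec n).continuousOn.inv₀ hne).smul continuous_vec.continuousOn
  have hmulpos : ∀ y ∈ L, 0 < e * (form n (vec y))⁻¹ := fun y hy => by
    have h1 := inv_pos.2 (hpos y hy)
    have h2 : e⁻¹ = e := inv_eq_of_mul_eq_one_left (by rw [← sq, he])
    rwa [mul_inv, h2] at h1
  ext x
  constructor
  · rintro ⟨v, hv, hv0, rfl⟩
    refine ⟨e • v, fun m hm => ?_, smul_ne_zero he0 hv0, (mk_eq_mk_iff _ _).2 ⟨e, he0, rfl⟩⟩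
    have hsub : convexHull ℝ (slice f Λ) ⊆ {v | formLin (e • m) v ≤ 0} := by
      refine convexHull_min ?_ (convex_halfSpace_le (formLin (e • m)).isLinear 0)
      rw [hslice]
      rintro _ ⟨y, hy, rfl⟩
      show form (e • m) ((form n (vec y))⁻¹ • vec y) ≤ 0
      rw [form_smul_left, form_smul_right, ← mul_assoc]
      exact mul_nonpos_of_nonneg_of_nonpos (hmulpos y hy).le (hm y hy)
    have h1 : form (e • m) v ≤ 0 := hsub hv
    rwa [form_smul_left, ← form_smul_right] at h1
  · rintro ⟨v, hv, hv0, rfl⟩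
    have hfv : 0 < e * form n v := by
      have := h.form_neg_of_mem_hullCone (m := -(e • n))
        (fun y hy => by rw [form_neg_left, form_smul_left]; linarith [hpos y hy]) hv hv0
      rw [form_neg_left, form_smul_left] at this
      linarith
    have hfv0 : form n v ≠ 0 := fun h0 => by rw [h0, mul_zero] at hfv; exact lt_irrefl _ hfv
    refine ⟨(form n v)⁻¹ • v, ?_, smul_ne_zero (inv_ne_zero hfv0) hv0,
      (mk_eq_mk_iff _ _).2 ⟨_, inv_ne_zero hfv0, rfl⟩⟩
    by_contra hnot
    obtain ⟨g, u, hg1, hg2⟩ := geometric_hahn_banach_closed_point (convex_convexHull ℝ _)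
      hcomp.isClosed hnot
    obtain ⟨p, hp⟩ := exists_form_eq (g : V →ₗ[ℝ] ℝ)
    have hp' : ∀ v, form p v = g v := hp
    -- The affine inequality `g < u` on the hyperplane `f = 1` homogenizes to `p - u • n`; the
    -- factor `e` corrects for the sign of `f` on `L`.
    have hmem : e • (p + (-u) • n) ∈ dualCone L := by
      intro y hy
      have h1 := hg1 _ (subset_convexHull ℝ _ (hslice ▸ mem_image_of_mem _ hy))
      simp only [← hp', form_smul_right] at h1
      rw [form_smul_left, form_add_left, form_smul_left]
      have h2 := mul_lt_mul_of_pos_left h1 (hpos y hy)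
      have h3 : e * form n (vec y) * ((form n (vec y))⁻¹ * form p (vec y)) = e * form p (vec y) := by
        have := hne y hy
        field_simp
      rw [h3] at h2
      linarith
    have h1 := hv _ hmem
    rw [form_smul_left, form_add_left, form_smul_left] at h1
    rw [← hp', form_smul_right] at hg2
    have h2 := mul_lt_mul_of_pos_left hg2 hfv
    have h3 : e * form n v * ((form n v)⁻¹ * form p v) = e * form p v := by
      field_simp
    rw [h3] at h2
    linarith

/-! ### Duality between the invisible domain and the convex hull -/

/-- Every vector of the dual cone is a limit of strictly negative ones, obtained by adding small
multiples of a base vector. -/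
theorem mem_hullCone_of_forall_strict (h : IsMeridianLift L Λ) {v : V}
    (hv : ∀ m, (∀ y ∈ L, form m (vec y) < 0) → form m v ≤ 0) : v ∈ hullCone L := by
  intro m hm
  obtain ⟨z, -, hz⟩ := h.exists_form_neg
  have hc : Continuous fun t : ℝ => form (m + t • vec z) v := by fun_prop
  have ht : Filter.Tendsto (fun t : ℝ => form (m + t • vec z) v) (𝓝[>] 0) (𝓝 (form m v)) := by
    have := hc.tendsto 0
    simp only [zero_smul, add_zero] at this
    exact this.mono_left nhdsWithin_le_nhds
  refine le_of_tendsto ht ?_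
  filter_upwards [self_mem_nhdsWithin] with t ht
  refine hv _ fun y hy => ?_
  rw [form_add_left, form_smul_left]
  have := mul_neg_of_pos_of_neg (show (0 : ℝ) < t from ht) (hz y hy)
  linarith [hm y hy]

theorem mem_invisibleDomain_iff_disjoint (h : IsMeridianLift L Λ)
    (hΛ : IsProperAchronalMeridian Λ) {x : RP3} (hx : x ∈ space) :
    x ∈ invisibleDomain Λ ↔ Disjoint (dualPlane x) (coneImage (hullCone L)) := by
  constructor
  · induction x using Projectivization.ind with | h v hv =>
    rw [h.mk_mem_invisibleDomain hΛ hv]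
    intro hor
    rw [disjoint_right]
    rintro _ ⟨u, hu, hu0, rfl⟩ hmem
    rw [mk_mem_dualPlane] at hmem
    rcases hor with h1 | h1
    · exact (h.form_neg_of_mem_hullCone h1 hu hu0).ne hmem
    · have := h.form_neg_of_mem_hullCone (m := -v)
        (fun y hy => by rw [form_neg_left]; linarith [h1 y hy]) hu hu0
      rw [form_neg_left] at this
      linarith
  · intro hd
    rw [hΛ.invisibleDomain_eq]
    refine ⟨hx, hd.mono_right ?_⟩
    rw [← h.image_eq]
    rintro _ ⟨y, hy, rfl⟩
    exact ⟨vec y, vec_mem_hullCone hy, vec_ne_zero y, rfl⟩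

theorem mem_coneImage_hullCone_iff_disjoint (h : IsMeridianLift L Λ)
    (hΛ : IsProperAchronalMeridian Λ) {x : RP3} :
    x ∈ coneImage (hullCone L) ↔ Disjoint (dualPlane x) (invisibleDomain Λ) := by
  constructor
  · rintro ⟨v, hv, hv0, rfl⟩
    rw [disjoint_right]
    intro x hx hmem
    induction x using Projectivization.ind with | h m hm =>
    rw [mk_mem_dualPlane, form_comm] at hmem
    rcases (h.mk_mem_invisibleDomain hΛ hm).1 hx with h1 | h1
    · exact (h.form_neg_of_mem_hullCone h1 hv hv0).ne hmem
    · have := h.form_neg_of_mem_hullCone (m := -m)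
        (fun y hy => by rw [form_neg_left]; linarith [h1 y hy]) hv hv0
      rw [form_neg_left] at this
      linarith
  · induction x using Projectivization.ind with | h v hv =>
    intro hd
    have hne : ∀ m ∈ {m : V | ∀ y ∈ L, form m (vec y) < 0}, form m v ≠ 0 := by
      intro m hm h0
      have hm0 : m ≠ 0 := by
        rintro rfl
        obtain ⟨y, hy⟩ := h.isConnected.nonempty
        have := hm y hy
        simp [form] at this
      refine disjoint_right.1 hd ((h.mk_mem_invisibleDomain hΛ hm0).2 (Or.inl hm)) ?_
      rwa [mk_mem_dualPlane, form_comm]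
    have hconv : Convex ℝ {m : V | ∀ y ∈ L, form m (vec y) < 0} := by
      have : {m : V | ∀ y ∈ L, form m (vec y) < 0} = ⋂ y ∈ L, {m | formLin (vec y) m < 0} := by
        ext m; simp [form_comm m]
      rw [this]
      exact convex_iInter₂ fun y _ => convex_halfSpace_lt (formLin (vec y)).isLinear 0
    rw [mk_mem_coneImage fun v hv c hc => smul_mem_hullCone hv hc]
    -- The strict dual cone is convex, hence connected, so the nonvanishing pairing with `v` has one
    -- sign on it.
    rcases forall_neg_or_forall_pos hconv.isPreconnected
      (Continuous.continuousOn (by fun_prop)) hne with h1 | h1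
    · exact Or.inl (h.mem_hullCone_of_forall_strict fun m hm => (h1 m hm).le)
    · refine Or.inr (h.mem_hullCone_of_forall_strict fun m hm => ?_)
      rw [form_neg_right]
      linarith [h1 m hm]

end IsMeridianLift

end AdS
namespace AdS

/-! ### Signed versions of the notions of support and boundary -/

/-- `s` is a continuous section over `K` of the covering map. -/
def IsSection (s : RP3 → Cyl) (K : Set RP3) : Prop :=
  ContinuousOn s K ∧ ∀ x ∈ K, s x ∈ closedCover ∧ proj (s x) = x

/-- The plane dual to `x` is a support plane of `K` on its future side for `e = 1`, on its past
side for `e = -1`. -/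
def IsSignedSupport (e : ℝ) (x : RP3) (K : Set RP3) : Prop :=
  IsSupportPlane x K ∧ ∃ s, IsSection s K ∧ ∃ z ∈ closedCover, proj z = x ∧
    (∃ p ∈ K, e * ((s p).2 - z.2) = Real.arccos (inner ℝ z.1 (s p).1)) ∧
    ∀ p ∈ K, e * ((s p).2 - z.2) ≤ Real.arccos (inner ℝ z.1 (s p).1)

/-- The condition on `x` defining the future boundary component of `K` for `e = 1`, the past one
for `e = -1`. -/
def IsSignedBoundary (e : ℝ) (x : RP3) (K Λ : Set RP3) : Prop :=
  x ∈ K ∧ x ∈ frontier K ∧ x ∉ Λ ∧ ∀ s, IsSection s K → ∀ z ∈ closedCover,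
    IsSupportPlane (proj z) K → e * ((s x).2 - z.2) = Real.arccos (inner ℝ z.1 (s x).1) →
      ∀ p ∈ K, e * ((s p).2 - z.2) ≤ Real.arccos (inner ℝ z.1 (s p).1)

/-- The point `x` lies on the projection of `S₋` for `e = 1`, of `S₊` for `e = -1`. -/
def IsSignedHorizon (e : ℝ) (x : RP3) (Λ : Set RP3) : Prop :=
  ∃ L, IsLift L Λ ∧ ∃ z ∈ closedCover, proj z = x ∧
    (∃ y ∈ L, e * (y.2 - z.2) = Real.arccos (inner ℝ z.1 y.1)) ∧
    ∀ y ∈ L, e * (y.2 - z.2) ≤ Real.arccos (inner ℝ z.1 y.1)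

theorem IsSection.mono {s : RP3 → Cyl} {K K' : Set RP3} (h : IsSection s K) (hK : K' ⊆ K) :
    IsSection s K' :=
  ⟨h.1.mono hK, fun x hx => h.2 x (hK hx)⟩

theorem IsSection.isLift {s : RP3 → Cyl} {K : Set RP3} (h : IsSection s K) : IsLift (s '' K) K :=
  ⟨s, h.1, h.2, rfl⟩

/-- A spacelike plane has a past and a future vertex, exchanged by a shift of π in time. The shift
replaces `arccos c` by `π - arccos c`, which converts statements about the future of a plane into
the signed form with `e = -1`. -/
theorem exists_opposite {e : ℝ} (he : e ^ 2 = 1) (z : Cyl) :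
    ∃ z' : Cyl, proj z' = proj z ∧ z'.1 = -z.1 ∧ z'.2 = z.2 - e * Real.pi := by
  rcases sq_eq_one_iff.1 he with rfl | rfl
  · exact ⟨deck (-1) z, proj_deck _ _, by simp [deck], by simp [deck]; ring⟩
  · exact ⟨deck 1 z, proj_deck _ _, by simp [deck], by simp [deck]⟩

theorem isFutureSupportPlane_iff {n : RP3} {K : Set RP3} :
    IsFutureSupportPlane n K ↔ IsSignedSupport 1 n K := by
  refine and_congr_right fun _ => ?_
  constructor
  · rintro ⟨_, ⟨s, hs, hs', rfl⟩, z, hz, hzn, ⟨_, hy, p, hp, rfl⟩, hsub⟩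
    refine ⟨s, ⟨hs, hs'⟩, z, hz, hzn, ⟨p, hp, ?_⟩, fun p hp => ?_⟩
    · rw [one_mul]; exact ((mem_planeLift_iff hz).1 hy).2
    · rw [one_mul]; exact (mem_chronPast_union_iff hz (hs' p hp).1).1 (hsub (mem_image_of_mem s hp))
  · rintro ⟨s, hs, z, hz, hzn, ⟨p, hp, hpe⟩, hle⟩
    simp only [one_mul] at hpe hle
    refine ⟨s '' K, hs.isLift, z, hz, hzn, ⟨s p, ?_, mem_image_of_mem s hp⟩, ?_⟩
    · exact (mem_planeLift_iff hz).2 ⟨(hs.2 p hp).1, hpe⟩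
    · rintro _ ⟨p, hp, rfl⟩
      exact (mem_chronPast_union_iff hz (hs.2 p hp).1).2 (hle p hp)

theorem isPastSupportPlane_iff {n : RP3} {K : Set RP3} :
    IsPastSupportPlane n K ↔ IsSignedSupport (-1) n K := by
  refine and_congr_right fun _ => ?_
  constructor
  · rintro ⟨_, ⟨s, hs, hs', rfl⟩, z, hz, hzn, ⟨_, hy, p, hp, rfl⟩, hsub⟩
    obtain ⟨z', hz', h1, h2⟩ := exists_opposite (e := -1) (by norm_num) z
    have hz'c : z' ∈ closedCover := by show ‖z'.1‖ ≤ 1; rw [h1, norm_neg]; exact hz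
    refine ⟨s, ⟨hs, hs'⟩, z', hz'c, hz'.trans hzn, ⟨p, hp, ?_⟩, fun p hp => ?_⟩
    · rw [h1, h2, inner_neg_left, Real.arccos_neg]
      linarith [((mem_planeLift_iff hz).1 hy).2]
    · rw [h1, h2, inner_neg_left, Real.arccos_neg]
      linarith [(mem_chronFuture_union_iff hz (hs' p hp).1).1 (hsub (mem_image_of_mem s hp))]
  · rintro ⟨s, hs, z, hz, hzn, ⟨p, hp, hpe⟩, hle⟩
    obtain ⟨z', hz', h1, h2⟩ := exists_opposite (e := 1) (by norm_num) z
    have hz'c : z' ∈ closedCover := by show ‖z'.1‖ ≤ 1; rw [h1, norm_neg]; exact hz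
    refine ⟨s '' K, hs.isLift, z', hz'c, hz'.trans hzn, ⟨s p, ?_, mem_image_of_mem s hp⟩, ?_⟩
    · refine (mem_planeLift_iff hz'c).2 ⟨(hs.2 p hp).1, ?_⟩
      rw [h1, h2, inner_neg_left, Real.arccos_neg]
      linarith
    · rintro _ ⟨p, hp, rfl⟩
      refine (mem_chronFuture_union_iff hz'c (hs.2 p hp).1).2 ?_
      rw [h1, h2, inner_neg_left, Real.arccos_neg]
      linarith [hle p hp]

theorem mem_futureBoundary_iff {x : RP3} {K Λ : Set RP3} :
    x ∈ futureBoundary K Λ ↔ IsSignedBoundary 1 x K Λ := by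
  refine and_congr_right fun hx => and_congr_right fun _ => and_congr_right fun _ => ?_
  constructor
  · intro H s hs z hz hsupp heq p hp
    rw [one_mul] at heq ⊢
    have := H _ hs.isLift (s x) (mem_image_of_mem s hx) (hs.2 x hx).2 z hz hsupp
      ((mem_planeLift_iff hz).2 ⟨(hs.2 x hx).1, heq⟩)
    exact (mem_chronPast_union_iff hz (hs.2 p hp).1).1 (this (mem_image_of_mem s hp))
  · rintro H _ ⟨s, hs, hs', rfl⟩ _ ⟨x', hx', rfl⟩ hxx' z hz hsupp hmem
    rw [(hs' x' hx').2] at hxx'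
    subst hxx'
    rintro _ ⟨p, hp, rfl⟩
    have := H s ⟨hs, hs'⟩ z hz hsupp (by rw [one_mul]; exact ((mem_planeLift_iff hz).1 hmem).2) p hp
    rw [one_mul] at this
    exact (mem_chronPast_union_iff hz (hs' p hp).1).2 this

theorem mem_pastBoundary_iff {x : RP3} {K Λ : Set RP3} :
    x ∈ pastBoundary K Λ ↔ IsSignedBoundary (-1) x K Λ := by
  refine and_congr_right fun hx => and_congr_right fun _ => and_congr_right fun _ => ?_
  constructor
  · intro H s hs z hz hsupp heq p hp
    obtain ⟨z', hz', h1, h2⟩ := exists_opposite (e := 1) (by norm_num) z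
    have hz'c : z' ∈ closedCover := by show ‖z'.1‖ ≤ 1; rw [h1, norm_neg]; exact hz
    have h3 := H _ hs.isLift (s x) (mem_image_of_mem s hx) (hs.2 x hx).2 z' hz'c (hz' ▸ hsupp)
      ((mem_planeLift_iff hz'c).2 ⟨(hs.2 x hx).1, by
        rw [h1, h2, inner_neg_left, Real.arccos_neg]; linarith⟩)
    have h4 := (mem_chronFuture_union_iff hz'c (hs.2 p hp).1).1 (h3 (mem_image_of_mem s hp))
    rw [h1, h2, inner_neg_left, Real.arccos_neg] at h4
    linarith
  · rintro H _ ⟨s, hs, hs', rfl⟩ _ ⟨x', hx', rfl⟩ hxx' z hz hsupp hmem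
    rw [(hs' x' hx').2] at hxx'
    subst hxx'
    rintro _ ⟨p, hp, rfl⟩
    obtain ⟨z', hz', h1, h2⟩ := exists_opposite (e := -1) (by norm_num) z
    have hz'c : z' ∈ closedCover := by show ‖z'.1‖ ≤ 1; rw [h1, norm_neg]; exact hz
    have h3 := H s ⟨hs, hs'⟩ z' hz'c (hz'.symm ▸ hsupp) (by
      rw [h1, h2, inner_neg_left, Real.arccos_neg]
      linarith [((mem_planeLift_iff hz).1 hmem).2]) p hp
    rw [h1, h2, inner_neg_left, Real.arccos_neg] at h3
    exact (mem_chronFuture_union_iff hz (hs' p hp).1).2 (by linarith)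

/-! ### The horizons as attained extrema over a compact lift. -/

theorem IsMeridianLift.mem_coverSMinus_iff {L : Set Cyl} {Λ : Set RP3} (h : IsMeridianLift L Λ)
    {z : Cyl} : z ∈ coverSMinus L ↔ z ∈ closedCover ∧
      (∃ y ∈ L, 1 * (y.2 - z.2) = Real.arccos (inner ℝ z.1 y.1)) ∧
      ∀ y ∈ L, 1 * (y.2 - z.2) ≤ Real.arccos (inner ℝ z.1 y.1) := by
  refine and_congr_right fun hz => ?_
  have hd : ∀ y ∈ L, hemiDist y.1 z.1 = Real.arccos (inner ℝ z.1 y.1) := fun y hy => by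
    rw [hemiDist_eq_arccos (h.norm_eq y hy), real_inner_comm]
  have hc : Continuous fun y : Cyl => y.2 - hemiDist y.1 z.1 := by
    unfold hemiDist
    exact continuous_snd.sub (Real.continuous_arccos.comp (by fun_prop))
  constructor
  · intro H
    obtain ⟨y, hy, hye⟩ := H.mem_of_isClosed (h.isConnected.nonempty.image _)
      (h.isCompact.image hc).isClosed
    refine ⟨⟨y, hy, ?_⟩, fun y hy => ?_⟩
    · rw [← hd y hy]; simp only at hye; linarith
    · have := H.1 (mem_image_of_mem _ hy)
      rw [← hd y hy]; linarith
  · rintro ⟨⟨y, hy, hye⟩, H⟩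
    refine IsGreatest.isLUB ⟨⟨y, hy, ?_⟩, ?_⟩
    · simp only [hd y hy]; linarith
    · rintro _ ⟨y, hy, rfl⟩
      simp only [hd y hy]; linarith [H y hy]

theorem IsMeridianLift.mem_coverSPlus_iff {L : Set Cyl} {Λ : Set RP3} (h : IsMeridianLift L Λ)
    {z : Cyl} : z ∈ coverSPlus L ↔ z ∈ closedCover ∧
      (∃ y ∈ L, -1 * (y.2 - z.2) = Real.arccos (inner ℝ z.1 y.1)) ∧
      ∀ y ∈ L, -1 * (y.2 - z.2) ≤ Real.arccos (inner ℝ z.1 y.1) := by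
  refine and_congr_right fun hz => ?_
  have hd : ∀ y ∈ L, hemiDist y.1 z.1 = Real.arccos (inner ℝ z.1 y.1) := fun y hy => by
    rw [hemiDist_eq_arccos (h.norm_eq y hy), real_inner_comm]
  have hc : Continuous fun y : Cyl => y.2 + hemiDist y.1 z.1 := by
    unfold hemiDist
    exact continuous_snd.add (Real.continuous_arccos.comp (by fun_prop))
  constructor
  · intro H
    obtain ⟨y, hy, hye⟩ := H.mem_of_isClosed (h.isConnected.nonempty.image _)
      (h.isCompact.image hc).isClosed
    refine ⟨⟨y, hy, ?_⟩, fun y hy => ?_⟩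
    · rw [← hd y hy]; simp only at hye; linarith
    · have := H.1 (mem_image_of_mem _ hy)
      rw [← hd y hy]; linarith
  · rintro ⟨⟨y, hy, hye⟩, H⟩
    refine IsLeast.isGLB ⟨⟨y, hy, ?_⟩, ?_⟩
    · simp only [hd y hy]; linarith
    · rintro _ ⟨y, hy, rfl⟩
      simp only [hd y hy]; linarith [H y hy]

theorem IsProperAchronalMeridian.mem_SMinus_iff {Λ : Set RP3} (hΛ : IsProperAchronalMeridian Λ)
    {x : RP3} (hx : x ∈ space) : x ∈ SMinus Λ ↔ IsSignedHorizon 1 x Λ := by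
  constructor
  · rintro ⟨-, L, hL, z, hz, rfl⟩
    obtain ⟨h1, h2⟩ := (hΛ.isMeridianLift hL).mem_coverSMinus_iff.1 hz
    exact ⟨L, hL, z, h1, rfl, h2⟩
  · rintro ⟨L, hL, z, hz, rfl, h⟩
    exact ⟨hx, L, hL, z, (hΛ.isMeridianLift hL).mem_coverSMinus_iff.2 ⟨hz, h⟩, rfl⟩

theorem IsProperAchronalMeridian.mem_SPlus_iff {Λ : Set RP3} (hΛ : IsProperAchronalMeridian Λ)
    {x : RP3} (hx : x ∈ space) : x ∈ SPlus Λ ↔ IsSignedHorizon (-1) x Λ := by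
  constructor
  · rintro ⟨-, L, hL, z, hz, rfl⟩
    obtain ⟨h1, h2⟩ := (hΛ.isMeridianLift hL).mem_coverSPlus_iff.1 hz
    exact ⟨L, hL, z, h1, rfl, h2⟩
  · rintro ⟨L, hL, z, hz, rfl, h⟩
    exact ⟨hx, L, hL, z, (hΛ.isMeridianLift hL).mem_coverSPlus_iff.2 ⟨hz, h⟩, rfl⟩

end AdS
namespace AdS

namespace IsMeridianLift

variable {L : Set Cyl} {Λ : Set RP3}

/-! ### Support planes of projectivized cones -/

/-- The open half-space removes only the apex while keeping convexity, which makes the projectivized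
cone connected. -/
theorem coneImage_eq_inter {T : Set V} {w : V} (hw : ∀ v ∈ T, v ≠ 0 → form w v < 0) :
    coneImage T = coneImage (T ∩ {v | formLin w v < 0}) := by
  ext x
  constructor
  · rintro ⟨v, hv, hv0, rfl⟩
    exact ⟨v, ⟨hv, hw v hv hv0⟩, hv0, rfl⟩
  · rintro ⟨v, hv, hv0, rfl⟩
    exact ⟨v, hv.1, hv0, rfl⟩

theorem isPreconnected_coneImage_of_subset (h : IsMeridianLift L Λ)
    (hb : ¬ BoundsSpacelikePlane Λ) {T : Set V} (hT : T ⊆ dualCone L) (hc : Convex ℝ T) :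
    IsPreconnected (coneImage T) := by
  obtain ⟨w, -, hw⟩ := h.exists_form_neg_dualCone hb
  rw [coneImage_eq_inter fun v hv => hw v (hT hv)]
  refine isPreconnected_coneImage (hc.inter (convex_halfSpace_lt (formLin w).isLinear 0)) ?_
  rintro ⟨-, h0⟩
  simp [form] at h0

theorem convex_dualCone (L : Set Cyl) : Convex ℝ (dualCone L) :=
  fun _ hx _ hy _ _ ha hb _ =>
    add_mem_dualCone (smul_mem_dualCone hx ha) (smul_mem_dualCone hy hb)

theorem convex_hullCone (L : Set Cyl) : Convex ℝ (hullCone L) :=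
  fun _ hx _ hy _ _ ha hb _ =>
    add_mem_hullCone (smul_mem_hullCone hx ha) (smul_mem_hullCone hy hb)

/-- The form of a chart containing the projectivized cone cannot vanish on `T` minus its apex, so it
has constant sign there, and one-sidedness in the chart is one-sidedness on the cone. -/
theorem isSupportPlane_iff (h : IsMeridianLift L Λ) (hb : ¬ BoundsSpacelikePlane Λ) {T : Set V}
    (hT : T ⊆ dualCone L) (hc : Convex ℝ T) (hs : ∀ v ∈ T, ∀ c : ℝ, 0 ≤ c → c • v ∈ T) {n : V}
    (hn : n ≠ 0) : IsSupportPlane (Projectivization.mk ℝ n hn) (coneImage T) ↔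
      (∃ v ∈ T, v ≠ 0 ∧ form n v = 0) ∧ ((∀ v ∈ T, form n v ≤ 0) ∨ (∀ v ∈ T, 0 ≤ form n v)) := by
  obtain ⟨w, -, hw⟩ := h.exists_form_neg_dualCone hb
  obtain ⟨c, hc0, hrep⟩ := exists_rep_eq n hn
  constructor
  · rintro ⟨⟨_, hx, v, hv, hv0, rfl⟩, f, hf, hsgn⟩
    refine ⟨⟨v, hv, hv0, (mk_mem_dualPlane _ _).1 hx⟩, ?_⟩
    have hconv : IsPreconnected (T ∩ {v | formLin w v < 0}) :=
      (hc.inter (convex_halfSpace_lt (formLin w).isLinear 0)).isPreconnected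
    have hne0 : ∀ v ∈ T ∩ {v | formLin w v < 0}, v ≠ 0 := by
      rintro v ⟨-, h0⟩ rfl
      simp [form] at h0
    have hfne : ∀ v ∈ T ∩ {v | formLin w v < 0}, f v ≠ 0 := fun v hv =>
      (mk_mem_affineChart (hne0 v hv) f).1 (hf ⟨v, hv.1, hne0 v hv, rfl⟩)
    have hfc : Continuous f := f.continuous_of_finiteDimensional
    have hmem : ∀ v ∈ T ∩ {v | formLin w v < 0}, (f v)⁻¹ • v ∈ slice f (coneImage T) := by
      intro v hv
      refine ⟨?_, smul_ne_zero (inv_ne_zero (hfne v hv)) (hne0 v hv), v, hv.1, hne0 v hv, ?_⟩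
      · rw [map_smul, smul_eq_mul, inv_mul_cancel₀ (hfne v hv)]
      · refine (mk_eq_mk_iff _ _).2 ⟨f v, hfne v hv, ?_⟩
        rw [smul_smul, mul_inv_cancel₀ (hfne v hv), one_smul]
    have hall : ∀ {P : V → Prop}, P 0 → (∀ v ∈ T ∩ {v | formLin w v < 0}, P v) → ∀ v ∈ T, P v := by
      intro P h0 hP v hv
      by_cases hv0 : v = 0
      · rwa [hv0]
      · exact hP v ⟨hv, hw v (hT hv) hv0⟩
    have h00 : form n 0 = 0 := by simp [form]
    have hval : ∀ v, form (Projectivization.mk ℝ n hn).rep ((f v)⁻¹ • v)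
        = (c * (f v)⁻¹) * form n v := fun v => by
      rw [hrep, form_smul_left, form_smul_right]; ring
    rcases forall_neg_or_forall_pos hconv (f := fun v => c * (f v)⁻¹)
      (continuousOn_const.mul (hfc.continuousOn.inv₀ hfne))
      (fun v hv => mul_ne_zero hc0 (inv_ne_zero (hfne v hv))) with hd | hd <;>
    rcases hsgn with hsgn | hsgn
    · refine Or.inr (hall h00.ge fun v hv => ?_)
      have h1 := hsgn _ (hmem v hv)
      rw [hval] at h1
      exact nonneg_of_mul_nonpos_right h1 (hd v hv)
    · refine Or.inl (hall h00.le fun v hv => ?_)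
      have h1 := hsgn _ (hmem v hv)
      rw [hval] at h1
      exact nonpos_of_mul_nonneg_right h1 (hd v hv)
    · refine Or.inl (hall h00.le fun v hv => ?_)
      have h1 := hsgn _ (hmem v hv)
      rw [hval] at h1
      exact nonpos_of_mul_nonpos_right h1 (hd v hv)
    · refine Or.inr (hall h00.ge fun v hv => ?_)
      have h1 := hsgn _ (hmem v hv)
      rw [hval] at h1
      exact nonneg_of_mul_nonneg_right h1 (hd v hv)
  · rintro ⟨⟨v, hv, hv0, hnv⟩, hsgn⟩
    refine ⟨⟨Projectivization.mk ℝ v hv0, (mk_mem_dualPlane hn hv0).2 hnv, v, hv, hv0, rfl⟩,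
      formLin (-w), ?_, ?_⟩
    · rintro _ ⟨v, hv, hv0, rfl⟩
      rw [mk_mem_affineChart, formLin_apply, form_neg_left, neg_ne_zero]
      exact (hw v (hT hv) hv0).ne
    · have hmem : ∀ v ∈ slice (formLin (-w)) (coneImage T), v ∈ T := by
        rintro v ⟨hfv, hv0, hv⟩
        rcases (mk_mem_coneImage hs hv0).1 hv with h1 | h1
        · exact h1
        · have h2 := hw _ (hT h1) (neg_ne_zero.2 hv0)
          rw [formLin_apply, form_neg_left] at hfv
          rw [form_neg_right] at h2
          linarith
      simp only [hrep, form_smul_left]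
      rcases lt_or_gt_of_ne hc0 with hc0 | hc0 <;> rcases hsgn with hsgn | hsgn
      · exact Or.inr fun v hv => mul_nonneg_of_nonpos_of_nonpos hc0.le (hsgn v (hmem v hv))
      · exact Or.inl fun v hv => mul_nonpos_of_nonpos_of_nonneg hc0.le (hsgn v (hmem v hv))
      · exact Or.inl fun v hv => mul_nonpos_of_nonneg_of_nonpos hc0.le (hsgn v (hmem v hv))
      · exact Or.inr fun v hv => mul_nonneg hc0.le (hsgn v (hmem v hv))

theorem isSupportPlane_hullCone_iff (h : IsMeridianLift L Λ) (hb : ¬ BoundsSpacelikePlane Λ)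
    {n : V} (hn : n ≠ 0) :
    IsSupportPlane (Projectivization.mk ℝ n hn) (coneImage (hullCone L)) ↔
      (∃ v ∈ hullCone L, v ≠ 0 ∧ form n v = 0) ∧
        ((∀ v ∈ hullCone L, form n v ≤ 0) ∨ (∀ v ∈ hullCone L, 0 ≤ form n v)) :=
  h.isSupportPlane_iff hb h.hullCone_subset_dualCone (convex_hullCone L)
    (fun _ hv _ hc => smul_mem_hullCone hv hc) hn

theorem isSupportPlane_dualCone_iff (h : IsMeridianLift L Λ) (hb : ¬ BoundsSpacelikePlane Λ)
    {n : V} (hn : n ≠ 0) :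
    IsSupportPlane (Projectivization.mk ℝ n hn) (coneImage (dualCone L)) ↔
      (∃ v ∈ dualCone L, v ≠ 0 ∧ form n v = 0) ∧
        ((∀ v ∈ dualCone L, form n v ≤ 0) ∨ (∀ v ∈ dualCone L, 0 ≤ form n v)) :=
  h.isSupportPlane_iff hb subset_rfl (convex_dualCone L)
    (fun _ hv _ hc => smul_mem_dualCone hv hc) hn

/-! ### The frontier of the hull -/

/-- The unit vectors of the dual cone form a compact set, so strict negativity against all of them
is an open condition on `v`. -/
theorem mk_mem_interior {v : V} (hv0 : v ≠ 0)
    (hv : ∀ m ∈ dualCone L, m ≠ 0 → form m v < 0) :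
    Projectivization.mk ℝ v hv0 ∈ interior (coneImage (hullCone L)) := by
  have hcomp : IsCompact (dualCone L ∩ Metric.sphere 0 1) :=
    (isCompact_sphere (0 : V) 1).inter_left (isClosed_dualCone L)
  have hev : ∀ᶠ u in 𝓝 v, ∀ m ∈ dualCone L ∩ Metric.sphere 0 1, form m u < 0 := by
    refine hcomp.eventually_forall_of_forall_eventually fun m hm => ?_
    have hc : Continuous fun p : V × V => form p.2 p.1 := by fun_prop
    refine (hc.tendsto (v, m)).eventually_lt_const (hv m hm.1 ?_)
    rintro rfl
    simpa using hm.2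
  have hmem : hullCone L ∈ 𝓝 v := by
    filter_upwards [hev] with u hu m hm
    by_cases hm0 : m = 0
    · simp [hm0, form]
    · have hn : 0 < ‖m‖ := norm_pos_iff.2 hm0
      have := hu (‖m‖⁻¹ • m) ⟨smul_mem_dualCone hm (inv_pos.2 hn).le, by simp [norm_smul, hn.ne']⟩
      rw [form_smul_left] at this
      exact (pos_iff_neg_of_mul_neg this |>.1 (inv_pos.2 hn)).le
  have h1 : (Subtype.val ⁻¹' hullCone L : Set { v : V // v ≠ 0 }) ∈ 𝓝 ⟨v, hv0⟩ :=
    continuous_subtype_val.continuousAt.preimage_mem_nhds hmem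
  have h2 := isOpenMap_toRP3.image_mem_nhds h1
  refine mem_interior_iff_mem_nhds.2 (Filter.mem_of_superset h2 ?_)
  rintro _ ⟨u, hu, rfl⟩
  exact ⟨u.1, hu, u.2, rfl⟩

/-- Moving `v` slightly in a direction positive for `n` leaves the hull cone; the sign against `w`
excludes that the opposite vector has entered it. -/
theorem mk_notMem_interior (h : IsMeridianLift L Λ) (hb : ¬ BoundsSpacelikePlane Λ) {v n : V}
    (hv0 : v ≠ 0) (hv : v ∈ hullCone L) (hn : n ∈ dualCone L) (hn0 : n ≠ 0)
    (hnv : form n v = 0) :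
    Projectivization.mk ℝ v hv0 ∉ interior (coneImage (hullCone L)) := by
  intro hint
  obtain ⟨w, -, hw⟩ := h.exists_form_neg_dualCone hb
  obtain ⟨u, hu⟩ := exists_form_pos hn0
  rw [form_comm] at hu
  have hopen : IsOpen (Subtype.val '' (toRP3 ⁻¹' interior (coneImage (hullCone L)))) :=
    (isOpen_ne (x := (0 : V))).isOpenMap_subtype_val _ (isOpen_interior.preimage continuous_toRP3)
  have hvU : v ∈ Subtype.val '' (toRP3 ⁻¹' interior (coneImage (hullCone L))) :=
    ⟨⟨v, hv0⟩, hint, rfl⟩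
  have hct : Continuous fun t : ℝ => v + t • u := by fun_prop
  have e1 : ∀ᶠ t in 𝓝 (0 : ℝ), v + t • u ∈
      Subtype.val '' (toRP3 ⁻¹' interior (coneImage (hullCone L))) :=
    hct.continuousAt.eventually_mem (hopen.mem_nhds (by simpa using hvU))
  have e2 : ∀ᶠ t in 𝓝 (0 : ℝ), form w (v + t • u) < 0 := by
    have hc : Continuous fun t : ℝ => form w (v + t • u) := by fun_prop
    refine (hc.tendsto 0).eventually_lt_const ?_
    simpa using hw v (h.hullCone_subset_dualCone hv) hv0
  obtain ⟨t, ⟨ht1, ht2⟩, htpos⟩ := (((e1.and e2).filter_mono nhdsWithin_le_nhds).and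
    (self_mem_nhdsWithin : Ioi (0 : ℝ) ∈ 𝓝[>] 0)).exists
  obtain ⟨⟨q, hq0⟩, hq, hqe⟩ := ht1
  simp only at hqe
  subst hqe
  rcases (mk_mem_coneImage (fun v hv c hc => smul_mem_hullCone hv hc) hq0).1
    (interior_subset hq) with h1 | h1
  · have := h1 n hn
    rw [form_add_right, hnv, form_smul_right, zero_add] at this
    have := mul_pos (show (0 : ℝ) < t from htpos) hu
    linarith
  · have := hw _ (h.hullCone_subset_dualCone h1) (neg_ne_zero.2 hq0)
    rw [form_neg_right] at this
    linarith

/-! ### Sections over the closed invisible domain -/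

theorem coneImage_dualCone_subset (h : IsMeridianLift L Λ) :
    coneImage (dualCone L) ⊆ space ∪ boundary := by
  rintro _ ⟨v, hv, hv0, rfl⟩
  rcases (h.form_self_nonpos hv).lt_or_eq with h1 | h1
  · exact Or.inl ((mk_mem_space hv0).2 h1)
  · exact Or.inr ((mk_mem_boundary hv0).2 h1)

theorem subset_coneImage_hullCone (h : IsMeridianLift L Λ) : Λ ⊆ coneImage (hullCone L) := by
  rw [← h.image_eq]
  rintro _ ⟨y, hy, rfl⟩
  exact ⟨vec y, vec_mem_hullCone hy, vec_ne_zero y, rfl⟩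

/-- The vector `w` lies in the dual cone, so it is negative on itself: it is a point of anti-de
Sitter space whose dual plane misses the projectivized dual cone. -/
theorem exists_isSection_dualCone (h : IsMeridianLift L Λ) (hb : ¬ BoundsSpacelikePlane Λ) :
    ∃ s, IsSection s (coneImage (dualCone L)) := by
  obtain ⟨w, hwd, hw⟩ := h.exists_form_neg_dualCone hb
  have hw0 : w ≠ 0 := by
    rintro rfl
    obtain ⟨y₀, hy₀⟩ := h.isConnected.nonempty
    have := hw _ (h.vec_mem_dualCone hy₀) (vec_ne_zero _)
    simp [form] at this
  have hws := (mk_mem_space hw0).2 (hw w hwd hw0)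
  obtain ⟨z, -, hz⟩ := exists_proj_eq (Or.inl hws)
  rw [← hz, proj_mem_space] at hws
  obtain ⟨s, hs, H⟩ := exists_section hws h.coneImage_dualCone_subset (by
    rintro _ ⟨v, hv, hv0, rfl⟩
    rw [hz, mk_mem_dualPlane]
    exact (hw v hv hv0).ne)
  exact ⟨s, hs, fun x hx => ⟨(H x hx).1, (H x hx).2.1⟩⟩

variable {s : RP3 → Cyl} {K : Set RP3}

/-- A section picks one of two opposite generators. The pairing with `w` tells them apart, is
continuous and nonzero along the connected `K`, and is negative on `Λ`. -/
theorem vec_section_mem_dualCone (h : IsMeridianLift (s '' Λ) Λ) (hb : ¬ BoundsSpacelikePlane Λ)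
    (hs : IsSection s K) (hK : IsPreconnected K) (hΛK : Λ ⊆ K)
    (hKd : K ⊆ coneImage (dualCone (s '' Λ))) {x : RP3} (hx : x ∈ K) :
    vec (s x) ∈ dualCone (s '' Λ) := by
  obtain ⟨w, -, hw⟩ := h.exists_form_neg_dualCone hb
  have hor : ∀ x ∈ K, vec (s x) ∈ dualCone (s '' Λ) ∨ -vec (s x) ∈ dualCone (s '' Λ) := by
    intro x hx
    rw [← mk_mem_coneImage (fun v hv c hc => smul_mem_dualCone hv hc) (vec_ne_zero _)]
    have := (hs.2 x hx).2
    rw [proj] at this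
    rw [this]
    exact hKd hx
  have hne : ∀ x ∈ K, form w (vec (s x)) ≠ 0 := by
    intro x hx
    rcases hor x hx with h1 | h1
    · exact (hw _ h1 (vec_ne_zero _)).ne
    · have := hw _ h1 (neg_ne_zero.2 (vec_ne_zero _))
      rw [form_neg_right] at this
      linarith
  obtain ⟨_, x₀, hx₀, rfl⟩ := h.isConnected.nonempty
  have hneg : form w (vec (s x)) < 0 := forall_lt_of_isPreconnected hK
    ((continuous_form_vec w).comp_continuousOn hs.1) hne (hΛK hx₀)
    (hw _ (h.vec_mem_dualCone (mem_image_of_mem s hx₀)) (vec_ne_zero _)) x hx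
  rcases hor x hx with h1 | h1
  · exact h1
  · have := hw _ h1 (neg_ne_zero.2 (vec_ne_zero _))
    rw [form_neg_right] at this
    linarith

theorem mem_of_mem_coneImage_hullCone (h : IsMeridianLift L Λ) (hb : ¬ BoundsSpacelikePlane Λ)
    {v : V} (hv0 : v ≠ 0) (hv : v ∈ dualCone L)
    (hx : Projectivization.mk ℝ v hv0 ∈ coneImage (hullCone L)) : v ∈ hullCone L := by
  obtain ⟨w, -, hw⟩ := h.exists_form_neg_dualCone hb
  rcases (mk_mem_coneImage (fun v hv c hc => smul_mem_hullCone hv hc) hv0).1 hx with h1 | h1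
  · exact h1
  · have h2 := hw _ (h.hullCone_subset_dualCone h1) (neg_ne_zero.2 hv0)
    have h3 := hw _ hv hv0
    rw [form_neg_right] at h2
    linarith

/-- The images under a section of a point of the closed invisible domain and of a point of the hull
are not timelike related. -/
theorem abs_sub_section_le (h : IsMeridianLift (s '' Λ) Λ) (hb : ¬ BoundsSpacelikePlane Λ)
    (hs : IsSection s K) (hK : IsPreconnected K) (hΛK : Λ ⊆ K)
    (hKd : K ⊆ coneImage (dualCone (s '' Λ))) {x x' : RP3} (hx : x ∈ K) (hx' : x' ∈ K)
    (hx'h : x' ∈ coneImage (hullCone (s '' Λ))) :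
    |(s x).2 - (s x').2| < Real.pi ∧
      |(s x).2 - (s x').2| ≤ Real.arccos (inner ℝ (s x).1 (s x').1) := by
  obtain ⟨w, -, hw⟩ := h.exists_form_neg_dualCone hb
  have hd := fun x hx => h.vec_section_mem_dualCone hb hs hK hΛK hKd (x := x) hx
  have hv' : vec (s x') ∈ hullCone (s '' Λ) := by
    refine h.mem_of_mem_coneImage_hullCone hb (vec_ne_zero _) (hd x' hx') ?_
    have := (hs.2 x' hx').2
    rw [proj] at this
    rwa [this]
  have hle : ∀ x ∈ K, inner ℝ (s x).1 (s x').1 ≤ Real.cos ((s x).2 - (s x').2) := by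
    intro x hx
    have := hv' _ (hd x hx)
    rw [form_vec_vec] at this
    linarith
  -- Cosine -1 would force the inner product to be -1 as well, so the two vectors would be opposite;
  -- but both are negative on `w`.
  have hcos : ∀ x ∈ K, -1 < Real.cos ((s x).2 - (s x').2) := by
    intro x hx
    by_contra hle1
    have hc : Real.cos ((s x).2 - (s x').2) = -1 :=
      le_antisymm (not_lt.1 hle1) (Real.neg_one_le_cos _)
    have hi := hle x hx
    rw [hc, inner_eq_sum] at hi
    have n1 : (s x).1 0 ^ 2 + (s x).1 1 ^ 2 ≤ 1 := by
      have : ‖(s x).1‖ ≤ 1 := (hs.2 x hx).1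
      rw [← norm_sq_eq_sum]; nlinarith [norm_nonneg (s x).1]
    have n2 : (s x').1 0 ^ 2 + (s x').1 1 ^ 2 ≤ 1 := by
      have : ‖(s x').1‖ ≤ 1 := (hs.2 x' hx').1
      rw [← norm_sq_eq_sum]; nlinarith [norm_nonneg (s x').1]
    obtain ⟨a0, a1⟩ := eq_zero_of_sq_add_sq_nonpos
      (a := (s x).1 0 + (s x').1 0) (b := (s x).1 1 + (s x').1 1) (by linarith)
    rw [Real.cos_sub] at hc
    obtain ⟨a2, a3⟩ := eq_zero_of_sq_add_sq_nonpos
      (a := Real.cos (s x).2 + Real.cos (s x').2) (b := Real.sin (s x).2 + Real.sin (s x').2) (by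
        linarith [Real.sin_sq_add_cos_sq (s x).2, Real.sin_sq_add_cos_sq (s x').2])
    have hvec : vec (s x) = (-1 : ℝ) • vec (s x') := vec_eq_of (by linarith) (by linarith)
      (by linarith) (by linarith)
    have h1 := hw _ (hd x hx) (vec_ne_zero _)
    have h2 := hw _ (hd x' hx') (vec_ne_zero _)
    rw [hvec, form_smul_right] at h1
    linarith
  have hlt := abs_lt_pi_of_isPreconnected hK (f := fun x => (s x).2 - (s x').2)
    ((continuous_snd.comp_continuousOn hs.1).sub continuousOn_const) hcos hx'
    (by simpa using Real.pi_pos) x hx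
  exact ⟨hlt, abs_le_arccos hlt.le (hle x hx)⟩

/-! ### Time differences along the faces of a cone. -/

theorem arccos_pos_lt_pi {z y : Cyl} (hz : z ∈ cover) (hy : y ∈ closedCover) :
    0 < Real.arccos (inner ℝ z.1 y.1) ∧ Real.arccos (inner ℝ z.1 y.1) < Real.pi := by
  obtain ⟨h1, h2⟩ := abs_lt.1 (abs_inner_lt_one hz hy)
  exact ⟨Real.arccos_pos.2 h2, Real.arccos_lt_pi.2 h1⟩

theorem form_eq_zero_of_eq_arccos {e : ℝ} (he : e ^ 2 = 1) {z y : Cyl} (hz : z ∈ closedCover)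
    (hy : y ∈ closedCover) (h : e * (y.2 - z.2) = Real.arccos (inner ℝ z.1 y.1)) :
    form (vec z) (vec y) = 0 := by
  have hi := _root_.abs_le.1 (abs_inner_le_one hz hy)
  have hc : Real.cos (z.2 - y.2) = Real.cos (e * (y.2 - z.2)) := by
    rcases sq_eq_one_iff.1 he with rfl | rfl
    · rw [one_mul, ← Real.cos_neg, neg_sub]
    · congr 1; ring
  rw [form_vec_vec, hc, h, Real.cos_arccos hi.1 hi.2, sub_self]

theorem cos_eq_of_form_eq_zero {e : ℝ} (he : e ^ 2 = 1) {z y : Cyl}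
    (h : form (vec z) (vec y) = 0) : Real.cos (e * (y.2 - z.2)) = inner ℝ z.1 y.1 := by
  have hc : Real.cos (z.2 - y.2) = Real.cos (e * (y.2 - z.2)) := by
    rcases sq_eq_one_iff.1 he with rfl | rfl
    · rw [one_mul, ← Real.cos_neg, neg_sub]
    · congr 1; ring
  rw [form_vec_vec] at h
  linarith

/-- On a face cut out by the plane dual to a point `z` of the cover, the time difference with `z`
has constant sign. -/
theorem eq_arccos_of_mem_face (h : IsMeridianLift L Λ) (hb : ¬ BoundsSpacelikePlane Λ)
    (hs : IsSection s K) {T : Set V} (hT : T ⊆ dualCone L) (hTc : Convex ℝ T)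
    (hTK : coneImage T ⊆ K) {e : ℝ} (he : e ^ 2 = 1) {z : Cyl} (hz : z ∈ cover)
    (hTz : ∀ v ∈ T, form (vec z) v = 0) {p q : RP3} (hp : p ∈ coneImage T) (hq : q ∈ coneImage T)
    (hpe : e * ((s p).2 - z.2) = Real.arccos (inner ℝ z.1 (s p).1)) :
    e * ((s q).2 - z.2) = Real.arccos (inner ℝ z.1 (s q).1) := by
  have hcos : ∀ x ∈ coneImage T, Real.cos (e * ((s x).2 - z.2)) = inner ℝ z.1 (s x).1 := by
    rintro x hx
    refine cos_eq_of_form_eq_zero he ?_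
    obtain ⟨v, hv, hv0, hvx⟩ := hx
    have hpx := (hs.2 x (hTK ⟨v, hv, hv0, hvx⟩)).2
    rw [← hvx] at hpx
    obtain ⟨c, hc, hcv⟩ := (mk_eq_mk_iff _ _).1 hpx
    rw [← hvx, hcv, form_smul_right, hTz v hv, mul_zero]
  have hab : ∀ x ∈ coneImage T, -1 < inner ℝ z.1 (s x).1 ∧ inner ℝ z.1 (s x).1 < 1 := fun x hx =>
    abs_lt.1 (abs_inner_lt_one hz (hs.2 x (hTK hx)).1)
  have hpre := h.isPreconnected_coneImage_of_subset hb hT hTc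
  have hcont : ContinuousOn (fun x => e * ((s x).2 - z.2)) (coneImage T) :=
    continuousOn_const.mul (((continuous_snd.comp_continuousOn hs.1).sub
      continuousOn_const).mono hTK)
  obtain ⟨g1, g2⟩ := arccos_pos_lt_pi hz (hs.2 p (hTK hp)).1
  -- On the face the cosine of the time difference is an inner product in (-1, 1), since `z` is
  -- interior; so the difference never meets 0 or π.
  have h0 : 0 < e * ((s q).2 - z.2) := by
    refine forall_gt_of_isPreconnected hpre hcont (fun x hx h0 => ?_) hp (hpe ▸ g1) q hq
    have := hcos x hx
    rw [h0, Real.cos_zero] at this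
    linarith [(hab x hx).2]
  have hπ : e * ((s q).2 - z.2) < Real.pi := by
    refine forall_lt_of_isPreconnected hpre hcont (fun x hx h0 => ?_) hp (hpe ▸ g2) q hq
    have := hcos x hx
    rw [h0, Real.cos_pi] at this
    linarith [(hab x hx).1]
  rw [← hcos q hq, Real.arccos_cos h0.le hπ.le]

end IsMeridianLift

end AdS
namespace AdS

/-! ### Uniqueness of lifts of points and of sections. -/

theorem eq_of_abs_lt_arccos {z y y' : Cyl} (h : proj y = proj y')
    (hy : |z.2 - y.2| < Real.arccos (inner ℝ z.1 y.1))
    (hy' : |z.2 - y'.2| < Real.arccos (inner ℝ z.1 y'.1)) : y = y' := by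
  obtain ⟨k, rfl⟩ := eq_deck_of_proj_eq h
  have h1 := form_neg_of_abs_lt hy
  have h2 := form_neg_of_abs_lt hy'
  have hk2 : (deck k y').2 - y'.2 = k * Real.pi := by simp [deck]
  have hlt : |(deck k y').2 - y'.2| < 2 * Real.pi := by
    have a1 := hy.trans_le (Real.arccos_le_pi _)
    have a2 := hy'.trans_le (Real.arccos_le_pi _)
    rw [abs_lt] at a1 a2 ⊢
    constructor <;> linarith
  rw [hk2, abs_mul, abs_of_pos Real.pi_pos] at hlt
  have hk : |(k : ℝ)| < 2 := lt_of_mul_lt_mul_right hlt Real.pi_pos.le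
  have hk' : |k| < 2 := by exact_mod_cast hk
  rw [vec_deck, form_smul_right] at h1
  -- An odd translate would reverse the sign of the form with `vec z`. Since `|k| < 2`, only `k = 0`
  -- is left.
  have heven : Even k := by
    by_contra hodd
    rw [Int.not_even_iff_odd] at hodd
    rw [hodd.neg_one_zpow] at h1
    linarith
  obtain ⟨j, rfl⟩ := heven
  have : j = 0 := by rw [abs_lt] at hk'; omega
  subst this
  simp [deck]

/-- Two sections over a connected set differ by a deck transformation. -/
theorem IsSection.exists_deck {s s' : RP3 → Cyl} {K : Set RP3} (hs : IsSection s K)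
    (hs' : IsSection s' K) (hK : IsPreconnected K) : ∃ k : ℤ, ∀ p ∈ K, s p = deck k (s' p) := by
  rcases K.eq_empty_or_nonempty with rfl | ⟨p₀, hp₀⟩
  · exact ⟨0, by simp⟩
  have hk : ∀ p ∈ K, ∃ k : ℤ, s p = deck k (s' p) := fun p hp =>
    eq_deck_of_proj_eq ((hs.2 p hp).2.trans (hs'.2 p hp).2.symm)
  obtain ⟨k, hk₀⟩ := hk p₀ hp₀
  refine ⟨k, fun p hp => ?_⟩
  have hval : ∀ p ∈ K, ∃ j : ℤ, (s p).2 - (s' p).2 - k * Real.pi = j * Real.pi ∧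
      s p = deck (k + j) (s' p) := fun p hp => by
    obtain ⟨i, hi⟩ := hk p hp
    refine ⟨i - k, ?_, by rw [hi]; congr 1; ring⟩
    rw [hi]; simp only [deck]; push_cast; ring
  have hcont : ContinuousOn (fun p => (s p).2 - (s' p).2 - k * Real.pi) K :=
    ((continuous_snd.comp_continuousOn hs.1).sub
      (continuous_snd.comp_continuousOn hs'.1)).sub continuousOn_const
  have h0 : (s p₀).2 - (s' p₀).2 - k * Real.pi = 0 := by rw [hk₀]; simp only [deck]; ring
  have hsin : ∀ p ∈ K, Real.sin ((s p).2 - (s' p).2 - k * Real.pi) = 0 := fun p hp => by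
    obtain ⟨j, hj, -⟩ := hval p hp
    rw [hj]; exact Real.sin_int_mul_pi j
  have hπ := Real.pi_pos
  -- The difference takes values in multiples of π, so it cannot cross ±π/2.
  have hu := forall_lt_of_isPreconnected hK hcont (c := Real.pi / 2) (fun p hp h => by
    have := hsin p hp
    rw [h, Real.sin_pi_div_two] at this
    exact one_ne_zero this) hp₀ (by rw [h0]; positivity) p hp
  have hl := forall_gt_of_isPreconnected hK hcont (c := -(Real.pi / 2)) (fun p hp h => by
    have := hsin p hp
    rw [h, Real.sin_neg, Real.sin_pi_div_two] at this
    norm_num at this) hp₀ (by rw [h0]; linarith) p hp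
  obtain ⟨j, hj, hsj⟩ := hval p hp
  rw [hj] at hu hl
  have j1 : (j : ℝ) < 1 := by
    by_contra hle
    nlinarith [not_lt.1 hle]
  have j2 : (-1 : ℝ) < j := by
    by_contra hle
    nlinarith [not_lt.1 hle]
  have j1' : j < 1 := by exact_mod_cast j1
  have j2' : -1 < j := by exact_mod_cast j2
  have : j = 0 := by omega
  rw [hsj, this, add_zero]

/-! ### Duality of the boundary components. -/

namespace IsProperAchronalMeridian

variable {Λ : Set RP3} {f : V →ₗ[ℝ] ℝ} {e : ℝ}

/-- The horizons are the sets of points dual to support planes of the convex hull. -/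
theorem isSignedHorizon_iff (hΛ : IsProperAchronalMeridian Λ) (hb : ¬ BoundsSpacelikePlane Λ)
    (hf : Λ ⊆ affineChart f) (he : e ^ 2 = 1) {x : RP3} (hx : x ∈ space) :
    IsSignedHorizon e x Λ ↔ IsSignedSupport e x (hullIn f Λ) := by
  have habs : |e| = 1 := (pow_eq_one_iff_of_nonneg (abs_nonneg e) two_ne_zero).1 (by rwa [sq_abs])
  constructor
  · rintro ⟨L, hL, z, hzc, rfl, ⟨y₀, hy₀, hy₀e⟩, hle⟩
    have h := hΛ.isMeridianLift hL
    rw [h.hullIn_eq hf]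
    rw [proj_mem_space] at hx
    -- The opposite inequality comes from contact at `y₀`, the Lipschitz bound on `L` and the
    -- triangle inequality. Hence `vec z` is in the dual cone.
    have hbound : ∀ y ∈ L, |z.2 - y.2| ≤ Real.arccos (inner ℝ z.1 y.1) := by
      intro y hy
      have h1 := h.abs_le y₀ hy₀ y hy
      have h2 := arccos_inner_le_add_hemiDist (h.subset_closedCover hy₀) hzc (h.subset_closedCover hy)
      rw [hemiDist_comm, hemiDist_eq_arccos (h.norm_eq y hy), real_inner_comm, real_inner_comm z.1] at h2
      have h6 : inner ℝ y.1 z.1 = inner ℝ z.1 y.1 := real_inner_comm _ _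
      rw [h6] at h2
      have h3 := le_abs_self (e * (y₀.2 - y.2))
      rw [abs_mul, habs, one_mul] at h3
      have h4 : |z.2 - y.2| = |e * (y.2 - z.2)| := by rw [abs_mul, habs, one_mul, abs_sub_comm]
      rw [h4, abs_le]
      rw [real_inner_comm] at h1
      constructor
      · have h5 : e * (y.2 - z.2) = e * (y₀.2 - z.2) - e * (y₀.2 - y.2) := by ring
        rw [h5, hy₀e]
        linarith
      · exact hle y hy
    have hzd : vec z ∈ dualCone L := fun y hy =>
      form_nonpos_of_abs_le hzc (h.subset_closedCover hy) (hbound y hy)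
    have hzy₀ : form (vec z) (vec y₀) = 0 :=
      IsMeridianLift.form_eq_zero_of_eq_arccos he hzc (h.subset_closedCover hy₀) hy₀e
    refine ⟨(h.isSupportPlane_hullCone_iff hb (vec_ne_zero z)).2
      ⟨⟨vec y₀, vec_mem_hullCone hy₀, vec_ne_zero _, hzy₀⟩, Or.inl fun v hv => hv _ hzd⟩, ?_⟩
    obtain ⟨z₀, hz₀, hz₀L⟩ := h.exists_base
    have hz₀neg : ∀ y ∈ L, form (vec z₀) (vec y) < 0 := fun y hy => form_neg_of_abs_lt (hz₀L y hy)
    obtain ⟨s, hs, H⟩ := exists_section hz₀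
      ((coneImage_mono h.hullCone_subset_dualCone).trans h.coneImage_dualCone_subset) (by
        rintro _ ⟨v, hv, hv0, rfl⟩ hmem
        exact (h.form_neg_of_mem_hullCone hz₀neg hv hv0).ne ((mk_mem_dualPlane _ _).1 hmem))
    have hsec : IsSection s (coneImage (hullCone L)) := ⟨hs, fun p hp => ⟨(H p hp).1, (H p hp).2.1⟩⟩
    have hp₀ : proj y₀ ∈ coneImage (hullCone L) :=
      h.subset_coneImage_hullCone (h.image_eq ▸ mem_image_of_mem _ hy₀)
    have hsy₀ : s (proj y₀) = y₀ :=
      eq_of_abs_lt_arccos (z := z₀) (H _ hp₀).2.1 (by rw [abs_sub_comm]; exact (H _ hp₀).2.2)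
        (hz₀L y₀ hy₀)
    refine ⟨s, hsec, z, hzc, rfl, ⟨proj y₀, hp₀, by rw [hsy₀]; exact hy₀e⟩, ?_⟩
    have hsmem : ∀ p ∈ coneImage (hullCone L), vec (s p) ∈ hullCone L := by
      intro p hp
      have hps := (H p hp).2.1
      rw [proj] at hps
      have hneg : form (vec z₀) (vec (s p)) < 0 :=
        form_neg_of_abs_lt (by rw [abs_sub_comm]; exact (H p hp).2.2)
      rcases (mk_mem_coneImage (fun v hv c hc => smul_mem_hullCone hv hc) (vec_ne_zero (s p))).1
        (hps.symm ▸ hp) with h1 | h1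
      · exact h1
      · have := h.form_neg_of_mem_hullCone hz₀neg h1 (neg_ne_zero.2 (vec_ne_zero _))
        rw [form_neg_right] at this
        linarith
    have hcos : ∀ p ∈ coneImage (hullCone L), inner ℝ z.1 (s p).1 ≤ Real.cos (z.2 - (s p).2) := by
      intro p hp
      have := hsmem p hp _ hzd
      rw [form_vec_vec] at this
      linarith
    have hlt := abs_lt_pi_of_isPreconnected
      (h.isPreconnected_coneImage_of_subset hb h.hullCone_subset_dualCone
        (IsMeridianLift.convex_hullCone L))
      (f := fun p => z.2 - (s p).2)
      (continuousOn_const.sub (continuous_snd.comp_continuousOn hs))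
      (fun p hp => (abs_lt.1 (abs_inner_lt_one hx (H p hp).1)).1.trans_le (hcos p hp)) hp₀ (by
        rw [hsy₀]
        exact (hbound y₀ hy₀).trans_lt
          (IsMeridianLift.arccos_pos_lt_pi hx (h.subset_closedCover hy₀)).2)
    intro p hp
    have h1 := abs_le_arccos (hlt p hp).le (hcos p hp)
    have h2 := le_abs_self (e * ((s p).2 - z.2))
    rw [abs_mul, habs, one_mul, abs_sub_comm] at h2
    exact h2.trans h1
  · rintro ⟨-, s, hs, z, hzc, rfl, ⟨p₀, hp₀, hp₀e⟩, hle⟩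
    rw [proj_mem_space] at hx
    have hΛC : Λ ⊆ hullIn f Λ := by
      obtain ⟨L, hL⟩ := hΛ.exists_isLift
      have h := hΛ.isMeridianLift hL
      rw [h.hullIn_eq hf]
      exact h.subset_coneImage_hullCone
    have hL : IsLift (s '' Λ) Λ := (hs.mono hΛC).isLift
    have h := hΛ.isMeridianLift hL
    rw [h.hullIn_eq hf] at hs hp₀ hle hΛC
    have hzp₀ : form (vec z) (vec (s p₀)) = 0 :=
      IsMeridianLift.form_eq_zero_of_eq_arccos he hzc (hs.2 p₀ hp₀).1 hp₀e
    have hKpre := h.isPreconnected_coneImage_of_subset hb h.hullCone_subset_dualCone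
        (IsMeridianLift.convex_hullCone _)
    have hmem : ∀ p ∈ coneImage (hullCone (s '' Λ)), vec (s p) ∈ hullCone (s '' Λ) := by
      intro p hp
      refine h.mem_of_mem_coneImage_hullCone hb (vec_ne_zero _) (h.vec_section_mem_dualCone hb hs
        hKpre hΛC (coneImage_mono h.hullCone_subset_dualCone) hp) ?_
      have := (hs.2 p hp).2
      rw [proj] at this
      rwa [this]
    -- The contact point may be taken in `Λ`: a strict sign on `L` would persist on the nonzero
    -- vectors of the hull cone. The face argument then carries the time orientation from `p₀` to
    -- `p₁`.
    obtain ⟨p₁, hp₁, hzp₁⟩ : ∃ p ∈ Λ, form (vec z) (vec (s p)) = 0 := by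
      by_contra! hne
      rcases forall_neg_or_forall_pos h.isConnected.isPreconnected
        (IsMeridianLift.continuous_form_vec (vec z)).continuousOn
        (by rintro _ ⟨p, hp, rfl⟩; exact hne p hp) with h1 | h1
      · exact (h.form_neg_of_mem_hullCone h1 (hmem p₀ hp₀) (vec_ne_zero _)).ne hzp₀
      · have := h.form_neg_of_mem_hullCone (m := -vec z)
          (fun y hy => by rw [form_neg_left]; linarith [h1 y hy]) (hmem p₀ hp₀) (vec_ne_zero _)
        rw [form_neg_left, hzp₀] at this
        simp at this
    have hface : ∀ p ∈ coneImage (hullCone (s '' Λ)), form (vec z) (vec (s p)) = 0 →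
        p ∈ coneImage (hullCone (s '' Λ) ∩ {v | formLin (vec z) v = 0}) := fun p hp h0 =>
      ⟨vec (s p), ⟨hmem p hp, h0⟩, vec_ne_zero _, (hs.2 p hp).2⟩
    refine ⟨_, hL, z, hzc, rfl, ⟨s p₁, mem_image_of_mem s hp₁, ?_⟩, ?_⟩
    · exact h.eq_arccos_of_mem_face hb hs (inter_subset_left.trans h.hullCone_subset_dualCone)
        ((IsMeridianLift.convex_hullCone _).inter (convex_hyperplane (formLin (vec z)).isLinear 0))
        (coneImage_mono inter_subset_left) he hx (fun v hv => hv.2) (hface p₀ hp₀ hzp₀)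
        (hface p₁ (hΛC hp₁) hzp₁) hp₀e
    · rintro _ ⟨p, hp, rfl⟩
      exact hle p (hΛC hp)

/-- The boundary components of the convex hull are the sets of points dual to support planes of
the closed invisible domain. -/
theorem isSignedBoundary_iff (hΛ : IsProperAchronalMeridian Λ) (hb : ¬ BoundsSpacelikePlane Λ)
    (hf : Λ ⊆ affineChart f) (he : e ^ 2 = 1) {x : RP3} (hx : x ∈ space) :
    IsSignedBoundary e x (hullIn f Λ) Λ ↔ IsSignedSupport (-e) x (closure (invisibleDomain Λ)) := by
  have habs : |e| = 1 := (pow_eq_one_iff_of_nonneg (abs_nonneg e) two_ne_zero).1 (by rwa [sq_abs])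
  have hle_abs : ∀ a b : ℝ, e * (a - b) ≤ |a - b| := fun a b => by
    have := le_abs_self (e * (a - b))
    rwa [abs_mul, habs, one_mul] at this
  have hle_abs' : ∀ a b : ℝ, -e * (a - b) ≤ |a - b| := fun a b => by
    have := le_abs_self (-e * (a - b))
    rwa [abs_mul, abs_neg, habs, one_mul] at this
  obtain ⟨L₀, hL₀⟩ := hΛ.exists_isLift
  have h₀ := hΛ.isMeridianLift hL₀
  have hCK : hullIn f Λ ⊆ closure (invisibleDomain Λ) := by
    rw [h₀.hullIn_eq hf, h₀.closure_invisibleDomain hΛ]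
    exact coneImage_mono h₀.hullCone_subset_dualCone
  have hΛC : Λ ⊆ hullIn f Λ := by
    rw [h₀.hullIn_eq hf]
    exact h₀.subset_coneImage_hullCone
  have hKpre : IsPreconnected (closure (invisibleDomain Λ)) := by
    rw [h₀.closure_invisibleDomain hΛ]
    exact h₀.isPreconnected_coneImage_of_subset hb subset_rfl (IsMeridianLift.convex_dualCone _)
  have hCpre : IsPreconnected (hullIn f Λ) := by
    rw [h₀.hullIn_eq hf]
    exact h₀.isPreconnected_coneImage_of_subset hb h₀.hullCone_subset_dualCone
      (IsMeridianLift.convex_hullCone _)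
  have hdata : ∀ s, IsSection s (closure (invisibleDomain Λ)) →
      IsMeridianLift (s '' Λ) Λ ∧
      (∀ p ∈ closure (invisibleDomain Λ), vec (s p) ∈ dualCone (s '' Λ)) ∧
      (∀ p ∈ hullIn f Λ, vec (s p) ∈ hullCone (s '' Λ)) ∧
      ∀ p ∈ closure (invisibleDomain Λ), ∀ q ∈ hullIn f Λ, |(s p).2 - (s q).2| < Real.pi ∧
        |(s p).2 - (s q).2| ≤ Real.arccos (inner ℝ (s p).1 (s q).1) := by
    intro s hs
    have h := hΛ.isMeridianLift (hs.mono (hΛC.trans hCK)).isLift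
    have hKd := (h.closure_invisibleDomain hΛ).subset
    have hd := fun p hp => h.vec_section_mem_dualCone hb hs hKpre (hΛC.trans hCK) hKd (x := p) hp
    refine ⟨h, hd, fun p hp => ?_, fun p hp q hq =>
      h.abs_sub_section_le hb hs hKpre (hΛC.trans hCK) hKd hp (hCK hq) (h.hullIn_eq hf ▸ hq)⟩
    refine h.mem_of_mem_coneImage_hullCone hb (vec_ne_zero _) (hd p (hCK hp)) ?_
    have := (hs.2 p (hCK hp)).2
    rw [proj] at this
    rw [this, ← h.hullIn_eq hf]
    exact hp
  constructor
  · rintro ⟨hxC, hxf, -, hbd⟩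
    obtain ⟨s, hs⟩ := h₀.exists_isSection_dualCone hb
    rw [← h₀.closure_invisibleDomain hΛ] at hs
    obtain ⟨h, hd, hc, hpair⟩ := hdata s hs
    have hpx : proj (s x) = x := (hs.2 x (hCK hxC)).2
    have hsx : s x ∈ cover := by rwa [← proj_mem_space, hpx]
    have hvx := hc x hxC
    -- A frontier point of the hull is annihilated by some nonzero dual vector. Its class `q` is
    -- where the plane dual to `x` touches the closed invisible domain.
    obtain ⟨n, hn, hn0, hnv⟩ : ∃ n ∈ dualCone (s '' Λ), n ≠ 0 ∧ form n (vec (s x)) = 0 := by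
      by_contra! hne
      have := IsMeridianLift.mk_mem_interior (vec_ne_zero (s x)) fun m hm hm0 =>
        lt_of_le_of_ne (hvx m hm) (hne m hm hm0)
      rw [← h.hullIn_eq hf] at this
      refine hxf.2 ?_
      have h1 := hpx
      rw [proj] at h1
      rwa [h1] at this
    have hqK : Projectivization.mk ℝ n hn0 ∈ closure (invisibleDomain Λ) := by
      rw [h.closure_invisibleDomain hΛ]
      exact ⟨n, hn, hn0, rfl⟩
    set q := Projectivization.mk ℝ n hn0 with hq
    have hpm : proj (s q) = q := (hs.2 q hqK).2
    obtain ⟨c, hc0, hcn⟩ := (mk_eq_mk_iff _ _).1 hpm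
    have hmx : form (vec (s q)) (vec (s x)) = 0 := by rw [hcn, form_smul_left, hnv, mul_zero]
    have hmC : (s q) ∈ closedCover := (hs.2 q hqK).1
    obtain ⟨g1, g2⟩ := hpair q hqK x hxC
    have hcosmx := IsMeridianLift.cos_eq_of_form_eq_zero he hmx
    have habsmx : |e * ((s x).2 - (s q).2)| = Real.arccos (inner ℝ (s q).1 (s x).1) := by
      rw [← hcosmx, ← Real.cos_abs, Real.arccos_cos (abs_nonneg _)]
      rw [abs_mul, habs, one_mul, abs_sub_comm]
      exact g1.le
    have hsuppK : IsSupportPlane x (closure (invisibleDomain Λ)) := by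
      rw [h.closure_invisibleDomain hΛ, ← hpx]
      exact (h.isSupportPlane_dualCone_iff hb (vec_ne_zero _)).2
        ⟨⟨n, hn, hn0, by rw [form_comm]; exact hnv⟩, Or.inl fun v hv => by
          rw [form_comm]; exact hvx v hv⟩
    have hsuppC : IsSupportPlane (proj (s q)) (hullIn f Λ) := by
      rw [h.hullIn_eq hf]
      exact (h.isSupportPlane_hullCone_iff hb (vec_ne_zero _)).2
        ⟨⟨vec (s x), hvx, vec_ne_zero _, hmx⟩, Or.inl fun v hv => hv _ (hd q hqK)⟩
    -- Either `q` is on the expected side of `x`, or the boundary condition at `x` for the plane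
    -- dual to `q` bounds time on the other side too; then all of `Λ` lies in that plane, the
    -- excluded case.
    rcases abs_choice (e * ((s x).2 - (s q).2)) with hsgn | hsgn <;> rw [hsgn] at habsmx
    · refine ⟨hsuppK, s, hs, s x, (hs.2 x (hCK hxC)).1, hpx, ⟨q, hqK, ?_⟩, fun p hp => ?_⟩
      · rw [real_inner_comm, ← habsmx]; ring
      · rw [real_inner_comm]
        exact (hle_abs' _ _).trans (hpair p hp x hxC).2
    · exfalso
      obtain ⟨z, hzp, hz1, hz2⟩ := exists_opposite he (s q)
      have hzc : z ∈ closedCover := by show ‖z.1‖ ≤ 1; rw [hz1, norm_neg]; exact hmC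
      have hall := hbd s (hs.mono hCK) z hzc (hzp ▸ hsuppC) (by
        rw [hz1, hz2, inner_neg_left, Real.arccos_neg, ← habsmx]
        linear_combination Real.pi * he)
      refine hb (h.boundsSpacelikePlane (vec_ne_zero (s q)) ?_)
      rintro _ ⟨p, hp, rfl⟩
      have h1 := hall p (hΛC hp)
      rw [hz1, hz2, inner_neg_left, Real.arccos_neg] at h1
      have h2 := (hpair q hqK p (hΛC hp)).2
      have h3 := hle_abs (s q).2 (s p).2
      have h4 : e * ((s p).2 - ((s q).2 - e * Real.pi)) = -(e * ((s q).2 - (s p).2)) + Real.pi := by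
        linear_combination Real.pi * he
      rw [h4] at h1
      refine IsMeridianLift.form_eq_zero_of_eq_arccos (e := -e) (by rw [neg_sq, he]) hmC
        (hs.2 p (hCK (hΛC hp))).1 ?_
      linarith
  · rintro ⟨hsupp, s, hs, z, hzc, rfl, ⟨p₀, hp₀, hp₀e⟩, hle⟩
    have hzcov := proj_mem_space.1 hx
    have he' : (-e) ^ 2 = 1 := by rw [neg_sq, he]
    obtain ⟨h, hd, hc, hpair⟩ := hdata s hs
    have hzp₀ : form (vec z) (vec (s p₀)) = 0 :=
      IsMeridianLift.form_eq_zero_of_eq_arccos he' hzc (hs.2 p₀ hp₀).1 hp₀e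
    have hxC : proj z ∈ hullIn f Λ := by
      rw [h.closure_invisibleDomain hΛ] at hsupp
      rw [h.hullIn_eq hf, proj, mk_mem_coneImage fun v hv c hc => smul_mem_hullCone hv hc]
      rcases ((h.isSupportPlane_dualCone_iff hb (vec_ne_zero z)).1 hsupp).2 with h1 | h1
      · exact Or.inl fun m hm => by rw [form_comm]; exact h1 m hm
      · exact Or.inr fun m hm => by rw [form_comm, form_neg_left]; linarith [h1 m hm]
    -- The one-sided bound at `proj z` and the bounds through `p₀` put the two times within π of
    -- each other, so the lifts agree.
    have hsz : s (proj z) = z := by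
      refine eq_of_proj_eq_of_abs_lt (hs.2 _ (hCK hxC)).2 ?_
      have k1 := (hpair p₀ hp₀ _ hxC).1
      have k2 := (IsMeridianLift.arccos_pos_lt_pi hzcov (hs.2 p₀ hp₀).1).1
      have k3 := (hle _ (hCK hxC)).trans_lt
        (IsMeridianLift.arccos_pos_lt_pi hzcov (hs.2 _ (hCK hxC)).1).2
      have k4 := (hle_abs' (s p₀).2 (s (proj z)).2).trans_lt k1
      have k5 : |(s (proj z)).2 - z.2| = |-e * ((s (proj z)).2 - z.2)| := by
        rw [abs_mul, abs_neg, habs, one_mul]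
      rw [k5, abs_lt]
      exact ⟨by linarith, k3⟩
    have hvz : vec z ∈ hullCone (s '' Λ) := by
      have := hc _ hxC
      rwa [hsz] at this
    refine ⟨hxC, ⟨subset_closure hxC, ?_⟩, fun hxΛ => ?_, ?_⟩
    · rw [h.hullIn_eq hf]
      exact h.mk_notMem_interior hb (vec_ne_zero z) hvz (hd p₀ hp₀) (vec_ne_zero _)
        (by rw [form_comm]; exact hzp₀)
    · have h1 := proj_mem_boundary.1 (hΛ.1 hxΛ)
      have h2 : ‖z.1‖ < 1 := hzcov
      linarith
    · intro s' hs' z₁ hz₁ hsupp₁ heq p hp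
      -- Sections over the connected hull differ by a deck transformation, so an arbitrary one can
      -- be replaced by `s` once `z₁` is translated to `z₂`.
      obtain ⟨k, hk⟩ := (hs.mono hCK).exists_deck hs' hCpre
      set z₂ := deck k z₁ with hz₂
      have hz₂c : z₂ ∈ closedCover := by show ‖z₂.1‖ ≤ 1; rw [hz₂, norm_deck]; exact hz₁
      have hz₂p : proj z₂ = proj z₁ := proj_deck k z₁
      have htime : ∀ p ∈ hullIn f Λ, (s' p).2 - z₁.2 = (s p).2 - z₂.2 := fun p hp => by
        rw [hk p hp, hz₂]; simp only [deck]; ring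
      have hinner : ∀ p ∈ hullIn f Λ, inner ℝ z₁.1 (s' p).1 = inner ℝ z₂.1 (s p).1 := fun p hp => by
        rw [hk p hp, hz₂, inner_deck]
      rw [htime _ hxC, hinner _ hxC, hsz] at heq
      rw [htime _ hp, hinner _ hp]
      have hz₂z : form (vec z₂) (vec z) = 0 :=
        IsMeridianLift.form_eq_zero_of_eq_arccos he hz₂c hzc heq
      have hqK : proj z₂ ∈ closure (invisibleDomain Λ) := by
        rw [← hz₂p, h.hullIn_eq hf] at hsupp₁
        rw [h.closure_invisibleDomain hΛ, proj,
          mk_mem_coneImage fun v hv c hc => smul_mem_dualCone hv hc]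
        rcases ((h.isSupportPlane_hullCone_iff hb (vec_ne_zero z₂)).1 hsupp₁).2 with h1 | h1
        · exact Or.inl fun y hy => h1 _ (vec_mem_hullCone hy)
        · exact Or.inr fun y hy => by
            rw [form_neg_left]; linarith [h1 _ (vec_mem_hullCone hy)]
      have hpm : proj (s (proj z₂)) = proj z₂ := (hs.2 _ hqK).2
      obtain ⟨c, hc0, hcn⟩ := (mk_eq_mk_iff _ _).1 hpm
      have hface : ∀ p ∈ closure (invisibleDomain Λ), form (vec z) (vec (s p)) = 0 →
          p ∈ coneImage (dualCone (s '' Λ) ∩ {v | formLin (vec z) v = 0}) := fun p hp h0 =>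
        ⟨vec (s p), ⟨hd p hp, h0⟩, vec_ne_zero _, (hs.2 p hp).2⟩
      -- `p₀` and `proj z₂` lie on the same face, dual to `z`, so they are on the same side of `z`
      -- in time. This identifies `z₂` as the lift of its projection by `s`, and the general bound
      -- between the two cones concludes.
      have hm := h.eq_arccos_of_mem_face hb hs inter_subset_left
        ((IsMeridianLift.convex_dualCone _).inter (convex_hyperplane (formLin (vec z)).isLinear 0))
        ((coneImage_mono inter_subset_left).trans (h.closure_invisibleDomain hΛ).superset) he'
        hzcov (fun v hv => hv.2) (hface p₀ hp₀ hzp₀)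
        (hface _ hqK (by rw [hcn, form_smul_right, form_comm, hz₂z, mul_zero])) hp₀e
      obtain ⟨b1, b2⟩ := IsMeridianLift.arccos_pos_lt_pi hzcov (hs.2 _ hqK).1
      obtain ⟨b3, b4⟩ := IsMeridianLift.arccos_pos_lt_pi hzcov hz₂c
      rw [real_inner_comm] at heq
      have hmz₂ : s (proj z₂) = z₂ := by
        refine eq_of_proj_eq_of_abs_lt hpm ?_
        have k5 : |(s (proj z₂)).2 - z₂.2| = |e * ((s (proj z₂)).2 - z₂.2)| := by
          rw [abs_mul, habs, one_mul]
        rw [k5, abs_lt]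
        constructor <;> linarith
      have h1 := (hpair _ hqK p hp).2
      rw [hmz₂, abs_sub_comm] at h1
      exact (hle_abs _ _).trans h1

end IsProperAchronalMeridian

end AdS

/-! ### Convexity and duality for the invisible domain. -/

theorem mainTheorem11 (Λ : Set AdS.RP3) (hΛ : AdS.IsProperAchronalMeridian Λ) :
    -- the invisible domain is convex, and properly convex unless `Λ` bounds a spacelike plane
    AdS.IsConvex (AdS.invisibleDomain Λ) ∧
    (¬ AdS.BoundsSpacelikePlane Λ → AdS.IsProperConvex (AdS.invisibleDomain Λ)) ∧
    -- description of the invisible domain in the projective model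
    AdS.invisibleDomain Λ = {x | x ∈ AdS.space ∧ Disjoint (AdS.dualPlane x) Λ} ∧
    -- duality with the convex hull of `Λ`, taken in any affine chart containing `Λ`
    (∃ f : AdS.V →ₗ[ℝ] ℝ, Λ ⊆ AdS.affineChart f) ∧
    ∀ f : AdS.V →ₗ[ℝ] ℝ, Λ ⊆ AdS.affineChart f →
      (∀ x ∈ AdS.space,
        (x ∈ AdS.invisibleDomain Λ ↔ Disjoint (AdS.dualPlane x) (AdS.hullIn f Λ)) ∧
        (x ∈ AdS.hullIn f Λ ↔ Disjoint (AdS.dualPlane x) (AdS.invisibleDomain Λ))) ∧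
      (¬ AdS.BoundsSpacelikePlane Λ → ∀ x ∈ AdS.space,
        (x ∈ AdS.SPlus Λ ↔ AdS.IsPastSupportPlane x (AdS.hullIn f Λ)) ∧
        (x ∈ AdS.SMinus Λ ↔ AdS.IsFutureSupportPlane x (AdS.hullIn f Λ)) ∧
        (x ∈ AdS.futureBoundary (AdS.hullIn f Λ) Λ ↔
          AdS.IsPastSupportPlane x (closure (AdS.invisibleDomain Λ))) ∧
        (x ∈ AdS.pastBoundary (AdS.hullIn f Λ) Λ ↔
          AdS.IsFutureSupportPlane x (closure (AdS.invisibleDomain Λ)))) := by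
  obtain ⟨L, hL⟩ := hΛ.exists_isLift
  have h := hΛ.isMeridianLift hL
  refine ⟨h.isConvex_invisibleDomain hΛ, fun hb => h.isProperConvex_invisibleDomain hΛ hb,
    hΛ.invisibleDomain_eq, h.exists_affineChart, fun f hf => ⟨fun x hx => ?_, fun hb x hx => ?_⟩⟩
  · rw [h.hullIn_eq hf]
    exact ⟨h.mem_invisibleDomain_iff_disjoint hΛ hx, h.mem_coneImage_hullCone_iff_disjoint hΛ⟩
  · refine ⟨?_, ?_, ?_, ?_⟩
    · rw [hΛ.mem_SPlus_iff hx, AdS.isPastSupportPlane_iff]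
      exact hΛ.isSignedHorizon_iff hb hf (by norm_num) hx
    · rw [hΛ.mem_SMinus_iff hx, AdS.isFutureSupportPlane_iff]
      exact hΛ.isSignedHorizon_iff hb hf (by norm_num) hx
    · rw [AdS.mem_futureBoundary_iff, AdS.isPastSupportPlane_iff]
      exact hΛ.isSignedBoundary_iff hb hf (by norm_num) hx
    · rw [AdS.mem_pastBoundary_iff, AdS.isFutureSupportPlane_iff]
      have := hΛ.isSignedBoundary_iff (e := -1) hb hf (by norm_num) hx
      rwa [neg_neg] at this
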